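/- **Conventions.** For a vector bundle $E\to M$ write $\underline{E}$ for its space of smooth global sections. In Fréchet spaces, a curve is smooth if all its iterated derivatives exist, and a map between open sets is smooth if it sends smooth curves to smooth curves; Fréchet manifolds, Fréchet vector bundles, tangent vectors and the Lie bracket $[X,Y]=dY(X)-dX(Y)$ of vector fields are understood in this sense. A (Banach or Fréchet) *Lie algebroid* $(E,\pi,M,\rho)$ is a smooth vector bundle $\pi:E\to M$ (with Banach or Fréchet model spaces), a smooth vector bundle morphism $\rho:E\to TM$ over $\mathrm{id}_M$ (the anchor), and a real Lie algebra bracket $[\cdot,\cdot]_E$ on $\underline{E}$ such that, for all $s_1,s_2\in\underline{E}$ and $g\in C^\infty(M)$, $$\rho([s_1,s_2]_E)=[\rho(s_1),\rho(s_2)],\qquad [s_1,g s_2]_E=g[s_1,s_2]_E+(\rho(s_1)g)\,s_2 .$$ For a smooth $q$-form $\alpha$ on a Banach Lie algebroid $E$ (a smooth section of the bundle of continuous alternating $q$-forms on $E$), a smooth $(q+1)$-form $\eta$ is the exterior differential $d_\rho\alpha$ if, for all $s_0,\dots,s_q\in\underline{E}$, $$\eta(s_0,\dots,s_q)=\sum_i(-1)^i\rho(s_i)\big(\alpha(s_0,\dots,\widehat{s_i},\dots,s_q)\big)+\sum_{i<j}(-1)^{i+j}\alpha\big([s_i,s_j]_E,s_0,\dots,\widehat{s_i},\dots,\widehat{s_j},\dots,s_q\big).$$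 A vector bundle morphism $\psi:E\to E'$ is a *morphism of Lie algebroids* if every smooth form $\alpha'$ on $E'$ has an exterior differential $d_{\rho'}\alpha'$ and $\psi^*(d_{\rho'}\alpha')$ is the exterior differential of $\psi^*\alpha'$. **Strong projective systems.** Let $(E_i,\pi_i,M_i,\rho_i)_{i\in\mathbb N}$ be Banach Lie algebroids, $M_i$ modelled on the Banach space $\mathbb M_i$ and $E_i$ with fibre the Banach space $\mathbb E_i$. Assume that each $M_i$ is smoothly regular: for every neighbourhood $U$ of a point $x$ there is $g\in C^\infty(M_i)$ with $g(x)=1$ and $g=0$ outside $U$. For $i\le j$ let $\delta_i^j:M_j\to M_i$ be smooth maps, $f_i^j:E_j\to E_i$ smooth vector bundle morphisms over $\delta_i^j$, and $\overline{\delta_i^j}:\mathbb M_j\to\mathbb M_i$, $\lambda_i^j:\mathbb E_j\to\mathbb E_i$ continuous linear maps, each family forming a projective system. They form a *strong projective system of Banach Lie algebroids* if: 1. every $x=(x_i)\in\varprojlim M_i$ has a projective system of charts $(U_i,\varphi_i)$ of the $M_i$, $x_i\in U_i$, with $\delta_i^j(U_j)\subset U_i$, $\varphi_i\circ\delta_i^j=\overline{\delta_i^j}\circ\varphi_j$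 on $U_j$, $\varprojlim U_i$ open in $\varprojlim M_i$ and $\varprojlim\varphi_i(U_i)$ open in $\varprojlim\mathbb M_i$; 2. every $x=(x_i)\in\varprojlim M_i$ has a projective system of smooth vector bundle trivializations $\tau_i:\pi_i^{-1}(U_i)\to U_i\times\mathbb E_i$, $x_i\in U_i$, with $\delta_i^j(U_j)\subset U_i$, $(\delta_i^j\times\lambda_i^j)\circ\tau_j=\tau_i\circ f_i^j$ on $\pi_j^{-1}(U_j)$ and $\varprojlim U_i$ open in $\varprojlim M_i$; 3. $\rho_i\circ f_i^j=T\delta_i^j\circ\rho_j$ for $i\le j$; 4. $f_i^j$ is a morphism of Lie algebroids for $i\le j$. **Theorem.** Under these assumptions $\varprojlim\mathbb M_i$ and $\varprojlim\mathbb E_i$ are Fréchet spaces; $\varprojlim M_i$, with the projective topology and the charts $\varprojlim\varphi_i$, is a Fréchet manifold modelled on $\varprojlim\mathbb M_i$; $\varprojlim\pi_i:\varprojlim E_i\to\varprojlim M_i$, with the projective topology and the trivializations $\varprojlim\tau_i$, is a Fréchet vector bundle with fibre $\varprojlim\mathbb E_i$; and it carries a Fréchet Lie algebroid structure with anchor $\rho$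 and bracket $[\cdot,\cdot]$ on all its smooth sections such that: * $\rho=\varprojlim\rho_i$, i.e. $T\delta_i(\rho(v))=\rho_i(v_i)$ for every $v=(v_i)\in\varprojlim E_i$ and every $i$, where $\delta_i:\varprojlim M_k\to M_i$ is the projection; * if $s_i\in\underline{E_i}$ satisfy $f_i^j\circ s_j=s_i\circ\delta_i^j$ for $i\le j$, then $\varprojlim s_i:(x_i)\mapsto(s_i(x_i))$ is a smooth section of $\varprojlim E_i$; and for two such families $(s_i)$, $(t_i)$ the brackets $[s_i,t_i]_{E_i}$ form such a family again and $$[\varprojlim s_i,\varprojlim t_i]=\varprojlim\,[s_i,t_i]_{E_i}.$$ -/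

import Mathlib

open Bundle Filter Set Topology
open scoped Manifold ContDiff

noncomputable section

/-! ### Smooth calculus in the sense of Kriegl and Michor -/

namespace Convenient

/-- A curve in a topological vector space is smooth if all its iterated derivatives exist
(`D n` is the `n`-th derivative). -/
def SmoothCurve {F : Type*} [AddCommGroup F] [Module ℝ F] [TopologicalSpace F]
    (c : ℝ → F) : Prop :=
  ∃ D : ℕ → ℝ → F, D 0 = c ∧
    ∀ n t, Tendsto (fun h : ℝ => h⁻¹ • (D n (t + h) - D n t)) (𝓝[≠] 0) (𝓝 (D (n + 1) t))

/-- `f` is smooth on `U` if it maps smooth curves lying in `U` to smooth curves. -/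
def SmoothOn {F G : Type*} [AddCommGroup F] [Module ℝ F] [TopologicalSpace F]
    [AddCommGroup G] [Module ℝ G] [TopologicalSpace G] (f : F → G) (U : Set F) : Prop :=
  ∀ c : ℝ → F, SmoothCurve c → (∀ t, c t ∈ U) → SmoothCurve (fun t => f (c t))

/-- The differential `df(x)(v)`, the derivative at `0` of `t ↦ f (x + t v)`. -/
def diff {F G : Type*} [AddCommGroup F] [Module ℝ F]
    [AddCommGroup G] [Module ℝ G] [TopologicalSpace G] (f : F → G) (x v : F) : G :=
  limUnder (𝓝[≠] (0 : ℝ)) (fun t : ℝ => t⁻¹ • (f (x + t • v) - f x))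

theorem SmoothCurve.add {F : Type*} [AddCommGroup F] [Module ℝ F] [TopologicalSpace F]
    [ContinuousAdd F] {c d : ℝ → F} (hc : SmoothCurve c) (hd : SmoothCurve d) :
    SmoothCurve (fun t => c t + d t) := by
  obtain ⟨C, hC0, hC⟩ := hc
  obtain ⟨D, hD0, hD⟩ := hd
  refine ⟨fun n t => C n t + D n t, by simp [hC0, hD0], fun n t => ?_⟩
  refine ((hC n t).add (hD n t)).congr fun h => ?_
  rw [← smul_add, add_sub_add_comm]

theorem SmoothCurve.const_smul {F : Type*} [AddCommGroup F] [Module ℝ F] [TopologicalSpace F]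
    [ContinuousConstSMul ℝ F] {c : ℝ → F} (a : ℝ) (hc : SmoothCurve c) :
    SmoothCurve (fun t => a • c t) := by
  obtain ⟨C, hC0, hC⟩ := hc
  refine ⟨fun n t => a • C n t, by simp [hC0], fun n t => ?_⟩
  refine ((hC n t).const_smul a).congr fun h => ?_
  rw [← smul_sub, smul_comm]

theorem smoothCurve_zero {F : Type*} [AddCommGroup F] [Module ℝ F] [TopologicalSpace F] :
    SmoothCurve (fun _ : ℝ => (0 : F)) :=
  ⟨fun _ _ => 0, rfl, fun n t => by simpa using tendsto_const_nhds⟩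

theorem SmoothCurve.congr {F : Type*} [AddCommGroup F] [Module ℝ F] [TopologicalSpace F]
    {c d : ℝ → F} (hc : SmoothCurve c) (h : ∀ t, d t = c t) : SmoothCurve d := by
  rwa [show d = c from funext h]

/-- Fréchet spaces: complete metrizable locally convex Hausdorff spaces. -/
class IsFrechetSpace (F : Type*) [AddCommGroup F] [Module ℝ F] [UniformSpace F] : Prop where
  uniformAddGroup : IsUniformAddGroup F
  continuousSMul : ContinuousSMul ℝ F
  locallyConvex : LocallyConvexSpace ℝ F
  t2 : T2Space F
  countable : (uniformity F).IsCountablyGenerated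
  complete : CompleteSpace F

/-! ### Manifolds -/

section Manifold

variable (F : Type*) [AddCommGroup F] [Module ℝ F] [TopologicalSpace F]
  (M : Type*) [TopologicalSpace M] [ChartedSpace F M]

/-- `M` is a smooth manifold modelled on `F`: all changes of charts are smooth. -/
class IsSmoothManifold : Prop where
  smooth_change : ∀ e ∈ atlas F M, ∀ e' ∈ atlas F M,
    SmoothOn (fun y => e' (e.symm y)) (e.target ∩ e.symm ⁻¹' e'.source)

variable {M}

/-- Smooth real functions on `M`. -/
def SmoothFun (g : M → ℝ) : Prop :=
  ∀ e ∈ atlas F M, SmoothOn (fun y => g (e.symm y)) e.target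

/-- The (kinematic) tangent space at `x`: a vector is given by its coordinate in the
preferred chart at `x`. This is the convention of Mathlib's `TangentSpace`. -/
def Tangent (_x : M) : Type _ := F

instance (x : M) : AddCommGroup (Tangent F x) := inferInstanceAs (AddCommGroup F)
instance (x : M) : Module ℝ (Tangent F x) := inferInstanceAs (Module ℝ F)

variable {F}

/-- The coordinate in the chart `e` of the tangent vector `v` at `x`. -/
def tangentCoord (e : OpenPartialHomeomorph M F) (x : M) (v : Tangent F x) : F :=
  diff (fun y : F => e ((chartAt F x).symm y)) (chartAt F x x) v

/-- The representative of the vector field `X` in the chart `e`. -/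
def fieldCoord (X : ∀ x : M, Tangent F x) (e : OpenPartialHomeomorph M F) (y : F) : F :=
  tangentCoord e (e.symm y) (X (e.symm y))

/-- The derivative `X(g)` of the function `g` along `X`, at `x`. -/
def fieldAct (X : ∀ x : M, Tangent F x) (g : M → ℝ) (x : M) : ℝ :=
  diff (fun y : F => g ((chartAt F x).symm y)) (chartAt F x x) (X x)

/-- The Lie bracket of vector fields: `[X, Y] = dY(X) - dX(Y)` in the preferred chart at `x`. -/
def fieldBracket (X Y : ∀ x : M, Tangent F x) (x : M) : Tangent F x :=
  (diff (fieldCoord Y (chartAt F x)) (chartAt F x x) (X x) -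
    diff (fieldCoord X (chartAt F x)) (chartAt F x x) (Y x) : F)

/-- The tangent map at `x` of a map between manifolds. -/
def tangentMap {G : Type*} [AddCommGroup G] [Module ℝ G] [TopologicalSpace G]
    {N : Type*} [TopologicalSpace N] [ChartedSpace G N] (f : M → N) (x : M)
    (v : Tangent F x) : Tangent G (f x) :=
  diff (G := G) (fun y : F => chartAt G (f x) (f ((chartAt F x).symm y))) (chartAt F x x) v

end Manifold

/-! ### Vector bundles -/

section VectorBundle

variable (F : Type*) [AddCommGroup F] [Module ℝ F] [TopologicalSpace F]
  {M : Type*} [TopologicalSpace M] [ChartedSpace F M]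
  (V : Type*) [AddCommGroup V] [Module ℝ V] [TopologicalSpace V]
  (E : M → Type*) [∀ x, AddCommGroup (E x)] [∀ x, Module ℝ (E x)]
  [∀ x, TopologicalSpace (E x)] [TopologicalSpace (TotalSpace V E)] [FiberBundle V E]

/-- The fibre bundle `E` over the manifold `M` is a smooth vector bundle with fibre `V`: its local
trivializations are fibrewise linear, and the changes of trivialization
`(x, v) ↦ (x, Φ(x) v)` are smooth (`x` is read in the charts of `M`). -/
class IsSmoothVectorBundle : Prop where
  linear : ∀ τ ∈ trivializationAtlas V E, τ.IsLinear ℝ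
  smooth_change : ∀ τ ∈ trivializationAtlas V E, ∀ τ' ∈ trivializationAtlas V E,
    ∀ e ∈ atlas F M,
      SmoothOn (fun p : F × V => (τ' ⟨e.symm p.1, τ.symm (e.symm p.1) p.2⟩).2)
        {p | p.1 ∈ e.target ∧ e.symm p.1 ∈ τ.baseSet ∩ τ'.baseSet}

variable {E} in
/-- Smoothness of a section, in charts of the base and local trivializations. -/
def IsSmoothSection (s : ∀ x, E x) : Prop :=
  ∀ τ ∈ trivializationAtlas V E, ∀ e ∈ atlas F M,
    SmoothOn (fun y : F => (τ ⟨e.symm y, s (e.symm y)⟩).2)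
      {y | y ∈ e.target ∧ e.symm y ∈ τ.baseSet}

variable [ContinuousAdd V] [ContinuousConstSMul ℝ V] [IsSmoothVectorBundle F V E]

/-- The vector space of smooth sections. -/
def smoothSections : Submodule ℝ (∀ x, E x) where
  carrier := {s | IsSmoothSection F V s}
  zero_mem' := fun τ hτ _ _ _ _ hcU => smoothCurve_zero.congr fun t =>
    ((IsSmoothVectorBundle.linear (F := F) τ hτ).linear _ (hcU t).2).map_zero
  add_mem' := fun {_ _} hs ht τ hτ e he c hc hcU =>
    ((hs τ hτ e he c hc hcU).add (ht τ hτ e he c hc hcU)).congr fun t =>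
      ((IsSmoothVectorBundle.linear (F := F) τ hτ).linear _ (hcU t).2).map_add _ _
  smul_mem' := fun a _ hs τ hτ e he c hc hcU =>
    ((hs τ hτ e he c hc hcU).const_smul a).congr fun t =>
      ((IsSmoothVectorBundle.linear (F := F) τ hτ).linear _ (hcU t).2).map_smul a _

/-- A Lie algebroid structure on the smooth vector bundle `E` over the manifold `M` modelled on
`F`: an anchor `ρ : E → TM`, which is a vector bundle morphism, and a Lie algebra bracket on the
smooth sections, such that `ρ` is a Lie algebra morphism into vector fields and the Leibniz
rule holds. -/
structure LieAlgebroid where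
  anchor : ∀ x, E x →ₗ[ℝ] Tangent F x
  smooth_anchor : ∀ τ ∈ trivializationAtlas V E, ∀ e ∈ atlas F M,
    SmoothOn
      (fun p : F × V =>
        tangentCoord e (e.symm p.1) (anchor (e.symm p.1) (τ.symm (e.symm p.1) p.2)))
      {p | p.1 ∈ e.target ∧ e.symm p.1 ∈ τ.baseSet}
  bracket : smoothSections F V E →ₗ[ℝ] smoothSections F V E →ₗ[ℝ] smoothSections F V E
  bracket_self : ∀ s, bracket s s = 0
  jacobi : ∀ s t u,
    bracket s (bracket t u) + bracket t (bracket u s) + bracket u (bracket s t) = 0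
  anchor_bracket : ∀ (s t : smoothSections F V E) (x : M),
    anchor x ((bracket s t).1 x) =
      fieldBracket (fun y => anchor y (s.1 y)) (fun y => anchor y (t.1 y)) x
  leibniz : ∀ g : M → ℝ, SmoothFun F g → ∀ s t u : smoothSections F V E,
    (∀ x, u.1 x = g x • t.1 x) →
    ∀ x, (bracket s u).1 x =
      g x • (bracket s t).1 x + fieldAct (fun y => anchor y (s.1 y)) g x • t.1 x

end VectorBundle

end Convenient

/-! ### Banach Lie algebroids -/

/-- Smoothly regular manifolds: smooth real functions separate points from closed sets. -/
def SmoothlyRegular (B : Type*) [NormedAddCommGroup B] [NormedSpace ℝ B]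
    (M : Type*) [TopologicalSpace M] [ChartedSpace B M] : Prop :=
  ∀ x : M, ∀ U ∈ 𝓝 x, ∃ g : M → ℝ,
    ContMDiff 𝓘(ℝ, B) 𝓘(ℝ, ℝ) ∞ g ∧ g x = 1 ∧ ∀ y, y ∉ U → g y = 0

section Banach

variable (B : Type*) [NormedAddCommGroup B] [NormedSpace ℝ B]
  {M : Type*} [TopologicalSpace M] [ChartedSpace B M] [IsManifold 𝓘(ℝ, B) ∞ M]
  (V : Type*) [NormedAddCommGroup V] [NormedSpace ℝ V]
  (E : M → Type*) [∀ x, AddCommGroup (E x)] [∀ x, Module ℝ (E x)]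
  [∀ x, TopologicalSpace (E x)] [TopologicalSpace (TotalSpace V E)] [FiberBundle V E]
  [VectorBundle ℝ V E]

/-- The derivative of the function `g` in the direction of the tangent vector `v` at `x`. -/
def dirDeriv {x : M} (v : TangentSpace 𝓘(ℝ, B) x) (g : M → ℝ) : ℝ :=
  mfderiv 𝓘(ℝ, B) 𝓘(ℝ, ℝ) g x v

/-- A Lie algebroid structure on the Banach vector bundle `E` over the Banach manifold `M`. -/
structure BanachLieAlgebroid where
  anchor : ∀ x, E x →L[ℝ] TangentSpace 𝓘(ℝ, B) x
  smooth_anchor :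
    ContMDiff (𝓘(ℝ, B).prod 𝓘(ℝ, V)) (𝓘(ℝ, B).prod 𝓘(ℝ, B)) ∞
      (fun p : TotalSpace V E => (⟨p.1, anchor p.1 p.2⟩ : TangentBundle 𝓘(ℝ, B) M))
  bracket : Cₛ^∞⟮𝓘(ℝ, B); V, E⟯ →ₗ[ℝ] Cₛ^∞⟮𝓘(ℝ, B); V, E⟯ →ₗ[ℝ] Cₛ^∞⟮𝓘(ℝ, B); V, E⟯
  bracket_self : ∀ s, bracket s s = 0
  jacobi : ∀ s t u,
    bracket s (bracket t u) + bracket t (bracket u s) + bracket u (bracket s t) = 0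
  anchor_bracket : ∀ (s t : Cₛ^∞⟮𝓘(ℝ, B); V, E⟯) (x : M),
    anchor x (bracket s t x) =
      VectorField.mlieBracket 𝓘(ℝ, B) (fun y => anchor y (s y)) (fun y => anchor y (t y)) x
  leibniz : ∀ g : M → ℝ, ContMDiff 𝓘(ℝ, B) 𝓘(ℝ, ℝ) ∞ g →
    ∀ s t u : Cₛ^∞⟮𝓘(ℝ, B); V, E⟯, (∀ x, u x = g x • t x) →
    ∀ x, bracket s u x =
      g x • bracket s t x + dirDeriv B (anchor x (s x)) g • t x

variable {E}

/-- `θ` is a smooth section of the bundle of continuous alternating `q`-forms on `E`. -/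
def IsSmoothForm {q : ℕ} (θ : ∀ x, E x [⋀^Fin q]→L[ℝ] ℝ) : Prop :=
  ∀ x₀ : M, ContMDiffOn 𝓘(ℝ, B) 𝓘(ℝ, V [⋀^Fin q]→L[ℝ] ℝ) ∞
    (fun x => (θ x).compContinuousLinearMap ((trivializationAt V E x₀).symmL ℝ x))
    (trivializationAt V E x₀).baseSet

variable {B V}

/-- The second sum in the formula for the exterior differential of a `q`-form,
`∑_{i < j} (-1)^(i+j) θ([s_i, s_j], s_0, …, ŝ_i, …, ŝ_j, …, s_q)`. Here `i` and `j` are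
`a.castSucc` and `j`, and `k ↦ j.succAbove (a.succAbove k)` enumerates the other indices. -/
def BanachLieAlgebroid.bracketSum (A : BanachLieAlgebroid B V E) :
    (q : ℕ) → (∀ x, E x [⋀^Fin q]→L[ℝ] ℝ) →
      (Fin (q + 1) → Cₛ^∞⟮𝓘(ℝ, B); V, E⟯) → M → ℝ
  | 0, _, _, _ => 0
  | r + 1, θ, s, x =>
      ∑ j : Fin (r + 2), ∑ a : Fin (r + 1),
        if a.castSucc < j then
          (-1 : ℝ) ^ ((a : ℕ) + (j : ℕ)) *
            θ x (Fin.cons (A.bracket (s a.castSucc) (s j) x)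
              (fun k : Fin r => s (j.succAbove (a.succAbove k)) x))
        else 0

/-- `η = d_ρ θ`: the `(q+1)`-form `η` is the exterior differential of the `q`-form `θ`. -/
def BanachLieAlgebroid.IsExtDiff (A : BanachLieAlgebroid B V E) {q : ℕ}
    (θ : ∀ x, E x [⋀^Fin q]→L[ℝ] ℝ) (η : ∀ x, E x [⋀^Fin (q + 1)]→L[ℝ] ℝ) : Prop :=
  ∀ (s : Fin (q + 1) → Cₛ^∞⟮𝓘(ℝ, B); V, E⟯) (x : M),
    η x (fun k => s k x) =
      (∑ i : Fin (q + 1), (-1 : ℝ) ^ (i : ℕ) *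
        dirDeriv B (A.anchor x (s i x)) (fun y => θ y (fun k => s (i.succAbove k) y))) +
      A.bracketSum q θ s x

/-- The vector bundle morphism `ψ` over `f` is a morphism of Lie algebroids: pullback of forms
commutes with the exterior differentials. Every smooth form `α` on the target has an exterior
differential `dα = η`, and `ψ^* η` is the exterior differential of `ψ^* α`. -/
def BanachLieAlgebroid.IsMorphism (A : BanachLieAlgebroid B V E)
    {B' : Type*} [NormedAddCommGroup B'] [NormedSpace ℝ B']
    {M' : Type*} [TopologicalSpace M'] [ChartedSpace B' M'] [IsManifold 𝓘(ℝ, B') ∞ M']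
    {V' : Type*} [NormedAddCommGroup V'] [NormedSpace ℝ V']
    {E' : M' → Type*} [∀ x, AddCommGroup (E' x)] [∀ x, Module ℝ (E' x)]
    [∀ x, TopologicalSpace (E' x)] [TopologicalSpace (TotalSpace V' E')] [FiberBundle V' E']
    [VectorBundle ℝ V' E']
    (A' : BanachLieAlgebroid B' V' E') (f : M → M') (ψ : ∀ x, E x →L[ℝ] E' (f x)) : Prop :=
  ∀ (q : ℕ) (α : ∀ x, E' x [⋀^Fin q]→L[ℝ] ℝ), IsSmoothForm B' V' α →
    ∃ η : ∀ x, E' x [⋀^Fin (q + 1)]→L[ℝ] ℝ, IsSmoothForm B' V' η ∧ A'.IsExtDiff α η ∧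
      A.IsExtDiff (fun x => (α (f x)).compContinuousLinearMap (ψ x))
        (fun x => (η (f x)).compContinuousLinearMap (ψ x))

end Banach

/-! ### Projective systems -/

/-- A projective system of sets and maps indexed by `ℕ`. -/
structure IsProjSystem {X : ℕ → Type*} (δ : ∀ i j, i ≤ j → X j → X i) : Prop where
  id : ∀ i x, δ i i le_rfl x = x
  comp : ∀ i j k (hij : i ≤ j) (hjk : j ≤ k) x,
    δ i j hij (δ j k hjk x) = δ i k (hij.trans hjk) x

/-- The projective limit: the space of threads, with the projective topology. -/
abbrev ProjLim {X : ℕ → Type*} (δ : ∀ i j, i ≤ j → X j → X i) : Type _ :=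
  {x : ∀ i, X i // ∀ i j (h : i ≤ j), δ i j h (x j) = x i}

/-- The projective limit of a system of topological vector spaces. -/
def linLim {W : ℕ → Type*} [∀ i, NormedAddCommGroup (W i)] [∀ i, NormedSpace ℝ (W i)]
    (l : ∀ i j, i ≤ j → W j →L[ℝ] W i) : Submodule ℝ (∀ i, W i) where
  carrier := {w | ∀ i j (h : i ≤ j), l i j h (w j) = w i}
  zero_mem' := fun i j h => by simp
  add_mem' := fun {a b} ha hb i j h => by simp [ha i j h, hb i j h]
  smul_mem' := fun r a ha i j h => by simp [ha i j h]

section Systems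

variable {B : ℕ → Type*} [∀ i, NormedAddCommGroup (B i)] [∀ i, NormedSpace ℝ (B i)]
  {M : ℕ → Type*} [∀ i, TopologicalSpace (M i)] [∀ i, ChartedSpace (B i) (M i)]
  [∀ i, IsManifold 𝓘(ℝ, B i) ∞ (M i)]
  {V : ℕ → Type*} [∀ i, NormedAddCommGroup (V i)] [∀ i, NormedSpace ℝ (V i)]
  {E : ∀ i, M i → Type*} [∀ i x, AddCommGroup (E i x)] [∀ i x, Module ℝ (E i x)]
  [∀ i x, TopologicalSpace (E i x)] [∀ i, TopologicalSpace (TotalSpace (V i) (E i))]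
  [∀ i, FiberBundle (V i) (E i)] [∀ i, VectorBundle ℝ (V i) (E i)]

/-- A projective system of local charts `(U_i, φ_i)` of the manifolds `M_i`: `δ_i^j` maps `U_j`
into `U_i` and reads as the bonding map `l_i^j` of the models; moreover `lim U_i` is open in
`lim M_i` and `lim φ_i(U_i)` is open in `lim B_i`. -/
structure IsProjChart (δ : ∀ i j, i ≤ j → M j → M i) (l : ∀ i j, i ≤ j → B j →L[ℝ] B i)
    (φ : ∀ i, OpenPartialHomeomorph (M i) (B i)) : Prop where
  mem : ∀ i, φ i ∈ IsManifold.maximalAtlas 𝓘(ℝ, B i) ∞ (M i)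
  mapsTo : ∀ i j (h : i ≤ j), MapsTo (δ i j h) (φ j).source (φ i).source
  coherent : ∀ i j (h : i ≤ j), ∀ x ∈ (φ j).source, φ i (δ i j h x) = l i j h (φ j x)
  isOpen_source : IsOpen {x : ProjLim δ | ∀ i, x.1 i ∈ (φ i).source}
  isOpen_target : IsOpen {y : linLim l | ∀ i, y.1 i ∈ (φ i).target}

/-- A strong projective system of Banach manifolds. -/
structure IsStrongProjManifold (δ : ∀ i j, i ≤ j → M j → M i)
    (l : ∀ i j, i ≤ j → B j →L[ℝ] B i) : Prop where
  proj : IsProjSystem δ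
  smooth : ∀ i j h, ContMDiff 𝓘(ℝ, B j) 𝓘(ℝ, B i) ∞ (δ i j h)
  proj_model : IsProjSystem fun i j h => (l i j h : B j → B i)
  exists_chart : ∀ x : ProjLim δ, ∃ φ : ∀ i, OpenPartialHomeomorph (M i) (B i),
    IsProjChart δ l φ ∧ ∀ i, x.1 i ∈ (φ i).source

/-- The charts `lim φ_i` of `lim M_i`. -/
def limCharts (δ : ∀ i j, i ≤ j → M j → M i) (l : ∀ i j, i ≤ j → B j →L[ℝ] B i) :
    Set (OpenPartialHomeomorph (ProjLim δ) (linLim l)) :=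
  {e | ∃ φ : ∀ i, OpenPartialHomeomorph (M i) (B i), IsProjChart δ l φ ∧
    e.source = {x | ∀ i, x.1 i ∈ (φ i).source} ∧
    e.target = {y | ∀ i, y.1 i ∈ (φ i).target} ∧
    ∀ x ∈ e.source, ∀ i, (e x).1 i = φ i (x.1 i)}

/-- The map of total spaces defined by fibrewise linear maps `f_i^j` over `δ_i^j`. -/
def totalMap (V : ℕ → Type*) (δ : ∀ i j, i ≤ j → M j → M i)
    (f : ∀ i j (h : i ≤ j) (x : M j), E j x →L[ℝ] E i (δ i j h x)) (i j : ℕ) (h : i ≤ j)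
    (p : TotalSpace (V j) (E j)) : TotalSpace (V i) (E i) :=
  ⟨δ i j h p.1, f i j h p.1 p.2⟩

variable (B) in
/-- A projective system of trivializations `(U_i, τ_i)` of the bundles `E_i`: the `τ_i` are
fibrewise linear diffeomorphisms from `π_i⁻¹(U_i)` onto `U_i × V_i`, the map `δ_i^j` sends `U_j`
into `U_i`, `(δ_i^j × l_i^j) ∘ τ_j = τ_i ∘ f_i^j`, and `lim U_i` is open in `lim M_i`. -/
structure IsProjTriv (δ : ∀ i j, i ≤ j → M j → M i) (l : ∀ i j, i ≤ j → V j →L[ℝ] V i)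
    (f : ∀ i j (h : i ≤ j) (x : M j), E j x →L[ℝ] E i (δ i j h x))
    (τ : ∀ i, Trivialization (V i) (π (V i) (E i))) : Prop where
  linear : ∀ i, (τ i).IsLinear ℝ
  smooth : ∀ i, ContMDiffOn (𝓘(ℝ, B i).prod 𝓘(ℝ, V i)) (𝓘(ℝ, B i).prod 𝓘(ℝ, V i)) ∞
    (τ i) (τ i).source
  smooth_symm : ∀ i, ContMDiffOn (𝓘(ℝ, B i).prod 𝓘(ℝ, V i)) (𝓘(ℝ, B i).prod 𝓘(ℝ, V i)) ∞
    (τ i).toOpenPartialHomeomorph.symm (τ i).target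
  mapsTo : ∀ i j (h : i ≤ j), MapsTo (δ i j h) (τ j).baseSet (τ i).baseSet
  coherent : ∀ i j (h : i ≤ j), ∀ p ∈ (τ j).source,
    τ i (totalMap V δ f i j h p) = (δ i j h (τ j p).1, l i j h (τ j p).2)
  isOpen_base : IsOpen {x : ProjLim δ | ∀ i, x.1 i ∈ (τ i).baseSet}

variable (B) in
/-- A strong projective system of Banach vector bundles over a projective system of manifolds. -/
structure IsStrongProjBundle (δ : ∀ i j, i ≤ j → M j → M i) (l : ∀ i j, i ≤ j → V j →L[ℝ] V i)
    (f : ∀ i j (h : i ≤ j) (x : M j), E j x →L[ℝ] E i (δ i j h x)) : Prop where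
  proj : IsProjSystem (totalMap V δ f)
  smooth : ∀ i j h, ContMDiff (𝓘(ℝ, B j).prod 𝓘(ℝ, V j)) (𝓘(ℝ, B i).prod 𝓘(ℝ, V i)) ∞
    (totalMap V δ f i j h)
  proj_fibre : IsProjSystem fun i j h => (l i j h : V j → V i)
  exists_triv : ∀ x : ProjLim δ, ∃ τ : ∀ i, Trivialization (V i) (π (V i) (E i)),
    IsProjTriv B δ l f τ ∧ ∀ i, x.1 i ∈ (τ i).baseSet

/-! ### The limit bundle -/

/-- The fibre of `lim E_i` over the thread `x = (x_i)`: the families `v_i ∈ (E_i)_{x_i}` such that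
`(x_i, v_i)` is a thread of total spaces. -/
def limFibre (V : ℕ → Type*) (δ : ∀ i j, i ≤ j → M j → M i)
    (f : ∀ i j (h : i ≤ j) (x : M j), E j x →L[ℝ] E i (δ i j h x)) (x : ProjLim δ) :
    Submodule ℝ (∀ i, E i (x.1 i)) where
  carrier := {v | ∀ i j (h : i ≤ j),
    totalMap V δ f i j h ⟨x.1 j, v j⟩ = (⟨x.1 i, v i⟩ : TotalSpace (V i) (E i))}
  zero_mem' := fun i j h => by
    have key : ∀ y : M i, δ i j h (x.1 j) = y →
        totalMap V δ f i j h ⟨x.1 j, 0⟩ = (⟨y, 0⟩ : TotalSpace (V i) (E i)) := by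
      rintro _ rfl
      simp [totalMap]
    exact key _ (x.2 i j h)
  add_mem' := fun {a b} ha hb i j h => by
    have key : ∀ (y : M i) (u w : E i y), δ i j h (x.1 j) = y →
        totalMap V δ f i j h ⟨x.1 j, a j⟩ = (⟨y, u⟩ : TotalSpace (V i) (E i)) →
        totalMap V δ f i j h ⟨x.1 j, b j⟩ = (⟨y, w⟩ : TotalSpace (V i) (E i)) →
        totalMap V δ f i j h ⟨x.1 j, a j + b j⟩ = (⟨y, u + w⟩ : TotalSpace (V i) (E i)) := by
      rintro _ u w rfl hu hw
      simp only [totalMap, TotalSpace.mk_inj] at hu hw ⊢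
      rw [map_add, hu, hw]
    exact key _ _ _ (x.2 i j h) (ha i j h) (hb i j h)
  smul_mem' := fun r a ha i j h => by
    have key : ∀ (y : M i) (u : E i y), δ i j h (x.1 j) = y →
        totalMap V δ f i j h ⟨x.1 j, a j⟩ = (⟨y, u⟩ : TotalSpace (V i) (E i)) →
        totalMap V δ f i j h ⟨x.1 j, r • a j⟩ = (⟨y, r • u⟩ : TotalSpace (V i) (E i)) := by
      rintro _ u rfl hu
      simp only [totalMap, TotalSpace.mk_inj] at hu ⊢
      rw [map_smul, hu]
    exact key _ _ (x.2 i j h) (ha i j h)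

variable (V) in
/-- The bundle `lim E_i` over `lim M_i`. -/
def LimBundle (δ : ∀ i j, i ≤ j → M j → M i)
    (f : ∀ i j (h : i ≤ j) (x : M j), E j x →L[ℝ] E i (δ i j h x)) (x : ProjLim δ) : Type _ :=
  limFibre V δ f x

section

variable (δ : ∀ i j, i ≤ j → M j → M i) (l : ∀ i j, i ≤ j → V j →L[ℝ] V i)
  (f : ∀ i j (h : i ≤ j) (x : M j), E j x →L[ℝ] E i (δ i j h x))

instance (x : ProjLim δ) : AddCommGroup (LimBundle V δ f x) :=
  inferInstanceAs (AddCommGroup (limFibre V δ f x))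
instance (x : ProjLim δ) : Module ℝ (LimBundle V δ f x) :=
  inferInstanceAs (Module ℝ (limFibre V δ f x))
instance (x : ProjLim δ) : TopologicalSpace (LimBundle V δ f x) :=
  inferInstanceAs (TopologicalSpace (limFibre V δ f x))

/-- The projective topology on the total space of `lim E_i`. -/
instance : TopologicalSpace (TotalSpace (linLim l) (LimBundle V δ f)) :=
  TopologicalSpace.induced
    (fun p i => (⟨p.1.1 i, p.2.1 i⟩ : TotalSpace (V i) (E i))) inferInstance

variable (B) in
/-- The local trivializations `lim τ_i` of `lim E_i`. -/
def limTrivs : Set (Trivialization (linLim l) (π (linLim l) (LimBundle V δ f))) :=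
  {T | ∃ τ : ∀ i, Trivialization (V i) (π (V i) (E i)), IsProjTriv B δ l f τ ∧
    T.baseSet = {x | ∀ i, x.1 i ∈ (τ i).baseSet} ∧
    ∀ x ∈ T.baseSet, ∀ (v : LimBundle V δ f x) (i : ℕ),
      (T ⟨x, v⟩).2.1 i = (τ i ⟨x.1 i, v.1 i⟩).2}

/-- The sections `s_i` of `E_i` form a projective sequence: `f_i^j ∘ s_j = s_i ∘ δ_i^j`. -/
def IsProjSection (s : ∀ i (x : M i), E i x) : Prop :=
  ∀ i j (h : i ≤ j) (x : M j), f i j h x (s j x) = s i (δ i j h x)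

/-- `σ` is the projective limit of the sections `s_i`. -/
def IsLimSection (σ : ∀ x : ProjLim δ, LimBundle V δ f x) (s : ∀ i (x : M i), E i x) : Prop :=
  ∀ (x : ProjLim δ) (i : ℕ), (σ x).1 i = s i (x.1 i)

end

/-- A strong projective system of Banach Lie algebroids, with bonding maps `δ_i^j : M_j → M_i`,
`f_i^j : E_j → E_i`, and `lB_i^j`, `lV_i^j` on the models of the bases and of the fibres. -/
structure IsStrongProjAlgebroid (A : ∀ i, BanachLieAlgebroid (B i) (V i) (E i))
    (δ : ∀ i j, i ≤ j → M j → M i) (lB : ∀ i j, i ≤ j → B j →L[ℝ] B i)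
    (lV : ∀ i j, i ≤ j → V j →L[ℝ] V i)
    (f : ∀ i j (h : i ≤ j) (x : M j), E j x →L[ℝ] E i (δ i j h x)) : Prop where
  base : IsStrongProjManifold δ lB
  bundle : IsStrongProjBundle B δ lV f
  anchor_comp : ∀ i j (h : i ≤ j) (x : M j) (v : E j x),
    (A i).anchor (δ i j h x) (f i j h x v) =
      mfderiv 𝓘(ℝ, B j) 𝓘(ℝ, B i) (δ i j h) x ((A j).anchor x v)
  morphism : ∀ i j (h : i ≤ j), (A j).IsMorphism (A i) (δ i j h) (f i j h)

end Systems

end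

set_option linter.unusedSectionVars false

noncomputable section

/-! ### Boman's theorem in the plane -/

section Boman

variable {E : Type*} [NormedAddCommGroup E] [NormedSpace ℝ E]

/-! The difficulty is the bracket of arbitrary smooth sections `σ`, `τ` of the limit bundle. The
component `σ_i` depends on the whole thread `x`, not only on `x_i`, so `[σ_i, τ_i]` has no meaning
in `E_i`. The bracket is therefore defined by duality, by solving the formula for the exterior
differential. For a 1-form `θ` on `E_i` with differential `η`, the component `w` of `[σ, τ]` at `x`
has to satisfy θ(w) = ρ(σ)(θ(τ_i)) - ρ(τ)(θ(σ_i)) - η(σ_i, τ_i) (`bracketForm`, `IsBracketAt`).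

Smooth 1-forms separate the vectors of a fibre, by smooth regularity and Hahn-Banach, so at most one
`w` exists. For existence, choose sections `s`, `t` of `E_i` with the values of `σ_i`, `τ_i` at `x`.
Then `τ_i - t` and `σ_i - s` vanish at `x`, so their derivatives at `x` are well-defined vectors of
the fibre, and w = [s, t](x_i) + D_{ρ(σ)}(τ_i - t) - D_{ρ(τ)}(σ_i - s) is a solution
(`isBracketAt_formula`). The bonding maps commute with exterior differentials, so they carry `w_j`
to `w_i` (`IsBracketAt.totalMap_eq`). If `σ` and `τ` are limits of sections, `s_i` and `t_i` are
admissible choices, the corrections vanish, and the bracket is the limit of the brackets.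

The algebraic laws are also tested on 1-forms. Bilinearity, antisymmetry and Leibniz are visible in
the defining formula. For the anchor, take `θ = dk`, which is closed: the formula reduces to the
commutator of two derivations. For Jacobi, the second-order terms cancel cyclically, and what
remains is `d(dθ) = 0` on `E_i`, transferred to the limit by the formula for `w`
(`cyclic_sum_evalTwo_eq_zero`).

All this needs calculus on the limit, where smooth means smooth along smooth curves. Curves in the
limit are smooth exactly when their components are, so smoothness of functions, sections and fields
is tested on threads of smooth curves. Linearity of differentials, the chain rule and the symmetry
of second derivatives each involve only a two-parameter surface. They follow from Boman's theorem in
the plane, proved here by Fourier decay. Finally, the bracket is a smooth section because a curve in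
a Banach space which is smooth under every functional is smooth (`contDiff_of_forall_dual`). -/

theorem exists_bound_iteratedDeriv_of_hasCompactSupport {G : ℝ → ℝ} (hG : ContDiff ℝ ∞ G)
    (hs : HasCompactSupport G) (n : ℕ) : ∃ C, ∀ t, ‖iteratedDeriv n G t‖ ≤ C := by
  have hc : Continuous (iteratedDeriv n G) := hG.continuous_iteratedDeriv n (by exact_mod_cast le_top)
  have hs' : HasCompactSupport (iteratedDeriv n G) := by
    induction n with
    | zero => simpa using hs
    | succ n ih =>
      rw [iteratedDeriv_succ]
      exact (ih (hG.continuous_iteratedDeriv n (by exact_mod_cast le_top))).deriv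
  exact hs'.exists_bound_of_continuous hc

/-- A series of bumps of widths `2⁻ᵏ` and sizes `1 / k!` is smooth. -/
theorem contDiff_tsum_bump [CompleteSpace E] {G : ℝ → ℝ} (hG : ContDiff ℝ ∞ G)
    (hs : HasCompactSupport G) {y : ℕ → E} (hy : ∀ k, ‖y k‖ ≤ 1 / (k.factorial : ℝ)) :
    ContDiff ℝ ∞ (fun t => ∑' k, G (2 ^ k * t) • y k) := by
  choose C hC using exists_bound_iteratedDeriv_of_hasCompactSupport hG hs
  have hsm : ∀ k : ℕ, ContDiff ℝ ∞ (fun t : ℝ => G (2 ^ k * t)) := fun k =>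
    hG.comp (contDiff_const.mul contDiff_id)
  -- Each derivative of `G (2 ^ k * t)` costs a factor `2 ^ k`, so the `n`-th derivative of the
  -- `k`-th term is at most `C n * (2 ^ n) ^ k / k!`. This is the exponential series at `2 ^ n`,
  -- whence the factorial size of `y k`.
  refine contDiff_tsum (v := fun n k => C n * (((2 : ℝ) ^ n) ^ k / k.factorial))
    (fun k => (hsm k).smul contDiff_const) (fun n _ => ?_) (fun n k t _ => ?_)
  · exact (Real.summable_pow_div_factorial _).mul_left _
  · have h1 : (fun t : ℝ => G (2 ^ k * t) • y k) =
        (ContinuousLinearMap.smulRight (1 : ℝ →L[ℝ] ℝ) (y k)) ∘ (fun t : ℝ => G (2 ^ k * t)) := by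
      ext t; simp
    rw [h1]
    refine (ContinuousLinearMap.norm_iteratedFDeriv_comp_left _ (hsm k).contDiffAt
      (by exact_mod_cast le_top)).trans ?_
    rw [norm_iteratedFDeriv_eq_norm_iteratedDeriv,
      iteratedDeriv_comp_const_mul (hG.of_le (by exact_mod_cast le_top)) ((2 : ℝ) ^ k)]
    have h2 : ‖ContinuousLinearMap.smulRight (1 : ℝ →L[ℝ] ℝ) (y k)‖ ≤ 1 / (k.factorial : ℝ) := by
      rw [ContinuousLinearMap.norm_smulRight_apply]
      simpa using hy k
    have h3 := hC n (2 ^ k * t)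
    have h4 : 0 ≤ C n := (norm_nonneg _).trans h3
    rw [norm_mul, norm_pow, norm_pow, Real.norm_ofNat]
    calc _ ≤ 1 / (k.factorial : ℝ) * (((2 : ℝ) ^ k) ^ n * C n) := by gcongr
      _ = _ := by rw [← pow_mul, ← pow_mul, mul_comm k n]; ring

/-- A smooth curve which, near the time `2⁻ᵏ`, runs through `y k` with velocity `v k`. -/
theorem exists_curve_through [CompleteSpace E] {y v : ℕ → E}
    (hy : ∀ k, ‖y k‖ ≤ 1 / (k.factorial : ℝ)) (hv : ∀ k, ‖v k‖ ≤ 1 / (k.factorial : ℝ)) :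
    ∃ c : ℝ → E, ContDiff ℝ ∞ c ∧
      ∀ k : ℕ, ∀ᶠ t in 𝓝 (((2 : ℝ) ^ k)⁻¹), c t = y k + (t - ((2 : ℝ) ^ k)⁻¹) • v k := by
  -- If `2 ^ k * t` is within `1/8` of `1`, then for `j ≠ k` the number `2 ^ j * t` is at most
  -- `9/16` or at least `7/4`, outside the support of `χ`. Only the `k`-th bump is then active, and
  -- it equals `1`.
  let χ : ContDiffBump (1 : ℝ) := ⟨1 / 8, 1 / 4, by norm_num, by norm_num⟩
  have hχ : ContDiff ℝ ∞ χ := χ.contDiff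
  have hχ1 : ContDiff ℝ ∞ (fun u : ℝ => (u - 1) * χ u) :=
    (contDiff_id.sub contDiff_const).mul hχ
  have hs1 : HasCompactSupport (fun u : ℝ => (u - 1) * χ u) := χ.hasCompactSupport.mul_left
  have hw : ∀ k, ‖((2 : ℝ) ^ k)⁻¹ • v k‖ ≤ 1 / (k.factorial : ℝ) := fun k => by
    rw [norm_smul, norm_inv, norm_pow, Real.norm_ofNat]
    have : ((2 : ℝ) ^ k)⁻¹ ≤ 1 := inv_le_one_of_one_le₀ (one_le_pow₀ (by norm_num))
    calc _ ≤ 1 * (1 / (k.factorial : ℝ)) := by gcongr; exact hv k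
      _ = _ := one_mul _
  -- The second series supplies the velocity, since `(2 ^ k * t - 1) * (2 ^ k)⁻¹ = t - (2 ^ k)⁻¹`.
  refine ⟨fun t => (∑' k, χ (2 ^ k * t) • y k) +
    ∑' k, ((2 ^ k * t - 1) * χ (2 ^ k * t)) • (((2 : ℝ) ^ k)⁻¹ • v k),
    (contDiff_tsum_bump hχ χ.hasCompactSupport hy).add (contDiff_tsum_bump hχ1 hs1 hw),
    fun k => ?_⟩
  have hk : (0 : ℝ) < 2 ^ k := by positivity
  have hev : ∀ᶠ t : ℝ in 𝓝 (((2 : ℝ) ^ k)⁻¹), |2 ^ k * t - 1| < 1 / 8 := by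
    have : ContinuousAt (fun t : ℝ => |2 ^ k * t - 1|) (((2 : ℝ) ^ k)⁻¹) := by fun_prop
    refine this.eventually_lt_const ?_
    beta_reduce
    rw [mul_inv_cancel₀ hk.ne']; norm_num
  filter_upwards [hev] with t ht
  have hone : χ (2 ^ k * t) = 1 := χ.one_of_mem_closedBall (by
    rw [Metric.mem_closedBall, Real.dist_eq]; exact ht.le)
  have hzero : ∀ j, j ≠ k → χ (2 ^ j * t) = 0 := fun j hj => by
    refine χ.zero_of_le_dist ?_
    rw [Real.dist_eq]
    change (1 : ℝ) / 4 ≤ _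
    rw [abs_lt] at ht
    rcases lt_or_gt_of_ne hj with h | h
    · obtain ⟨m, rfl⟩ := Nat.exists_eq_add_of_lt h
      have h0 : (0 : ℝ) < 2 ^ j * t := by
        have : (0 : ℝ) < 2 ^ (j + m + 1) * t := by linarith
        rw [mul_pos_iff] at this ⊢
        rcases this with h | h
        · exact Or.inl ⟨by positivity, h.2⟩
        · exact absurd h.1 (by push Not; positivity)
      have h2 : (2 : ℝ) ^ (j + m + 1) * t = 2 ^ m * 2 * (2 ^ j * t) := by ring
      have h3 : (1 : ℝ) ≤ 2 ^ m := one_le_pow₀ (by norm_num)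
      rw [abs_sub_comm, le_abs]
      left
      rw [h2] at ht
      nlinarith [mul_le_mul_of_nonneg_right h3 h0.le]
    · obtain ⟨m, rfl⟩ := Nat.exists_eq_add_of_lt h
      have h2 : (2 : ℝ) ^ (k + m + 1) * t = 2 ^ m * 2 * (2 ^ k * t) := by ring
      have h3 : (1 : ℝ) ≤ 2 ^ m := one_le_pow₀ (by norm_num)
      rw [le_abs]
      left
      rw [h2]
      nlinarith [mul_le_mul_of_nonneg_right h3 (show (0 : ℝ) ≤ 2 ^ k * t by linarith)]
  rw [tsum_eq_single k (fun j hj => by rw [hzero j hj, zero_smul]),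
    tsum_eq_single k (fun j hj => by rw [hzero j hj, mul_zero, zero_smul]), hone, one_smul,
    mul_one, smul_smul, sub_mul, mul_right_comm, mul_inv_cancel₀ hk.ne', one_mul, one_mul]

/-- A function is smooth along curves if its composition with smooth curves is smooth. -/
def CurveSmooth (g : E → ℝ) : Prop :=
  ∀ c : ℝ → E, ContDiff ℝ ∞ c → ContDiff ℝ ∞ (fun t => g (c t))

/-- Otherwise there are points `y k` converging very fast to `x` with huge `n`-th derivatives in the
direction `v`. A smooth curve passes through `y k` at time `2⁻ᵏ` with velocity a small multiple of
`v`. Along it the `n`-th derivative of `g` at `2⁻ᵏ` exceeds `k`, although it converges to its value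
at `0`. -/
theorem CurveSmooth.locally_bounded_iteratedDeriv [CompleteSpace E] {g : E → ℝ}
    (hg : CurveSmooth g) (x v : E) (n : ℕ) :
    ∃ C, ∀ᶠ y in 𝓝 x, |iteratedDeriv n (fun t : ℝ => g (y + t • v)) 0| ≤ C := by
  by_contra! hcon
  -- The velocity `ε k • v` has norm at most `1 / k!`. Slowing down by `ε k` divides out `ε k ^ n`
  -- from the `n`-th derivative, so the bad points are chosen with derivative beyond `k / ε k ^ n`.
  let ε : ℕ → ℝ := fun k => 1 / (k.factorial : ℝ) / (1 + ‖v‖)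
  have hε : ∀ k, 0 < ε k := fun k => by positivity
  have hex : ∀ k : ℕ, ∃ y, ‖y - x‖ ≤ 1 / (k.factorial : ℝ) ∧
      (k : ℝ) / ε k ^ n < |iteratedDeriv n (fun t : ℝ => g (y + t • v)) 0| := fun k => by
    have h := hcon ((k : ℝ) / ε k ^ n)
    have h2 : ∀ᶠ y in 𝓝 x, ‖y - x‖ ≤ 1 / (k.factorial : ℝ) := by
      have := Metric.closedBall_mem_nhds x (show 0 < 1 / (k.factorial : ℝ) by positivity)
      filter_upwards [this] with y hy
      rwa [← dist_eq_norm]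
    obtain ⟨y, hy1, hy2⟩ := (h.and_eventually h2).exists
    exact ⟨y, hy2, hy1⟩
  choose y hy1 hy2 using hex
  have hv : ∀ k, ‖ε k • v‖ ≤ 1 / (k.factorial : ℝ) := fun k => by
    rw [norm_smul, Real.norm_of_nonneg (hε k).le]
    have h1 : ‖v‖ / (1 + ‖v‖) ≤ 1 := by
      rw [div_le_one (by positivity)]; linarith [norm_nonneg v]
    calc ε k * ‖v‖ = 1 / (k.factorial : ℝ) * (‖v‖ / (1 + ‖v‖)) := by simp only [ε]; ring
      _ ≤ 1 / (k.factorial : ℝ) * 1 := by gcongr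
      _ = _ := mul_one _
  obtain ⟨c, hc, hcy⟩ := exists_curve_through hy1 hv
  have hsm := hg (fun t => x + c t) (contDiff_const.add hc)
  have hder : ∀ k : ℕ, (k : ℝ) < |iteratedDeriv n (fun t => g (x + c t)) (((2 : ℝ) ^ k)⁻¹)| := by
    intro k
    have hline : ContDiff ℝ ∞ (fun u : ℝ => g (y k + u • v)) :=
      hg _ (contDiff_const.add (contDiff_id.smul contDiff_const))
    have h1 : (fun t => g (x + c t)) =ᶠ[𝓝 (((2 : ℝ) ^ k)⁻¹)]
        fun t => (fun r : ℝ => (fun u : ℝ => g (y k + u • v)) (ε k * r)) (t - ((2 : ℝ) ^ k)⁻¹) := by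
      filter_upwards [hcy k] with t ht
      simp only [ht]
      congr 1
      rw [smul_smul, mul_comm]; abel
    have h2 := congrFun (iteratedDeriv_comp_sub_const n
      (fun r : ℝ => (fun u : ℝ => g (y k + u • v)) (ε k * r)) (((2 : ℝ) ^ k)⁻¹)) (((2 : ℝ) ^ k)⁻¹)
    rw [h1.iteratedDeriv_eq n, h2, sub_self,
      iteratedDeriv_comp_const_mul (hline.of_le (by exact_mod_cast le_top))]
    simp only [mul_zero]
    rw [abs_mul, abs_of_pos (pow_pos (hε k) n), mul_comm]
    exact (div_lt_iff₀ (pow_pos (hε k) n)).1 (hy2 k)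
  have hlim : Tendsto (fun k : ℕ => |iteratedDeriv n (fun t => g (x + c t)) (((2 : ℝ) ^ k)⁻¹)|)
      atTop (𝓝 |iteratedDeriv n (fun t => g (x + c t)) 0|) := by
    have h0 : Tendsto (fun k : ℕ => ((2 : ℝ) ^ k)⁻¹) atTop (𝓝 0) := by
      simp_rw [← inv_pow]
      exact tendsto_pow_atTop_nhds_zero_of_lt_one (by norm_num) (by norm_num)
    exact (((hsm.continuous_iteratedDeriv n (by exact_mod_cast le_top)).tendsto 0).comp h0).abs
  exact not_tendsto_nhds_of_tendsto_atTop
    (tendsto_atTop_mono (fun k => (hder k).le) tendsto_natCast_atTop_atTop) _ hlim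

theorem CurveSmooth.mul {g h : E → ℝ} (hg : CurveSmooth g) (hh : CurveSmooth h) :
    CurveSmooth (fun x => g x * h x) := fun c hc => (hg c hc).mul (hh c hc)

theorem ContDiff.curveSmooth {g : E → ℝ} (hg : ContDiff ℝ ∞ g) : CurveSmooth g :=
  fun _ hc => hg.comp hc

end Boman

/-! ### Fourier decay and Boman's theorem -/

section Boman

open MeasureTheory FourierTransform

/-- Points `y k` tending fast to `x` with `g (y k)` away from `g x` would lie on one smooth curve
arriving at `x` at time `0`, and `g` is continuous along it. -/
theorem CurveSmooth.continuous {E : Type*} [NormedAddCommGroup E] [NormedSpace ℝ E]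
    [CompleteSpace E] {g : E → ℝ} (hg : CurveSmooth g) : Continuous g := by
  rw [continuous_iff_continuousAt]
  intro x
  by_contra hcon
  rw [Metric.continuousAt_iff'] at hcon
  push Not at hcon
  obtain ⟨ε, hε, hfr⟩ := hcon
  have hex : ∀ k : ℕ, ∃ y, ‖y - x‖ ≤ 1 / (k.factorial : ℝ) ∧ ε ≤ dist (g y) (g x) := fun k => by
    have h2 : ∀ᶠ y in 𝓝 x, ‖y - x‖ ≤ 1 / (k.factorial : ℝ) := by
      have := Metric.closedBall_mem_nhds x (show 0 < 1 / (k.factorial : ℝ) by positivity)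
      filter_upwards [this] with y hy
      rwa [← dist_eq_norm]
    obtain ⟨y, hy1, hy2⟩ := (hfr.and_eventually h2).exists
    exact ⟨y, hy2, hy1⟩
  choose y hy1 hy2 using hex
  obtain ⟨c, hc, hcy⟩ := exists_curve_through (v := fun _ => (0 : E)) hy1
    (fun k => by simp only [norm_zero]; positivity)
  have hck : ∀ k : ℕ, c (((2 : ℝ) ^ k)⁻¹) = y k - x := fun k => by
    simpa using (hcy k).self_of_nhds
  have h0 : Tendsto (fun k : ℕ => ((2 : ℝ) ^ k)⁻¹) atTop (𝓝 0) := by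
    simp_rw [← inv_pow]
    exact tendsto_pow_atTop_nhds_zero_of_lt_one (by norm_num) (by norm_num)
  have hfac : Tendsto (fun k : ℕ => 1 / (k.factorial : ℝ)) atTop (𝓝 0) := by
    simpa using FloorSemiring.tendsto_pow_div_factorial_atTop (1 : ℝ)
  have hc0 : c 0 = 0 := by
    have h1 := (hc.continuous.tendsto 0).comp h0
    refine tendsto_nhds_unique h1 (squeeze_zero_norm (fun k => ?_) hfac)
    simpa [hck k] using hy1 k
  have hlim := ((hg (fun t => x + c t) (contDiff_const.add hc)).continuous.tendsto 0).comp h0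
  simp only [Function.comp_def, hck, hc0, add_zero, add_sub_cancel] at hlim
  obtain ⟨k, hk⟩ := ((Metric.tendsto_nhds.1 hlim) ε hε).exists
  exact absurd hk (not_lt.2 (hy2 k))

/-- Decay of the Fourier transform of a function on the plane whose derivatives in the first
variable are bounded. -/
theorem norm_fourier_plane_le {f : ℝ × ℝ → ℂ} (hc : Continuous f) {R : ℝ} (hR : 0 ≤ R)
    (hsupp : ∀ t s, R < |t| ∨ R < |s| → f (t, s) = 0)
    (hsm : ∀ s, ContDiff ℝ ∞ (fun t => f (t, s))) {n : ℕ} {C : ℝ}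
    (hC : ∀ t s, ‖iteratedDeriv n (fun t => f (t, s)) t‖ ≤ C) (a b : ℝ) :
    |2 * Real.pi * a| ^ n * ‖∫ p : ℝ × ℝ, Real.fourierChar (-(p.1 * a + p.2 * b)) • f p‖ ≤
      C * (2 * R) * (2 * R) := by
  have hC0 : 0 ≤ C := (norm_nonneg _).trans (hC 0 0)
  have hcs : HasCompactSupport f := by
    refine HasCompactSupport.intro (K := Icc (-R) R ×ˢ Icc (-R) R)
      (isCompact_Icc.prod isCompact_Icc) fun p hp => ?_
    obtain ⟨t, s⟩ := p
    refine hsupp t s ?_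
    by_contra! h
    exact hp ⟨abs_le.1 h.1, abs_le.1 h.2⟩
  have hcont : Continuous fun p : ℝ × ℝ => Real.fourierChar (-(p.1 * a + p.2 * b)) • f p := by
    have h1 : Continuous fun p : ℝ × ℝ => Real.fourierChar (-(p.1 * a + p.2 * b)) :=
      Real.continuous_fourierChar.comp (by fun_prop)
    exact h1.smul hc
  have hinteg : Integrable (fun p : ℝ × ℝ => Real.fourierChar (-(p.1 * a + p.2 * b)) • f p)
      (volume.prod volume) := by
    refine hcont.integrable_of_hasCompactSupport ?_
    exact hcs.smul_left (f' := f)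
  have hvan : ∀ (m : ℕ) (s t : ℝ), R < |t| ∨ R < |s| →
      iteratedDeriv m (fun t => f (t, s)) t = 0 := by
    intro m s t h
    have : (fun t => f (t, s)) =ᶠ[𝓝 t] fun _ => 0 := by
      rcases h with h | h
      · filter_upwards [(isOpen_lt continuous_const continuous_abs).mem_nhds h] with t' ht'
        exact hsupp t' s (Or.inl ht')
      · exact Eventually.of_forall fun t' => hsupp t' s (Or.inr h)
    rw [this.iteratedDeriv_eq m]
    simp
  -- By Fubini the plane transform is an integral over `s` of one-dimensional transforms of the
  -- slices `t ↦ f (t, s)`. On each slice `n` derivatives produce the factor `(2πia)ⁿ`, and both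
  -- integrations run over an interval of length `2R`.
  have hinner : ∀ s : ℝ, (∫ t : ℝ, Real.fourierChar (-(t * a + s * b)) • f (t, s)) =
      Real.fourierChar (-(s * b)) • 𝓕 (fun t => f (t, s)) a := by
    intro s
    rw [Real.fourier_real_eq, Circle.smul_def, ← integral_smul]
    congr 1
    ext t
    rw [← Circle.smul_def, smul_smul, ← AddChar.map_add_eq_mul]
    congr 2
    ring_nf
  have hbound : ∀ s : ℝ, |2 * Real.pi * a| ^ n * ‖𝓕 (fun t => f (t, s)) a‖ ≤ C * (2 * R) := by
    intro s
    have hI : ∀ m : ℕ, (m : ℕ∞) ≤ (⊤ : ℕ∞) →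
        Integrable (iteratedDeriv m (fun t => f (t, s))) := fun m _ => by
      refine ((hsm s).continuous_iteratedDeriv m
        (by exact_mod_cast le_top)).integrable_of_hasCompactSupport ?_
      refine HasCompactSupport.intro (K := Icc (-R) R) isCompact_Icc fun t ht => hvan m s t ?_
      left
      by_contra! h
      exact ht (abs_le.1 h)
    have h1 := congrFun (Real.fourier_iteratedDeriv (N := ⊤) (n := n) (hsm s) hI le_top) a
    have h2 : ‖𝓕 (iteratedDeriv n (fun t => f (t, s))) a‖ =
        |2 * Real.pi * a| ^ n * ‖𝓕 (fun t => f (t, s)) a‖ := by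
      rw [h1, norm_smul, norm_pow]
      simp [abs_mul]
    rw [← h2, Real.fourier_real_eq]
    rw [← setIntegral_eq_integral_of_forall_compl_eq_zero (s := Icc (-R) R)]
    · refine (norm_setIntegral_le_of_norm_le_const (C := C) (by simp) ?_).trans ?_
      · intro t _
        rw [Circle.norm_smul]
        exact hC t s
      · simp [Measure.real, Real.volume_Icc]
        rw [ENNReal.toReal_ofReal (by linarith)]
        nlinarith
    · intro t ht
      rw [hvan n s t, smul_zero]
      left
      by_contra! h
      exact ht (abs_le.1 h)
  have hz : ∀ s : ℝ, R < |s| → 𝓕 (fun t => f (t, s)) a = 0 := by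
    intro s hs
    rw [Real.fourier_real_eq]
    simp [fun t => hsupp t s (Or.inr hs)]
  rw [show (∫ p : ℝ × ℝ, Real.fourierChar (-(p.1 * a + p.2 * b)) • f p) =
    ∫ p : ℝ × ℝ, Real.fourierChar (-(p.1 * a + p.2 * b)) • f p ∂(volume.prod volume) from rfl,
    integral_prod_symm _ hinteg]
  simp only [hinner]
  rw [← setIntegral_eq_integral_of_forall_compl_eq_zero (s := Icc (-R) R)]
  · have h3 : |2 * Real.pi * a| ^ n *
        ‖∫ s in Icc (-R) R, Real.fourierChar (-(s * b)) • 𝓕 (fun t => f (t, s)) a‖ =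
        ‖∫ s in Icc (-R) R, (|2 * Real.pi * a| ^ n : ℝ) •
          Real.fourierChar (-(s * b)) • 𝓕 (fun t => f (t, s)) a‖ := by
      rw [integral_smul, norm_smul, Real.norm_of_nonneg (by positivity)]
    rw [h3]
    refine (norm_setIntegral_le_of_norm_le_const (C := C * (2 * R)) (by simp) ?_).trans ?_
    · intro s _
      rw [norm_smul, Real.norm_of_nonneg (by positivity), Circle.norm_smul]
      exact hbound s
    · simp [Measure.real, Real.volume_Icc]
      rw [ENNReal.toReal_ofReal (by linarith)]
      nlinarith [mul_nonneg hC0 hR]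
  · intro s hs
    rw [hz s, smul_zero]
    by_contra! h
    exact hs (abs_le.1 h)

/-- The local bounds become one bound by compactness of the support, and off the support the
derivatives vanish. -/
theorem CurveSmooth.exists_bound_iteratedDeriv {f : ℝ × ℝ → ℝ} (hf : CurveSmooth f)
    (hs : HasCompactSupport f) (n : ℕ) :
    ∃ C, ∀ t s, ‖iteratedDeriv n (fun t => (f (t, s) : ℂ)) t‖ ≤ C := by
  have hline : ∀ s, ContDiff ℝ ∞ (fun t => f (t, s)) := fun s =>
    hf (fun t => (t, s)) (contDiff_id.prodMk contDiff_const)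
  have h1 : ∀ t s, ‖iteratedDeriv n (fun t => (f (t, s) : ℂ)) t‖ =
      |iteratedDeriv n (fun u : ℝ => f ((t, s) + u • ((1 : ℝ), (0 : ℝ)))) 0| := by
    intro t s
    have e1 : (fun t => (f (t, s) : ℂ)) = Complex.ofRealLI ∘ (fun t => f (t, s)) := rfl
    have e2 : (fun u : ℝ => f ((t, s) + u • ((1 : ℝ), (0 : ℝ)))) = fun u => f (t + u, s) := by
      ext u; simp
    rw [e2, iteratedDeriv_comp_const_add n (fun t => f (t, s)) t, e1,
      ← norm_iteratedFDeriv_eq_norm_iteratedDeriv,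
      Complex.ofRealLI.norm_iteratedFDeriv_comp_left (hline s).contDiffAt
        (by exact_mod_cast le_top),
      norm_iteratedFDeriv_eq_norm_iteratedDeriv]
    simp
  have hK : ∃ C, ∀ p ∈ tsupport f,
      |iteratedDeriv n (fun u : ℝ => f (p + u • ((1 : ℝ), (0 : ℝ)))) 0| ≤ C := by
    refine IsCompact.induction_on hs (p := fun S => ∃ C, ∀ p ∈ S,
      |iteratedDeriv n (fun u : ℝ => f (p + u • ((1 : ℝ), (0 : ℝ)))) 0| ≤ C) ⟨0, by simp⟩
      (fun S T hST ⟨C, hC⟩ => ⟨C, fun p hp => hC p (hST hp)⟩)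
      (fun S T ⟨C, hC⟩ ⟨D, hD⟩ => ⟨max C D, fun p hp => ?_⟩) (fun x _ => ?_)
    · rcases hp with h | h
      · exact (hC p h).trans (le_max_left _ _)
      · exact (hD p h).trans (le_max_right _ _)
    · obtain ⟨C, hC⟩ := hf.locally_bounded_iteratedDeriv x ((1 : ℝ), (0 : ℝ)) n
      exact ⟨_, mem_nhdsWithin_of_mem_nhds hC, C, fun p hp => hp⟩
  obtain ⟨C, hC⟩ := hK
  refine ⟨max C 0, fun t s => ?_⟩
  rw [h1]
  by_cases hp : (t, s) ∈ tsupport f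
  · exact (hC _ hp).trans (le_max_left _ _)
  · have h0 : f =ᶠ[𝓝 (t, s)] 0 := notMem_tsupport_iff_eventuallyEq.1 hp
    have : (fun u : ℝ => f ((t, s) + u • ((1 : ℝ), (0 : ℝ)))) =ᶠ[𝓝 0] fun _ => 0 := by
      have hcont : Tendsto (fun u : ℝ => (t, s) + u • ((1 : ℝ), (0 : ℝ))) (𝓝 0) (𝓝 (t, s)) := by
        have : Continuous (fun u : ℝ => (t, s) + u • ((1 : ℝ), (0 : ℝ))) := by fun_prop
        simpa using this.tendsto 0
      exact hcont.eventually h0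
    rw [this.iteratedDeriv_eq n]
    simp

/-- Bounded partial derivatives of all orders in each of the two variables make the Fourier
transform decay faster than any power. Mixed derivatives are not needed. A function whose transform
has all moments integrable is smooth by Fourier inversion. -/
theorem CurveSmooth.contDiff_of_hasCompactSupport {f : ℝ × ℝ → ℝ} (hf : CurveSmooth f)
    (hs : HasCompactSupport f) : ContDiff ℝ ∞ f := by
  -- The plane is taken to be `ℂ`, because the Fourier transform needs an inner product and `ℝ × ℝ`
  -- carries the sup norm.
  let F : ℂ → ℂ := fun z => (f (z.re, z.im) : ℂ)
  have hfc := hf.continuous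
  have hFc : Continuous F :=
    Complex.continuous_ofReal.comp (hfc.comp (Complex.continuous_re.prodMk Complex.continuous_im))
  obtain ⟨R, hR, hsub⟩ : ∃ R, 0 ≤ R ∧ ∀ t s, R < |t| ∨ R < |s| → f (t, s) = 0 := by
    obtain ⟨R, hR⟩ := hs.isBounded.subset_closedBall (0 : ℝ × ℝ)
    refine ⟨max R 0, le_max_right _ _, fun t s h => ?_⟩
    by_contra hne
    have h1 := hR (subset_tsupport f (Function.mem_support.2 hne))
    rw [mem_closedBall_zero_iff, Prod.norm_def, max_le_iff] at h1
    simp only [Real.norm_eq_abs] at h1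
    rcases h with h | h
    · exact absurd (lt_of_le_of_lt (le_max_left _ _) h) (not_lt.2 h1.1)
    · exact absurd (lt_of_le_of_lt (le_max_left _ _) h) (not_lt.2 h1.2)
  have hFs : HasCompactSupport F := by
    have h1 : HasCompactSupport (fun z : ℂ => f (Complex.equivRealProdCLM z)) :=
      hs.comp_homeomorph Complex.equivRealProdCLM.toHomeomorph
    exact h1.comp_left (g := fun r : ℝ => (r : ℂ)) (by simp)
  have hFi : Integrable F := hFc.integrable_of_hasCompactSupport hFs
  have hfour : ∀ ξ : ℂ, 𝓕 F ξ =
      ∫ p : ℝ × ℝ, Real.fourierChar (-(p.1 * ξ.re + p.2 * ξ.im)) • (f p : ℂ) := by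
    intro ξ
    rw [Real.fourier_eq, ← Complex.volume_preserving_equiv_real_prod.integral_comp'
      (fun p : ℝ × ℝ => Real.fourierChar (-(p.1 * ξ.re + p.2 * ξ.im)) • (f p : ℂ))]
    congr 1
    ext z
    simp only [F, Complex.measurableEquivRealProd_apply]
    congr 3
    rw [Complex.inner]
    simp
    ring
  let fs : ℝ × ℝ → ℝ := fun p => f p.swap
  have hswap : CurveSmooth fs := fun c hc => hf (fun t => (c t).swap)
    (hc.snd.prodMk hc.fst)
  have hfss : HasCompactSupport fs := hs.comp_homeomorph (Homeomorph.prodComm ℝ ℝ)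
  have hre : ∀ n : ℕ, ∃ K, ∀ ξ : ℂ, |ξ.re| ^ n * ‖𝓕 F ξ‖ ≤ K := by
    intro n
    obtain ⟨C, hC⟩ := hf.exists_bound_iteratedDeriv hs n
    refine ⟨C * (2 * R) * (2 * R), fun ξ => ?_⟩
    have h := norm_fourier_plane_le (f := fun p => (f p : ℂ)) (Complex.continuous_ofReal.comp hfc)
      hR (fun t s h => by simp [hsub t s h]) (fun s => Complex.ofRealCLM.contDiff.comp
        (hf (fun t => (t, s)) (contDiff_id.prodMk contDiff_const))) hC ξ.re ξ.im
    rw [← hfour] at h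
    refine le_trans (mul_le_mul_of_nonneg_right (pow_le_pow_left₀ (abs_nonneg _) ?_ n)
      (norm_nonneg _)) h
    rw [abs_mul, abs_of_pos Real.two_pi_pos]
    nlinarith [abs_nonneg ξ.re, Real.pi_gt_three]
  have him : ∀ n : ℕ, ∃ K, ∀ ξ : ℂ, |ξ.im| ^ n * ‖𝓕 F ξ‖ ≤ K := by
    intro n
    obtain ⟨C, hC⟩ := hswap.exists_bound_iteratedDeriv hfss n
    refine ⟨C * (2 * R) * (2 * R), fun ξ => ?_⟩
    have h := norm_fourier_plane_le (f := fun p => (fs p : ℂ))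
      (Complex.continuous_ofReal.comp hswap.continuous)
      hR (fun t s h => by simp [fs, hsub s t h.symm]) (fun s => Complex.ofRealCLM.contDiff.comp
        (hswap (fun t => (t, s)) (contDiff_id.prodMk contDiff_const))) hC ξ.im ξ.re
    have e : 𝓕 F ξ =
        ∫ p : ℝ × ℝ, Real.fourierChar (-(p.1 * ξ.im + p.2 * ξ.re)) • (fs p : ℂ) := by
      rw [hfour]
      have := integral_prod_swap (μ := (volume : Measure ℝ)) (ν := (volume : Measure ℝ))
        (fun p : ℝ × ℝ => Real.fourierChar (-(p.1 * ξ.re + p.2 * ξ.im)) • (f p : ℂ))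
      rw [← Measure.volume_eq_prod] at this
      rw [← this]
      congr 1
      ext p
      simp only [fs, Prod.fst_swap, Prod.snd_swap]
      rw [add_comm]
    rw [← e] at h
    refine le_trans (mul_le_mul_of_nonneg_right (pow_le_pow_left₀ (abs_nonneg _) ?_ n)
      (norm_nonneg _)) h
    rw [abs_mul, abs_of_pos Real.two_pi_pos]
    nlinarith [abs_nonneg ξ.im, Real.pi_gt_three]
  have hdec : ∀ n : ℕ, ∃ K, ∀ ξ : ℂ, ‖ξ‖ ^ n * ‖𝓕 F ξ‖ ≤ K := by
    intro n
    obtain ⟨K, hK⟩ := hre n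
    obtain ⟨L, hL⟩ := him n
    refine ⟨2 ^ n * (K + L), fun ξ => ?_⟩
    have h1 : ‖ξ‖ ^ n ≤ 2 ^ n * (|ξ.re| ^ n + |ξ.im| ^ n) := by
      have h2 : ‖ξ‖ ≤ 2 * max |ξ.re| |ξ.im| := by
        refine (Complex.norm_le_abs_re_add_abs_im ξ).trans ?_
        linarith [le_max_left |ξ.re| |ξ.im|, le_max_right |ξ.re| |ξ.im|]
      calc ‖ξ‖ ^ n ≤ (2 * max |ξ.re| |ξ.im|) ^ n := by gcongr
        _ = 2 ^ n * (max |ξ.re| |ξ.im|) ^ n := mul_pow _ _ _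
        _ ≤ _ := by
          gcongr
          rcases max_choice |ξ.re| |ξ.im| with h | h <;> rw [h]
          · linarith [pow_nonneg (abs_nonneg ξ.im) n]
          · linarith [pow_nonneg (abs_nonneg ξ.re) n]
    calc _ ≤ 2 ^ n * (|ξ.re| ^ n + |ξ.im| ^ n) * ‖𝓕 F ξ‖ := by gcongr
      _ = 2 ^ n * (|ξ.re| ^ n * ‖𝓕 F ξ‖ + |ξ.im| ^ n * ‖𝓕 F ξ‖) := by ring
      _ ≤ _ := by gcongr; exacts [hK ξ, hL ξ]
  have hFFc : Continuous (𝓕 F) := VectorFourier.fourierIntegral_continuous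
    Real.continuous_fourierChar (L := innerₗ ℂ) continuous_inner hFi
  have hinteg : ∀ n : ℕ, Integrable (fun ξ : ℂ => ‖ξ‖ ^ n * ‖𝓕 F ξ‖) := by
    intro n
    obtain ⟨K, hK⟩ := hdec n
    obtain ⟨L, hL⟩ := hdec (n + 3)
    -- The exponent `3` exceeds the real dimension `2`; it is paid for by three extra powers of
    -- `‖ξ‖` in the decay bound.
    have h3 : Integrable (fun ξ : ℂ => (1 + ‖ξ‖) ^ (-(3 : ℝ))) := integrable_one_add_norm (by
      rw [Complex.finrank_real_complex]; norm_num)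
    refine (h3.const_mul (4 * (K + L))).mono'
      ((continuous_norm.pow n).mul hFFc.norm).aestronglyMeasurable (Eventually.of_forall fun ξ => ?_)
    have h4 : (0 : ℝ) < 1 + ‖ξ‖ := by positivity
    rw [Real.norm_of_nonneg (by positivity), Real.rpow_neg h4.le, ← div_eq_mul_inv,
      le_div_iff₀ (by positivity)]
    rw [show (3 : ℝ) = ((3 : ℕ) : ℝ) by norm_num, Real.rpow_natCast]
    have h5 : (1 + ‖ξ‖) ^ 3 ≤ 4 * (1 + ‖ξ‖ ^ 3) := by
      nlinarith [norm_nonneg ξ, sq_nonneg (1 - ‖ξ‖), mul_nonneg (norm_nonneg ξ) (sq_nonneg (1 - ‖ξ‖))]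
    calc ‖ξ‖ ^ n * ‖𝓕 F ξ‖ * (1 + ‖ξ‖) ^ 3 ≤ ‖ξ‖ ^ n * ‖𝓕 F ξ‖ * (4 * (1 + ‖ξ‖ ^ 3)) := by gcongr
      _ = 4 * (‖ξ‖ ^ n * ‖𝓕 F ξ‖ + ‖ξ‖ ^ (n + 3) * ‖𝓕 F ξ‖) := by ring
      _ ≤ _ := by gcongr; exacts [hK ξ, hL ξ]
  have hFFi : Integrable (𝓕 F) := by
    have := hinteg 0
    simp only [pow_zero, one_mul] at this
    exact (integrable_norm_iff hFFc.aestronglyMeasurable).1 this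
  have hinv := hFc.fourierInv_fourier_eq hFi hFFi
  have hsm : ContDiff ℝ ∞ (𝓕 (𝓕 F)) := Real.contDiff_fourier (N := ⊤) fun n _ => hinteg n
  have hF : ContDiff ℝ ∞ F := by
    rw [← hinv]
    have : 𝓕⁻ (𝓕 F) = fun w => 𝓕 (𝓕 F) (-w) := by
      ext w; exact Real.fourierInv_eq_fourier_neg _ _
    rw [this]
    exact hsm.comp contDiff_neg
  have : f = fun p => Complex.reCLM (F (Complex.equivRealProdCLM.symm p)) := by
    ext p
    simp [F]
  rw [this]
  exact Complex.reCLM.contDiff.comp (hF.comp Complex.equivRealProdCLM.symm.contDiff)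

/-- **Boman's theorem** in the plane: a function which is smooth along smooth curves is smooth. -/
theorem CurveSmooth.contDiff {g : ℝ × ℝ → ℝ} (hg : CurveSmooth g) : ContDiff ℝ ∞ g := by
  rw [contDiff_iff_contDiffAt]
  intro x
  let χ : ContDiffBump x := ⟨1, 2, by norm_num, by norm_num⟩
  have h1 : ContDiff ℝ ∞ (fun y => χ y * g y) :=
    ((ContDiff.curveSmooth χ.contDiff).mul hg).contDiff_of_hasCompactSupport
      χ.hasCompactSupport.mul_right
  refine h1.contDiffAt.congr_of_eventuallyEq ?_
  filter_upwards [χ.eventuallyEq_one] with y hy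
  simp [hy]

end Boman

/-! ### Localization of curves, Hadamard's lemma and scalarwise smoothness -/

section Calculus

/-- A smooth self-map with values in a given neighbourhood of `x₀`, equal to the identity
near `x₀`. -/
theorem exists_squash {E : Type*} [NormedAddCommGroup E] [NormedSpace ℝ E] [HasContDiffBump E]
    (x₀ : E) {U : Set E} (hU : U ∈ 𝓝 x₀) :
    ∃ s : E → E, ContDiff ℝ ∞ s ∧ (∀ x, s x ∈ U) ∧ ∀ᶠ x in 𝓝 x₀, s x = x := by
  obtain ⟨ε, hε, hεU⟩ := Metric.mem_nhds_iff.1 hU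
  let χ : ContDiffBump x₀ := ⟨ε / 2, ε, by positivity, by linarith⟩
  refine ⟨fun x => x₀ + χ x • (x - x₀),
    contDiff_const.add (χ.contDiff.smul (contDiff_id.sub contDiff_const)), fun x => hεU ?_, ?_⟩
  · rw [Metric.mem_ball, dist_eq_norm, add_sub_cancel_left, norm_smul, Real.norm_of_nonneg χ.nonneg]
    by_cases hx : dist x x₀ < ε
    · rw [dist_eq_norm] at hx
      exact (mul_le_of_le_one_left (norm_nonneg _) χ.le_one).trans_lt hx
    · rw [χ.zero_of_le_dist (not_lt.1 hx), zero_mul]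
      exact hε
  · filter_upwards [χ.eventuallyEq_one] with x hx
    simp [hx]

variable {V : Type*} [NormedAddCommGroup V] [NormedSpace ℝ V]

/-- Differentiation under the integral sign. The weight `u ^ n` is there so that the derivative is
an integral of the same shape, with `n + 1` and `deriv k`; the induction for smoothness then closes.
-/
theorem hasDerivAt_integral_pow_smul_comp_mul {k : ℝ → V} (hk : ContDiff ℝ ∞ k) (n : ℕ) (t₀ : ℝ) :
    HasDerivAt (fun t => ∫ u in (0 : ℝ)..1, u ^ n • k (u * t))
      (∫ u in (0 : ℝ)..1, u ^ (n + 1) • deriv k (u * t₀)) t₀ := by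
  have hk' : Continuous (deriv k) := hk.continuous_deriv (by simp)
  obtain ⟨C, hC⟩ := (isCompact_Icc (a := -(|t₀| + 1)) (b := |t₀| + 1)).exists_bound_of_continuousOn
    hk'.continuousOn
  refine (intervalIntegral.hasDerivAt_integral_of_dominated_loc_of_deriv_le
    (F' := fun t u => u ^ (n + 1) • deriv k (u * t)) (bound := fun _ => C)
    (Metric.ball_mem_nhds t₀ one_pos) (Eventually.of_forall fun t => ?_) ?_ ?_ ?_ ?_ ?_).2
  · exact ((continuous_id.pow n).smul
      (hk.continuous.comp (continuous_id.mul continuous_const))).aestronglyMeasurable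
  · exact ((continuous_id.pow n).smul
      (hk.continuous.comp (continuous_id.mul continuous_const))).intervalIntegrable _ _
  · exact ((continuous_id.pow (n + 1)).smul
      (hk'.comp (continuous_id.mul continuous_const))).aestronglyMeasurable
  · refine Eventually.of_forall fun u hu t ht => ?_
    rw [uIoc_of_le zero_le_one] at hu
    have h1 : |t| ≤ |t₀| + 1 := by
      rw [Metric.mem_ball, Real.dist_eq] at ht
      have := abs_sub_abs_le_abs_sub t t₀
      linarith
    have h2 : |u * t| ≤ |t₀| + 1 := by
      rw [abs_mul, abs_of_pos hu.1]
      exact (mul_le_of_le_one_left (abs_nonneg _) hu.2).trans h1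
    have h3 := hC (u * t) (abs_le.1 h2)
    rw [norm_smul, norm_pow, Real.norm_of_nonneg hu.1.le]
    exact (mul_le_of_le_one_left (norm_nonneg _) (pow_le_one₀ hu.1.le hu.2)).trans h3
  · exact intervalIntegrable_const
  · refine Eventually.of_forall fun u _ t _ => ?_
    have h1 : HasDerivAt k (deriv k (u * t)) (u * t) :=
      (hk.differentiable (by simp) _).hasDerivAt
    have h2 := (h1.scomp t ((hasDerivAt_id t).const_mul u)).const_smul (u ^ n)
    simp only [mul_one, smul_smul, ← pow_succ] at h2
    exact h2

theorem contDiff_integral_pow_smul_comp_mul {k : ℝ → V} (hk : ContDiff ℝ ∞ k) (n : ℕ) :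
    ContDiff ℝ ∞ (fun t => ∫ u in (0 : ℝ)..1, u ^ n • k (u * t)) := by
  rw [contDiff_infty]
  intro m
  induction m generalizing k n with
  | zero =>
    refine contDiff_zero.2 (continuous_iff_continuousAt.2 fun t => ?_)
    exact (hasDerivAt_integral_pow_smul_comp_mul hk n t).continuousAt
  | succ m ih =>
    have hd := hasDerivAt_integral_pow_smul_comp_mul hk n
    rw [Nat.cast_add, Nat.cast_one, contDiff_succ_iff_deriv]
    refine ⟨fun t => (hd t).differentiableAt, by simp, ?_⟩
    rw [funext fun t => (hd t).deriv]
    exact ih (contDiff_infty_iff_deriv.1 hk).2 (n + 1)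

/-- Hadamard's lemma in one variable. -/
theorem ContDiff.exists_hadamard [CompleteSpace V] {c : ℝ → V} (hc : ContDiff ℝ ∞ c) :
    ∃ q : ℝ → V, ContDiff ℝ ∞ q ∧ q 0 = deriv c 0 ∧ ∀ t, c t = c 0 + t • q t := by
  have hc' : ContDiff ℝ ∞ (deriv c) := (contDiff_infty_iff_deriv.1 hc).2
  -- The mean of the derivative over the segment from `0` to `t`; the weight `u ^ 0` matches the
  -- preceding lemma.
  refine ⟨fun t => ∫ u in (0 : ℝ)..1, u ^ 0 • deriv c (u * t),
    contDiff_integral_pow_smul_comp_mul hc' 0, by simp, fun t => ?_⟩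
  have h1 : ∀ u ∈ uIcc (0 : ℝ) 1, HasDerivAt (fun u => c (u * t)) (t • deriv c (u * t)) u := by
    intro u _
    have h1 : HasDerivAt c (deriv c (u * t)) (u * t) := (hc.differentiable (by simp) _).hasDerivAt
    have h2 := h1.scomp u ((hasDerivAt_id u).mul_const t)
    rw [one_mul] at h2
    exact h2
  have h2 := intervalIntegral.integral_eq_sub_of_hasDerivAt h1
    ((continuous_const.smul (hc'.continuous.comp
      (continuous_id.mul continuous_const))).intervalIntegrable _ _)
  simp only [one_mul, zero_mul] at h2
  simp only [pow_zero, one_smul]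
  rw [← intervalIntegral.integral_smul, h2]
  abel

/-- The difference quotients `q` are shown to be Lipschitz near `0`. Under a functional `l`, the
quotient `l ∘ q` extends smoothly by Hadamard's lemma, so its own difference quotients `l (w p)` are
bounded. The uniform boundedness principle in the bidual turns this into a bound on `‖w p‖`. Thus
`q` is Cauchy at `0`, and completeness gives the derivative. -/
theorem exists_hasDerivAt_of_forall_dual [CompleteSpace V] {c : ℝ → V}
    (hc : ∀ l : V →L[ℝ] ℝ, ContDiff ℝ ∞ (fun t => l (c t))) (t : ℝ) : ∃ v, HasDerivAt c v t := by
  let q : ℝ → V := fun h => h⁻¹ • (c (t + h) - c t)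
  let I := {p : ℝ × ℝ // p.1 ≠ 0 ∧ p.2 ≠ 0 ∧ p.1 ≠ p.2 ∧ |p.1| ≤ 1 ∧ |p.2| ≤ 1}
  let w : I → V := fun p => (p.1.1 - p.1.2)⁻¹ • (q p.1.1 - q p.1.2)
  have hq : ∀ l : V →L[ℝ] ℝ, ∃ K, ∀ p : I, ‖l (w p)‖ ≤ K := by
    intro l
    have h1 : ContDiff ℝ ∞ (fun h => l (c (t + h))) := (hc l).comp (contDiff_const.add contDiff_id)
    obtain ⟨r, hr, -, hrq⟩ := h1.exists_hadamard
    have hr' : Continuous (deriv r) := hr.continuous_deriv (by simp)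
    obtain ⟨K, hK⟩ := (isCompact_Icc (a := (-1 : ℝ)) (b := 1)).exists_bound_of_continuousOn
      hr'.continuousOn
    refine ⟨K, fun ⟨⟨a, b⟩, ha, hb, hab, ha1, hb1⟩ => ?_⟩
    have hqr : ∀ h, h ≠ 0 → l (q h) = r h := fun h hh => by
      have := hrq h
      simp only [add_zero] at this
      simp only [q, map_smul, map_sub, this, smul_eq_mul]
      field_simp
      ring
    have h2 := (convex_Icc (-1 : ℝ) 1).norm_image_sub_le_of_norm_deriv_le
      (fun x _ => hr.differentiable (by simp) x) hK (abs_le.1 hb1) (abs_le.1 ha1)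
    have h3 : 0 < ‖a - b‖ := norm_pos_iff.2 (sub_ne_zero.2 hab)
    simp only [w, map_smul, map_sub, hqr a ha, hqr b hb, norm_smul, norm_inv]
    rw [inv_mul_le_iff₀ h3]
    linarith
  obtain ⟨K, hK⟩ := banach_steinhaus
    (g := fun p : I => NormedSpace.inclusionInDoubleDual ℝ V (w p)) (fun l => by
      obtain ⟨K, hK⟩ := hq l
      exact ⟨K, fun p => by simpa using hK p⟩)
  have hK' : ∀ p : I, ‖w p‖ ≤ K := fun p => by
    have h := hK p
    rwa [show ‖NormedSpace.inclusionInDoubleDual ℝ V (w p)‖ = ‖w p‖ from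
      (NormedSpace.inclusionInDoubleDualLi ℝ).norm_map (w p)] at h
  have hlip : ∀ a b : ℝ, a ≠ 0 → b ≠ 0 → |a| ≤ 1 → |b| ≤ 1 → ‖q a - q b‖ ≤ K * |a - b| := by
    intro a b ha hb ha1 hb1
    rcases eq_or_ne a b with rfl | hab
    · simp
    · have h := hK' ⟨(a, b), ha, hb, hab, ha1, hb1⟩
      simp only [w, norm_smul, norm_inv] at h
      rw [inv_mul_le_iff₀ (norm_pos_iff.2 (sub_ne_zero.2 hab)), Real.norm_eq_abs] at h
      linarith
  have hcau : Cauchy (map q (𝓝[≠] 0)) := by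
    rw [Metric.cauchy_iff]
    refine ⟨inferInstance, fun ε hε => ?_⟩
    let r := min 1 (ε / (2 * (|K| + 1)))
    have hr : 0 < r := lt_min one_pos (by positivity)
    refine ⟨q '' (Metric.ball 0 r ∩ {0}ᶜ), image_mem_map (inter_mem
      (mem_nhdsWithin_of_mem_nhds (Metric.ball_mem_nhds _ hr)) self_mem_nhdsWithin), ?_⟩
    rintro _ ⟨a, ⟨ha, ha0⟩, rfl⟩ _ ⟨b, ⟨hb, hb0⟩, rfl⟩
    rw [mem_ball_zero_iff, Real.norm_eq_abs] at ha hb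
    have ha1 := ha.le.trans (min_le_left _ _)
    have hb1 := hb.le.trans (min_le_left _ _)
    have h := hlip a b ha0 hb0 ha1 hb1
    have hab : |a - b| < ε / (|K| + 1) := by
      have h1 := ha.trans_le (min_le_right _ _)
      have h2 := hb.trans_le (min_le_right _ _)
      have h3 : ε / (|K| + 1) = ε / (2 * (|K| + 1)) + ε / (2 * (|K| + 1)) := by field_simp; ring
      have := abs_sub a b
      linarith
    rw [dist_eq_norm]
    calc ‖q a - q b‖ ≤ K * |a - b| := h
      _ ≤ (|K| + 1) * |a - b| := by gcongr; linarith [le_abs_self K]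
      _ < (|K| + 1) * (ε / (|K| + 1)) := by gcongr
      _ = ε := by field_simp
  obtain ⟨v, hv⟩ := CompleteSpace.complete hcau
  exact ⟨v, hasDerivAt_iff_tendsto_slope_zero.2 hv⟩

/-- A curve in a Banach space which is scalarwise smooth is smooth. -/
theorem contDiff_of_forall_dual [CompleteSpace V] {c : ℝ → V}
    (hc : ∀ l : V →L[ℝ] ℝ, ContDiff ℝ ∞ (fun t => l (c t))) : ContDiff ℝ ∞ c := by
  rw [contDiff_infty]
  intro m
  induction m generalizing c with
  | zero =>
    refine contDiff_zero.2 (continuous_iff_continuousAt.2 fun t => ?_)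
    obtain ⟨v, hv⟩ := exists_hasDerivAt_of_forall_dual hc t
    exact hv.continuousAt
  | succ m ih =>
    have hd : ∀ t, HasDerivAt c (deriv c t) t := fun t => by
      obtain ⟨v, hv⟩ := exists_hasDerivAt_of_forall_dual hc t
      exact hv.differentiableAt.hasDerivAt
    rw [Nat.cast_add, Nat.cast_one, contDiff_succ_iff_deriv]
    refine ⟨fun t => (hd t).differentiableAt, by simp, ih fun l => ?_⟩
    have h1 : deriv (fun t => l (c t)) = fun t => l (deriv c t) :=
      funext fun t => (l.hasFDerivAt.comp_hasDerivAt t (hd t)).deriv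
    rw [← h1]
    exact (contDiff_infty_iff_deriv.1 (hc l)).2

end Calculus

namespace Convenient

/-! ### Smooth curves in Banach spaces and in projective limits -/

theorem smoothCurve_iff_contDiff {V : Type*} [NormedAddCommGroup V] [NormedSpace ℝ V]
    {c : ℝ → V} : SmoothCurve c ↔ ContDiff ℝ ∞ c := by
  constructor
  · rintro ⟨D, rfl, hD⟩
    have hd : ∀ n t, HasDerivAt (D n) (D (n + 1) t) t := fun n t =>
      hasDerivAt_iff_tendsto_slope_zero.2 (hD n t)
    rw [contDiff_infty]
    intro m
    -- The induction must treat all `D n` at once, since the derivative of `D n` is `D (n + 1)`.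
    generalize 0 = n
    induction m generalizing n with
    | zero =>
      exact contDiff_zero.2 (continuous_iff_continuousAt.2 fun t => (hd n t).continuousAt)
    | succ m ih =>
      rw [Nat.cast_add, Nat.cast_one, contDiff_succ_iff_deriv]
      refine ⟨fun t => (hd n t).differentiableAt, by simp, ?_⟩
      rw [funext fun t => (hd n t).deriv]
      exact ih (n + 1)
  · intro hc
    refine ⟨fun n => iteratedDeriv n c, iteratedDeriv_zero, fun n t => ?_⟩
    have h1 : HasDerivAt (iteratedDeriv n c) (iteratedDeriv (n + 1) c t) t := by
      rw [iteratedDeriv_succ]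
      exact ((hc.differentiable_iteratedDeriv n (by exact_mod_cast ENat.natCast_lt_top n)) t).hasDerivAt
    exact hasDerivAt_iff_tendsto_slope_zero.1 h1

theorem SmoothCurve.clm {F G : Type*} [AddCommGroup F] [Module ℝ F] [TopologicalSpace F]
    [AddCommGroup G] [Module ℝ G] [TopologicalSpace G] (L : F →L[ℝ] G) {c : ℝ → F}
    (hc : SmoothCurve c) : SmoothCurve (fun t => L (c t)) := by
  obtain ⟨D, hD0, hD⟩ := hc
  refine ⟨fun n t => L (D n t), by simp only [hD0], fun n t => ?_⟩
  have := (L.continuous.tendsto _).comp (hD n t)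
  simpa [Function.comp_def] using this

theorem smoothCurve_prod_iff {F G : Type*} [AddCommGroup F] [Module ℝ F] [TopologicalSpace F]
    [AddCommGroup G] [Module ℝ G] [TopologicalSpace G] {c : ℝ → F × G} :
    SmoothCurve c ↔ SmoothCurve (fun t => (c t).1) ∧ SmoothCurve (fun t => (c t).2) := by
  constructor
  · intro h
    exact ⟨h.clm (ContinuousLinearMap.fst ℝ F G), h.clm (ContinuousLinearMap.snd ℝ F G)⟩
  · rintro ⟨⟨C, hC0, hC⟩, ⟨D, hD0, hD⟩⟩
    refine ⟨fun n t => (C n t, D n t), by simp only [hC0, hD0], fun n t => ?_⟩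
    exact (hC n t).prodMk_nhds (hD n t)

section LinLim

variable {W : ℕ → Type*} [∀ i, NormedAddCommGroup (W i)] [∀ i, NormedSpace ℝ (W i)]
  {l : ∀ i j, i ≤ j → W j →L[ℝ] W i}

variable (l) in
/-- The projection of the projective limit onto its `i`-th term. -/
def linLimProj (i : ℕ) : linLim l →L[ℝ] W i :=
  (ContinuousLinearMap.proj i).comp (linLim l).subtypeL

theorem isClosed_linLim : IsClosed (linLim l : Set (∀ i, W i)) := by
  have : (linLim l : Set (∀ i, W i)) = ⋂ i, ⋂ j, ⋂ h : i ≤ j, {w | l i j h (w j) = w i} := by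
    ext w; simp [linLim]
  rw [this]
  exact isClosed_iInter fun i => isClosed_iInter fun j => isClosed_iInter fun h =>
    isClosed_eq ((l i j h).continuous.comp (continuous_apply j)) (continuous_apply i)

/-- The limit is a closed subspace of a product of Banach spaces; countability of the index set
makes the uniformity countably generated. -/
theorem isFrechetSpace_linLim [∀ i, CompleteSpace (W i)] : IsFrechetSpace (linLim l) where
  uniformAddGroup := inferInstanceAs (IsUniformAddGroup (linLim l).toAddSubgroup)
  continuousSMul := inferInstance
  locallyConvex := inferInstance
  t2 := inferInstance
  countable := by rw [uniformity_subtype]; infer_instance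
  complete := isClosed_linLim.completeSpace_coe

theorem continuous_linLim {X : Type*} [TopologicalSpace X] {p : X → linLim l}
    (hp : ∀ i, Continuous fun x => (p x).1 i) : Continuous p :=
  Continuous.subtype_mk (continuous_pi hp) _

/-- The bonding maps are continuous and linear, hence commute with derivatives of curves. The
componentwise derivatives of a curve of threads are therefore threads again, and difference
quotients converge componentwise. -/
theorem smoothCurve_linLim_iff {c : ℝ → linLim l} :
    SmoothCurve c ↔ ∀ i, ContDiff ℝ ∞ (fun t => (c t).1 i) := by
  constructor
  · exact fun h i => smoothCurve_iff_contDiff.1 (h.clm (linLimProj l i))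
  · intro h
    have hl : ∀ (n : ℕ) (t : ℝ) (i j : ℕ) (hij : i ≤ j),
        l i j hij (iteratedDeriv n (fun t => (c t).1 j) t) =
          iteratedDeriv n (fun t => (c t).1 i) t := by
      intro n
      induction n with
      | zero => intro t i j hij; simpa using (c t).2 i j hij
      | succ n ih =>
        intro t i j hij
        rw [iteratedDeriv_succ, iteratedDeriv_succ]
        have hd := (((h j).differentiable_iteratedDeriv n
          (by exact_mod_cast ENat.natCast_lt_top n)) t).hasDerivAt
        have := ((l i j hij).hasFDerivAt.comp_hasDerivAt t hd).deriv
        rw [← this]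
        congr 1
        ext t'
        exact ih t' i j hij
    refine ⟨fun n t => ⟨fun i => iteratedDeriv n (fun t => (c t).1 i) t, hl n t⟩, ?_, fun n t => ?_⟩
    · ext t i
      simp
    · rw [tendsto_subtype_rng, tendsto_pi_nhds]
      intro i
      have h1 : HasDerivAt (iteratedDeriv n (fun t => (c t).1 i))
          (iteratedDeriv (n + 1) (fun t => (c t).1 i) t) t := by
        rw [iteratedDeriv_succ]
        exact (((h i).differentiable_iteratedDeriv n
          (by exact_mod_cast ENat.natCast_lt_top n)) t).hasDerivAt
      exact hasDerivAt_iff_tendsto_slope_zero.1 h1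

/-- `diff` is a `limUnder`, with a junk value when there is no limit. Its values are computed by
first producing a genuine derivative along the line. -/
theorem diff_eq_of_hasDerivAt {F V : Type*} [AddCommGroup F] [Module ℝ F] [NormedAddCommGroup V]
    [NormedSpace ℝ V] {f : F → V} {x v : F} {d : V}
    (h : HasDerivAt (fun t : ℝ => f (x + t • v)) d 0) : diff f x v = d := by
  refine Tendsto.limUnder_eq ?_
  simpa using hasDerivAt_iff_tendsto_slope_zero.1 h

theorem diff_linLim_eq_of_hasDerivAt {F : Type*} [AddCommGroup F] [Module ℝ F]
    {f : F → linLim l} {x v : F} {d : linLim l}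
    (h : ∀ i, HasDerivAt (fun t : ℝ => (f (x + t • v)).1 i) (d.1 i) 0) : diff f x v = d := by
  refine Tendsto.limUnder_eq ?_
  rw [tendsto_subtype_rng, tendsto_pi_nhds]
  intro i
  simpa using hasDerivAt_iff_tendsto_slope_zero.1 (h i)

/-- The velocity of a smooth curve in the projective limit. -/
def velocity (c : ℝ → linLim l) (hc : ∀ i, ContDiff ℝ ∞ fun t => (c t).1 i) (t : ℝ) : linLim l :=
  ⟨fun i => deriv (fun t => (c t).1 i) t, fun i j hij => by
    have hd := ((hc j).differentiable (by simp) t).hasDerivAt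
    rw [← ((l i j hij).hasFDerivAt.comp_hasDerivAt t hd).deriv]
    congr 1
    ext t'
    exact (c t').2 i j hij⟩

theorem contDiff_line (x v : linLim l) (i : ℕ) :
    ContDiff ℝ ∞ (fun t : ℝ => (x + t • v).1 i) :=
  contDiff_const.add (contDiff_id.smul contDiff_const)

theorem hasDerivAt_line (x v : linLim l) (i : ℕ) (t : ℝ) :
    HasDerivAt (fun t : ℝ => (x + t • v).1 i) (v.1 i) t := by
  have := ((hasDerivAt_id t).smul_const (v.1 i)).const_add (x.1 i)
  rw [one_smul] at this
  exact this

end LinLim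

/-! ### Differential calculus of functions on projective limits -/

section Differential

variable {W : ℕ → Type*} [∀ i, NormedAddCommGroup (W i)] [∀ i, NormedSpace ℝ (W i)]
  {l : ∀ i j, i ≤ j → W j →L[ℝ] W i}
  {H : linLim l → ℝ} {U : Set (linLim l)}

/-- Smooth functions are smooth along curves which run in `U` near a given time. -/
theorem SmoothOn.contDiffAt_comp (hH : SmoothOn H U) (hU : IsOpen U) {c : ℝ → linLim l}
    (hc : ∀ i, ContDiff ℝ ∞ fun t => (c t).1 i) {t₀ : ℝ} (ht : c t₀ ∈ U) :
    ContDiffAt ℝ ∞ (fun t => H (c t)) t₀ := by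
  have hcc : Continuous c := continuous_linLim fun i => (hc i).continuous
  -- `SmoothOn` only accepts curves that stay in `U` for all times. The reparametrization `s` keeps
  -- the curve inside `U` without changing it near `t₀`.
  obtain ⟨s, hs, hsU, hse⟩ := exists_squash t₀ (hcc.continuousAt.preimage_mem_nhds (hU.mem_nhds ht))
  have h1 := smoothCurve_iff_contDiff.1 (hH (fun t => c (s t))
    (smoothCurve_linLim_iff.2 fun i => (hc i).comp hs) hsU)
  refine h1.contDiffAt.congr_of_eventuallyEq ?_
  filter_upwards [hse] with t ht
  rw [ht]

/-- Smooth functions are smooth along smooth surfaces which run in `U` near a given parameter. -/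
theorem SmoothOn.contDiffAt_comp_plane (hH : SmoothOn H U) (hU : IsOpen U) {p : ℝ × ℝ → linLim l}
    (hp : ∀ i, ContDiff ℝ ∞ fun z => (p z).1 i) {z₀ : ℝ × ℝ} (hz : p z₀ ∈ U) :
    ContDiffAt ℝ ∞ (fun z => H (p z)) z₀ := by
  have hpc : Continuous p := continuous_linLim fun i => (hp i).continuous
  obtain ⟨s, hs, hsU, hse⟩ := exists_squash z₀ (hpc.continuousAt.preimage_mem_nhds (hU.mem_nhds hz))
  -- Only smoothness along curves in the parameter plane is available here; Boman's theorem converts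
  -- it into smoothness in two variables.
  have h1 : CurveSmooth (fun z => H (p (s z))) := fun c hc =>
    smoothCurve_iff_contDiff.1 (hH (fun t => p (s (c t)))
      (smoothCurve_linLim_iff.2 fun i => (hp i).comp (hs.comp hc)) fun t => hsU _)
  refine h1.contDiff.contDiffAt.congr_of_eventuallyEq ?_
  filter_upwards [hse] with z hz
  rw [hz]

theorem SmoothOn.hasDerivAt_line (hH : SmoothOn H U) (hU : IsOpen U) {x : linLim l} (hx : x ∈ U)
    (v : linLim l) : HasDerivAt (fun t : ℝ => H (x + t • v)) (diff H x v) 0 := by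
  have h1 := (hH.contDiffAt_comp hU (contDiff_line x v) (t₀ := 0) (by simpa using hx)).differentiableAt
    (by simp)
  rw [diff_eq_of_hasDerivAt h1.hasDerivAt]
  exact h1.hasDerivAt

theorem diff_smul_right (hH : SmoothOn H U) (hU : IsOpen U) {x : linLim l} (hx : x ∈ U)
    (a : ℝ) (v : linLim l) : diff H x (a • v) = a * diff H x v := by
  refine diff_eq_of_hasDerivAt ?_
  have h1 : HasDerivAt (fun t : ℝ => H (x + t • v)) (diff H x v) (0 * a) := by
    rw [zero_mul]; exact hH.hasDerivAt_line hU hx v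
  have h2 := h1.scomp 0 ((hasDerivAt_id (0 : ℝ)).mul_const a)
  simp only [one_mul, smul_eq_mul, Function.comp_def, id_eq] at h2
  simpa only [smul_smul] using h2

/-- On the plane `x + a • v + b • w` the function is smooth by Boman's theorem, so its derivative at
the origin is linear. The two axes and the diagonal give the three terms. -/
theorem diff_add_right (hH : SmoothOn H U) (hU : IsOpen U) {x : linLim l} (hx : x ∈ U)
    (v w : linLim l) : diff H x (v + w) = diff H x v + diff H x w := by
  have hG := (hH.contDiffAt_comp_plane hU (p := fun z : ℝ × ℝ => x + z.1 • v + z.2 • w)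
    (fun i => (contDiff_const.add (contDiff_fst.smul contDiff_const)).add
      (contDiff_snd.smul contDiff_const)) (z₀ := (0, 0)) (by simpa using hx)).differentiableAt
      (by simp)
  have h1 := hG.hasFDerivAt.comp_hasDerivAt_of_eq (0 : ℝ)
    ((hasDerivAt_id (0 : ℝ)).prodMk (hasDerivAt_const (0 : ℝ) (0 : ℝ))) rfl
  have h2 := hG.hasFDerivAt.comp_hasDerivAt_of_eq (0 : ℝ)
    ((hasDerivAt_const (0 : ℝ) (0 : ℝ)).prodMk (hasDerivAt_id (0 : ℝ))) rfl
  have h3 := hG.hasFDerivAt.comp_hasDerivAt_of_eq (0 : ℝ)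
    ((hasDerivAt_id (0 : ℝ)).prodMk (hasDerivAt_id (0 : ℝ))) rfl
  simp only [Function.comp_def, id_eq, zero_smul, add_zero] at h1 h2 h3
  rw [diff_eq_of_hasDerivAt h1, diff_eq_of_hasDerivAt h2, ← map_add]
  refine diff_eq_of_hasDerivAt ?_
  simp only [smul_add, ← add_assoc]
  simpa using h3

/-- The chain rule for a smooth function and a smooth curve. -/
theorem SmoothOn.hasDerivAt_comp [∀ i, CompleteSpace (W i)] (hH : SmoothOn H U) (hU : IsOpen U) {c : ℝ → linLim l}
    (hc : ∀ i, ContDiff ℝ ∞ fun t => (c t).1 i) {t₀ : ℝ} (ht : c t₀ ∈ U) {v : linLim l}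
    (hv : ∀ i, HasDerivAt (fun t => (c t).1 i) (v.1 i) t₀) :
    HasDerivAt (fun t => H (c t)) (diff H (c t₀) v) t₀ := by
  have hsm : ∀ i, ContDiff ℝ ∞ fun t => (c (t₀ + t)).1 i := fun i =>
    (hc i).comp (contDiff_const.add contDiff_id)
  -- Hadamard's lemma gives `c (t₀ + t) = c t₀ + t • Q t` with `Q 0 = v`. The components of `Q` form
  -- a thread by cancelling `t` when `t ≠ 0`, and because `v` is a thread when `t = 0`.
  choose q hq hq0 hqc using fun i => (hsm i).exists_hadamard
  have hq0' : ∀ i, q i 0 = v.1 i := fun i => by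
    rw [hq0, deriv_comp_const_add (fun t => (c t).1 i), add_zero, (hv i).deriv]
  have hql : ∀ t i j (hij : i ≤ j), l i j hij (q j t) = q i t := fun t i j hij => by
    rcases eq_or_ne t 0 with rfl | ht0
    · rw [hq0', hq0']; exact v.2 i j hij
    · have h1 : t • l i j hij (q j t) = t • q i t := by
        have hj := congrArg (l i j hij) (hqc j t)
        rw [map_add, (c _).2 i j hij, (c _).2 i j hij, map_smul, hqc i t] at hj
        exact (add_left_cancel hj).symm
      exact smul_right_injective _ ht0 h1
  let Q : ℝ → linLim l := fun t => ⟨fun i => q i t, hql t⟩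
  have hQ0 : Q 0 = v := Subtype.ext (funext hq0')
  have hQc : ∀ t, c (t₀ + t) = c t₀ + t • Q t := fun t => Subtype.ext (funext fun i => by
    have := hqc i t
    rw [add_zero] at this
    exact this)
  -- The diagonal of this surface is the curve `c`. The first axis is constant and the second is the
  -- line in direction `v`, so the derivative along the diagonal is `diff H (c t₀) v`.
  have hG := (hH.contDiffAt_comp_plane hU (p := fun z : ℝ × ℝ => c t₀ + z.2 • Q z.1)
    (fun i => contDiff_const.add (contDiff_snd.smul ((hq i).comp contDiff_fst)))
    (z₀ := (0, 0)) (by simpa using ht)).differentiableAt (by simp)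
  have h1 := hG.hasFDerivAt.comp_hasDerivAt_of_eq (0 : ℝ)
    ((hasDerivAt_id (0 : ℝ)).prodMk (hasDerivAt_const (0 : ℝ) (0 : ℝ))) rfl
  have h2 := hG.hasFDerivAt.comp_hasDerivAt_of_eq (0 : ℝ)
    ((hasDerivAt_const (0 : ℝ) (0 : ℝ)).prodMk (hasDerivAt_id (0 : ℝ))) rfl
  have h3 := hG.hasFDerivAt.comp_hasDerivAt_of_eq (0 : ℝ)
    ((hasDerivAt_id (0 : ℝ)).prodMk (hasDerivAt_id (0 : ℝ))) rfl
  simp only [Function.comp_def, id_eq, zero_smul, add_zero, hQ0, ← hQc] at h1 h2 h3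
  have h4 : HasDerivAt (fun t => H (c (t₀ + t))) (diff H (c t₀) v) 0 := by
    rw [show ((1 : ℝ), (1 : ℝ)) = (1, 0) + (0, 1) by simp, map_add,
      h1.unique (hasDerivAt_const _ _), zero_add] at h3
    rw [diff_eq_of_hasDerivAt h2]
    exact h3
  have h5 := (show HasDerivAt (fun t => H (c (t₀ + t))) (diff H (c t₀) v) (t₀ - t₀) by
    rwa [sub_self]).comp_sub_const t₀ t₀
  simpa using h5

/-- This writes `dH(c)(X)` as a partial derivative of a function which is smooth on the plane, so
that it depends smoothly on the time. -/
theorem SmoothOn.fderiv_plane_apply (hH : SmoothOn H U) (hU : IsOpen U) {c X : ℝ → linLim l}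
    (hc : ∀ i, ContDiff ℝ ∞ fun t => (c t).1 i) (hX : ∀ i, ContDiff ℝ ∞ fun t => (X t).1 i)
    {t : ℝ} (ht : c t ∈ U) :
    fderiv ℝ (fun z : ℝ × ℝ => H (c z.1 + z.2 • X z.1)) (t, 0) (0, 1) = diff H (c t) (X t) := by
  have hG := (hH.contDiffAt_comp_plane hU (p := fun z : ℝ × ℝ => c z.1 + z.2 • X z.1)
    (fun i => ((hc i).comp contDiff_fst).add (contDiff_snd.smul ((hX i).comp contDiff_fst)))
    (z₀ := (t, 0)) (by simpa using ht)).differentiableAt (by simp)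
  have h2 := hG.hasFDerivAt.comp_hasDerivAt_of_eq (0 : ℝ)
    ((hasDerivAt_const (0 : ℝ) t).prodMk (hasDerivAt_id (0 : ℝ))) rfl
  exact (diff_eq_of_hasDerivAt h2).symm

/-- The derivative of a smooth function along a vector field is smooth along curves. -/
theorem SmoothOn.contDiffAt_diff (hH : SmoothOn H U) (hU : IsOpen U) {c X : ℝ → linLim l}
    (hc : ∀ i, ContDiff ℝ ∞ fun t => (c t).1 i) (hX : ∀ i, ContDiff ℝ ∞ fun t => (X t).1 i)
    {t₀ : ℝ} (ht : c t₀ ∈ U) : ContDiffAt ℝ ∞ (fun t => diff H (c t) (X t)) t₀ := by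
  have hcc : Continuous c := continuous_linLim fun i => (hc i).continuous
  have hG := hH.contDiffAt_comp_plane hU (p := fun z : ℝ × ℝ => c z.1 + z.2 • X z.1)
    (fun i => ((hc i).comp contDiff_fst).add (contDiff_snd.smul ((hX i).comp contDiff_fst)))
    (z₀ := (t₀, 0)) (by simpa using ht)
  have h1 : ContDiffAt ℝ ∞ (fun t : ℝ =>
      fderiv ℝ (fun z : ℝ × ℝ => H (c z.1 + z.2 • X z.1)) (t, 0) (0, 1)) t₀ := by
    have h2 := hG.fderiv_right (m := ∞) (by simp)
    have h3 : ContDiffAt ℝ ∞ (fun t : ℝ => (t, (0 : ℝ))) t₀ :=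
      (contDiff_id.prodMk contDiff_const).contDiffAt
    exact (h2.comp t₀ h3).clm_apply contDiffAt_const
  refine h1.congr_of_eventuallyEq ?_
  filter_upwards [hcc.continuousAt.preimage_mem_nhds (hU.mem_nhds ht)] with t ht
  exact (hH.fderiv_plane_apply hU hc hX ht).symm

theorem SmoothOn.smoothOn_diff (hH : SmoothOn H U) (hU : IsOpen U) {X : linLim l → linLim l}
    (hX : SmoothOn X U) : SmoothOn (fun y => diff H y (X y)) U := fun c hc hcU =>
  smoothCurve_iff_contDiff.2 (contDiff_iff_contDiffAt.2 fun _ =>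
    hH.contDiffAt_diff hU (smoothCurve_linLim_iff.1 hc) (smoothCurve_linLim_iff.1 (hX c hc hcU))
      (hcU _))

theorem smoothOn_const {F G : Type*} [AddCommGroup F] [Module ℝ F] [TopologicalSpace F]
    [AddCommGroup G] [Module ℝ G] [TopologicalSpace G] (v : G) (U : Set F) :
    SmoothOn (fun _ => v) U := fun _ _ _ =>
  ⟨fun n _ => if n = 0 then v else 0, by simp, fun n t => by
    simpa using tendsto_const_nhds⟩

/-- For maps into the limit this shows that the limit defining `diff` exists: the componentwise
derivatives along the squashed line are the components of its velocity, which is a thread. -/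
theorem hasDerivAt_diff_linLim {Y : linLim l → linLim l} (hY : SmoothOn Y U) (hU : IsOpen U)
    {x : linLim l} (hx : x ∈ U) (v : linLim l) (i : ℕ) :
    HasDerivAt (fun t : ℝ => (Y (x + t • v)).1 i) ((diff Y x v).1 i) 0 := by
  have hcc : Continuous fun t : ℝ => x + t • v :=
    continuous_linLim fun i => (contDiff_line x v i).continuous
  obtain ⟨s, hs, hsU, hse⟩ := exists_squash (0 : ℝ)
    (hcc.continuousAt.preimage_mem_nhds (hU.mem_nhds (by simpa using hx)))
  have hsm := smoothCurve_linLim_iff.1 (hY (fun t => x + s t • v)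
    (smoothCurve_linLim_iff.2 fun i => (contDiff_line x v i).comp hs) hsU)
  have hd : ∀ i, HasDerivAt (fun t : ℝ => (Y (x + t • v)).1 i)
      ((velocity _ hsm 0).1 i) 0 := fun i => by
    refine (((hsm i).differentiable (by simp) 0).hasDerivAt).congr_of_eventuallyEq ?_
    filter_upwards [hse] with t ht
    rw [ht]
  rw [diff_linLim_eq_of_hasDerivAt hd]
  exact hd i

variable [∀ i, CompleteSpace (W i)]

/-- The derivative of `y ↦ dH(y)(Y(y))`. -/
theorem diff_diff (hH : SmoothOn H U) (hU : IsOpen U) {Y : linLim l → linLim l}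
    (hY : SmoothOn Y U) {x : linLim l} (hx : x ∈ U) (v : linLim l) :
    diff (fun y => diff H y (Y y)) x v =
      diff (fun y => diff H y v) x (Y x) + diff H x (diff Y x v) := by
  have hcc : Continuous fun t : ℝ => x + t • v :=
    continuous_linLim fun i => (contDiff_line x v i).continuous
  obtain ⟨s, hs, hsU, hse⟩ := exists_squash (0 : ℝ)
    (hcc.continuousAt.preimage_mem_nhds (hU.mem_nhds (by simpa using hx)))
  have hs0 : s 0 = 0 := hse.self_of_nhds
  let c : ℝ → linLim l := fun t => x + s t • v
  have hc : ∀ i, ContDiff ℝ ∞ fun t => (c t).1 i := fun i => (contDiff_line x v i).comp hs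
  have hc0 : c 0 = x := by simp [c, hs0]
  have hYc := smoothCurve_linLim_iff.1 (hY c (smoothCurve_linLim_iff.2 hc) hsU)
  -- The claim is the equality of the two mixed second derivatives of `G` at the origin, where `c`
  -- is the line `x + t • v`, squashed so as to remain in `U`.
  let G : ℝ × ℝ → ℝ := fun z => H (c z.1 + z.2 • Y (c z.1))
  have hG : ContDiffAt ℝ ∞ G (0, 0) :=
    hH.contDiffAt_comp_plane hU (p := fun z : ℝ × ℝ => c z.1 + z.2 • Y (c z.1))
      (fun i => ((hc i).comp contDiff_fst).add (contDiff_snd.smul ((hYc i).comp contDiff_fst)))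
      (z₀ := (0, 0)) (by simpa [hc0] using hx)
  have hsymm : IsSymmSndFDerivAt ℝ G (0, 0) := hG.isSymmSndFDerivAt (by
    rw [minSmoothness_of_isRCLikeNormedField]; exact ENat.LEInfty.out)
  have hG' : HasFDerivAt (fderiv ℝ G) (fderiv ℝ (fderiv ℝ G) (0, 0)) (0, 0) :=
    ((hG.fderiv_right (m := ∞) (by simp)).differentiableAt (by simp)).hasFDerivAt
  -- the derivative of `fderiv G · (0, 1)` in the first variable
  have h1 : diff (fun y => diff H y (Y y)) x v = fderiv ℝ (fderiv ℝ G) (0, 0) (1, 0) (0, 1) := by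
    refine diff_eq_of_hasDerivAt ?_
    have e1 := hG'.comp_hasDerivAt_of_eq (0 : ℝ)
      ((hasDerivAt_id (0 : ℝ)).prodMk (hasDerivAt_const (0 : ℝ) (0 : ℝ))) rfl
    have e2 := e1.clm_apply (hasDerivAt_const (0 : ℝ) ((0 : ℝ), (1 : ℝ)))
    simp only [map_zero, add_zero, Function.comp_def, id_eq] at e2
    refine e2.congr_of_eventuallyEq ?_
    filter_upwards [hse] with t ht
    have := hH.fderiv_plane_apply hU hc hYc (hsU t)
    rw [this]
    simp only [c, ht]
  -- the derivative of `fderiv G · (1, 0)` in the second variable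
  have h2 : HasDerivAt (fun r : ℝ => fderiv ℝ G (0, r) (1, 0))
      (fderiv ℝ (fderiv ℝ G) (0, 0) (0, 1) (1, 0)) 0 := by
    have e1 := hG'.comp_hasDerivAt_of_eq (0 : ℝ)
      ((hasDerivAt_const (0 : ℝ) (0 : ℝ)).prodMk (hasDerivAt_id (0 : ℝ))) rfl
    have e2 := e1.clm_apply (hasDerivAt_const (0 : ℝ) ((1 : ℝ), (0 : ℝ)))
    simpa only [map_zero, add_zero, Function.comp_def, id_eq] using e2
  have hline : Continuous fun r : ℝ => x + r • Y x :=
    continuous_linLim fun i => (contDiff_line x (Y x) i).continuous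
  -- For fixed `r` the curve `t ↦ c t + r • Y (c t)` has velocity `v + r • diff Y x v` at `0`; the
  -- chain rule and linearity of the differential apply.
  have h3 : ∀ᶠ r : ℝ in 𝓝 0, fderiv ℝ G (0, r) (1, 0) =
      diff H (x + r • Y x) v + r * diff H (x + r • Y x) (diff Y x v) := by
    filter_upwards [hline.continuousAt.preimage_mem_nhds (hU.mem_nhds (by simpa using hx))]
      with r hr
    have hGr := (hH.contDiffAt_comp_plane hU (p := fun z : ℝ × ℝ => c z.1 + z.2 • Y (c z.1))
      (fun i => ((hc i).comp contDiff_fst).add (contDiff_snd.smul ((hYc i).comp contDiff_fst)))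
      (z₀ := (0, r)) (by simpa [hc0] using hr)).differentiableAt (by simp)
    have e1 := hGr.hasFDerivAt.comp_hasDerivAt_of_eq (0 : ℝ)
      ((hasDerivAt_id (0 : ℝ)).prodMk (hasDerivAt_const (0 : ℝ) r)) rfl
    have hder : ∀ i, HasDerivAt (fun t => (c t + r • Y (c t)).1 i)
        ((v + r • diff Y x v).1 i) 0 := fun i => by
      have a1 : HasDerivAt (fun t => (c t).1 i) (v.1 i) 0 := by
        refine (hasDerivAt_line x v i 0).congr_of_eventuallyEq ?_
        filter_upwards [hse] with t ht
        simp only [c, ht]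
      have a2 : HasDerivAt (fun t => (Y (c t)).1 i) ((diff Y x v).1 i) 0 := by
        refine (hasDerivAt_diff_linLim hY hU hx v i).congr_of_eventuallyEq ?_
        filter_upwards [hse] with t ht
        simp only [c, ht]
      exact a1.add (a2.const_smul r)
    have e2 := hH.hasDerivAt_comp hU (c := fun t => c t + r • Y (c t))
      (fun i => (hc i).add ((hYc i).const_smul r)) (t₀ := 0) (by simpa [hc0] using hr) hder
    have e3 := e1.unique e2
    simp only [hc0] at e3
    rw [diff_add_right hH hU hr, diff_smul_right hH hU hr] at e3
    exact e3
  have h4 : HasDerivAt (fun r : ℝ => diff H (x + r • Y x) v + r * diff H (x + r • Y x) (diff Y x v))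
      (diff (fun y => diff H y v) x (Y x) + diff H x (diff Y x v)) 0 := by
    have e1 := (hH.smoothOn_diff hU (smoothOn_const v U)).hasDerivAt_line hU hx (Y x)
    have e2 := (hH.smoothOn_diff hU (smoothOn_const (diff Y x v) U)).hasDerivAt_line hU hx (Y x)
    have e3 := (hasDerivAt_id (0 : ℝ)).mul e2
    simp only [id_eq, one_mul, zero_mul, add_zero, zero_smul] at e3
    exact e1.add e3
  rw [h1, hsymm.eq, h2.unique (h4.congr_of_eventuallyEq h3)]

/-- The case of a constant field in `diff_diff`: its differential vanishes and only the symmetry of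
second derivatives is left. -/
theorem diff_diff_comm (hH : SmoothOn H U) (hU : IsOpen U) {x : linLim l} (hx : x ∈ U)
    (v w : linLim l) :
    diff (fun y => diff H y v) x w = diff (fun y => diff H y w) x v := by
  have h := diff_diff hH hU (smoothOn_const v U) hx w
  have h0 : diff (fun _ : linLim l => v) x w = 0 :=
    diff_linLim_eq_of_hasDerivAt fun i => hasDerivAt_const _ _
  have h1 : diff H x 0 = 0 := by
    have := diff_smul_right hH hU hx 0 0
    simpa using this
  rw [h, h0, h1, add_zero]

/-- The commutator of the derivatives along two vector fields. -/
theorem diff_diff_sub (hH : SmoothOn H U) (hU : IsOpen U) {X Y : linLim l → linLim l}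
    (hX : SmoothOn X U) (hY : SmoothOn Y U) {x : linLim l} (hx : x ∈ U) :
    diff (fun y => diff H y (Y y)) x (X x) - diff (fun y => diff H y (X y)) x (Y x) =
      diff H x (diff Y x (X x) - diff X x (Y x)) := by
  rw [diff_diff hH hU hY hx, diff_diff hH hU hX hx, diff_diff_comm hH hU hx (X x) (Y x),
    sub_eq_add_neg (diff Y x (X x)), diff_add_right hH hU hx,
    ← neg_one_smul ℝ (diff X x (Y x)), diff_smul_right hH hU hx]
  ring

end Differential

end Convenient

/-! ### Bump functions, sections and forms on Banach vector bundles -/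

section BanachBundle

variable {B : Type*} [NormedAddCommGroup B] [NormedSpace ℝ B]
  {M : Type*} [TopologicalSpace M] [ChartedSpace B M]

/-- Composing the function given by regularity with a real bump around `1` makes it equal to `1`
near `x`. It also confines it to the closed set where the original function is within `1/2` of `1`.
This set lies in `U`, so local objects extend by zero. -/
theorem SmoothlyRegular.exists_bump (hreg : SmoothlyRegular B M) {x : M} {U : Set M}
    (hU : U ∈ 𝓝 x) : ∃ g : M → ℝ, ContMDiff 𝓘(ℝ, B) 𝓘(ℝ, ℝ) ∞ g ∧ (∀ᶠ y in 𝓝 x, g y = 1) ∧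
      ∃ C ⊆ U, IsClosed C ∧ ∀ y ∉ C, g y = 0 := by
  obtain ⟨g, hg, hgx, hgU⟩ := hreg x U hU
  let χ : ContDiffBump (1 : ℝ) := ⟨1 / 4, 1 / 2, by norm_num, by norm_num⟩
  refine ⟨fun y => χ (g y), χ.contDiff.contMDiff.comp hg, ?_,
    {y | dist (g y) 1 ≤ 1 / 2}, fun y hy => ?_,
    isClosed_le (hg.continuous.dist continuous_const) continuous_const, fun y hy => ?_⟩
  · have h1 : ∀ᶠ r in 𝓝 (g x), χ r = 1 := by rw [hgx]; exact χ.eventuallyEq_one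
    exact hg.continuous.continuousAt.eventually h1
  · by_contra hyU
    rw [mem_ofPred_eq, hgU y hyU] at hy
    norm_num at hy
  · exact χ.zero_of_le_dist (not_le.1 hy).le

theorem contMDiff_smul_of_bump {G : Type*} [NormedAddCommGroup G] [NormedSpace ℝ G]
    {g : M → ℝ} (hg : ContMDiff 𝓘(ℝ, B) 𝓘(ℝ, ℝ) ∞ g) {U C : Set M} (hU : IsOpen U) (hC : IsClosed C)
    (hCU : C ⊆ U) (hgC : ∀ y ∉ C, g y = 0) {k : M → G}
    (hk : ContMDiffOn 𝓘(ℝ, B) 𝓘(ℝ, G) ∞ k U) :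
    ContMDiff 𝓘(ℝ, B) 𝓘(ℝ, G) ∞ (fun y => g y • k y) := by
  intro y
  by_cases hy : y ∈ U
  · exact hg.contMDiffAt.smul (hk.contMDiffAt (hU.mem_nhds hy))
  · refine (contMDiffAt_const (c := (0 : G))).congr_of_eventuallyEq ?_
    filter_upwards [hC.isOpen_compl.mem_nhds (fun h => hy (hCU h))] with z hz
    rw [hgC z hz, zero_smul]

variable {V : Type*} [NormedAddCommGroup V] [NormedSpace ℝ V]
  {E : M → Type*} [∀ x, AddCommGroup (E x)] [∀ x, Module ℝ (E x)]
  [∀ x, TopologicalSpace (E x)] [TopologicalSpace (TotalSpace V E)] [FiberBundle V E]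
  [VectorBundle ℝ V E]

theorem trivializationAt_symmL_apply {x y : M} (hy : y ∈ (trivializationAt V E x).baseSet)
    (v : E y) :
    (trivializationAt V E x).symmL ℝ y (trivializationAt V E x ⟨y, v⟩).2 = v := by
  rw [Trivialization.symmL_apply (R := ℝ) _ hy]
  exact (trivializationAt V E x).symm_apply_apply_mk hy v

/-- The `1`-form `g · (l ∘ τ)`, where `τ` is the preferred trivialization at `x₀`. -/
def dualForm (x₀ : M) (g : M → ℝ) (l : V →L[ℝ] ℝ) (x : M) : E x [⋀^Fin 1]→L[ℝ] ℝ :=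
  ContinuousAlternatingMap.ofSubsingleton ℝ (E x) ℝ (0 : Fin 1)
    (g x • l.comp ((trivializationAt V E x₀).continuousLinearMapAt ℝ x))

/-- Off the base set the linear map of the trivialization is zero, while the trivialization itself
is arbitrary there; the vanishing of `g` makes both sides zero. -/
theorem dualForm_apply {x₀ : M} {g : M → ℝ} (l : V →L[ℝ] ℝ) {x : M}
    (hx : x ∉ (trivializationAt V E x₀).baseSet → g x = 0) (v : Fin 1 → E x) :
    dualForm (V := V) x₀ g l x v = g x * l (trivializationAt V E x₀ ⟨x, v 0⟩).2 := by
  by_cases hxT : x ∈ (trivializationAt V E x₀).baseSet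
  · simp only [dualForm, ContinuousAlternatingMap.ofSubsingleton_apply_apply,
      _root_.smul_apply, ContinuousLinearMap.comp_apply, smul_eq_mul]
    rw [Trivialization.continuousLinearMapAt_apply,
      (trivializationAt V E x₀).coe_linearMapAt_of_mem hxT]
  · simp [dualForm, hx hxT]

section Evaluation

variable {P : Type*} [NormedAddCommGroup P] [NormedSpace ℝ P] {H : Type*} [TopologicalSpace H]
  {I : ModelWithCorners ℝ P H} {N : Type*} [TopologicalSpace N] [ChartedSpace H N]

/-- Induction on the number of arguments: currying splits off the first one, and evaluation of
linear maps is smooth. -/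
theorem ContMDiffAt.continuousMultilinearMap_apply {q : ℕ} {n₀ : N}
    {Θ : N → ContinuousMultilinearMap ℝ (fun _ : Fin q => V) ℝ}
    (hΘ : ContMDiffAt I 𝓘(ℝ, ContinuousMultilinearMap ℝ (fun _ : Fin q => V) ℝ) ∞ Θ n₀)
    {v : Fin q → N → V} (hv : ∀ k, ContMDiffAt I 𝓘(ℝ, V) ∞ (v k) n₀) :
    ContMDiffAt I 𝓘(ℝ, ℝ) ∞ (fun n => Θ n (fun k => v k n)) n₀ := by
  induction q with
  | zero =>
    have h := (continuousMultilinearCurryFin0 ℝ V ℝ).toContinuousLinearEquiv.contDiff.contMDiff.contMDiffAt.comp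
      n₀ hΘ
    refine h.congr_of_eventuallyEq (Eventually.of_forall fun n => ?_)
    simp only [Function.comp_apply, LinearIsometryEquiv.coe_toContinuousLinearEquiv,
      continuousMultilinearCurryFin0_apply]
    congr 1
    exact Subsingleton.elim _ _
  | succ q ih =>
    have hK : ContDiff ℝ ∞ (continuousMultilinearCurryLeftEquiv ℝ (fun _ : Fin (q + 1) => V) ℝ) :=
      LinearIsometryEquiv.contDiff (E := ContinuousMultilinearMap ℝ (fun _ : Fin (q + 1) => V) ℝ)
        (F := V →L[ℝ] ContinuousMultilinearMap ℝ (fun _ : Fin q => V) ℝ) _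
    have h := hK.contMDiff.contMDiffAt.comp n₀ hΘ
    have h2 := ih (h.clm_apply (hv 0)) (v := fun k => v k.succ) (fun k => hv _)
    refine h2.congr_of_eventuallyEq (Eventually.of_forall fun n => ?_)
    change _ = Θ n (Fin.cons (v 0 n) fun k : Fin q => v k.succ n)
    refine congrArg (Θ n) (funext fun k => ?_)
    refine Fin.cases ?_ (fun k => ?_) k <;> simp

/-- The value of a smooth form on smooth families of vectors is smooth. -/
theorem IsSmoothForm.contMDiffAt_apply {q : ℕ} {θ : ∀ x, E x [⋀^Fin q]→L[ℝ] ℝ}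
    (hθ : IsSmoothForm B V θ) {m : N → M} {n₀ : N} (hm : ContMDiffAt I 𝓘(ℝ, B) ∞ m n₀)
    {e : ∀ (_ : Fin q) (n : N), E (m n)}
    (he : ∀ k, ContMDiffAt I (𝓘(ℝ, B).prod 𝓘(ℝ, V)) ∞ (fun n => TotalSpace.mk' V (m n) (e k n)) n₀) :
    ContMDiffAt I 𝓘(ℝ, ℝ) ∞ (fun n => θ (m n) (fun k => e k n)) n₀ := by
  let T := trivializationAt V E (m n₀)
  have hT : m n₀ ∈ T.baseSet := mem_baseSet_trivializationAt V E _
  have h1 := ((hθ (m n₀)).contMDiffAt (T.open_baseSet.mem_nhds hT)).comp n₀ hm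
  have h2 : ∀ k, ContMDiffAt I 𝓘(ℝ, V) ∞ (fun n => (T ⟨m n, e k n⟩).2) n₀ := fun k =>
    (contMDiffAt_totalSpace.1 (he k)).2
  have h3 := (ContinuousAlternatingMap.toContinuousMultilinearMapCLM ℝ
    (E := V) (F := ℝ) (ι := Fin q) (𝕜 := ℝ)).contDiff.contMDiff.contMDiffAt.comp n₀ h1
  have h4 := h3.continuousMultilinearMap_apply h2
  refine h4.congr_of_eventuallyEq ?_
  filter_upwards [hm.continuousAt.preimage_mem_nhds (T.open_baseSet.mem_nhds hT)] with n hn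
  change _ = θ (m n) (fun k => T.symmL ℝ (m n) (T ⟨m n, e k n⟩).2)
  congr 1
  ext k
  exact (trivializationAt_symmL_apply hn (e k n)).symm

end Evaluation

variable [ContMDiffVectorBundle ∞ V E 𝓘(ℝ, B)]

/-- A section constant in a trivialization, cut off by a bump function. -/
theorem SmoothlyRegular.exists_section (hreg : SmoothlyRegular B M) (x : M) (v : E x) :
    ∃ s : Cₛ^∞⟮𝓘(ℝ, B); V, E⟯, s x = v := by
  let T := trivializationAt V E x
  have hxT : x ∈ T.baseSet := mem_baseSet_trivializationAt V E x
  obtain ⟨g, hg, hgx, C, hCU, hC, hgC⟩ := hreg.exists_bump (T.open_baseSet.mem_nhds hxT)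
  let w : V := (T ⟨x, v⟩).2
  refine ⟨⟨fun y => g y • T.symm y w, fun y => ?_⟩, ?_⟩
  · by_cases hy : y ∈ T.baseSet
    · have h1 : ContMDiffAt 𝓘(ℝ, B) (𝓘(ℝ, B).prod 𝓘(ℝ, V)) ∞
          (fun y => TotalSpace.mk' V y (T.symm y w)) y := by
        rw [T.contMDiffAt_section_iff hy]
        refine (contMDiffAt_const (c := w)).congr_of_eventuallyEq ?_
        filter_upwards [T.open_baseSet.mem_nhds hy] with z hz
        rw [T.apply_mk_symm hz]
      exact hg.contMDiffAt.smul_section h1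
    · refine ((contMDiff_zeroSection ℝ E (F := V)) y).congr_of_eventuallyEq ?_
      filter_upwards [hC.isOpen_compl.mem_nhds (fun h => hy (hCU h))] with z hz
      simp only [hgC z hz, zero_smul]
      rfl
  · change g x • T.symm x w = v
    rw [hgx.self_of_nhds, one_smul]
    exact T.symm_apply_apply_mk hxT v

/-- In another trivialization the form is `g` times `l` composed with the coordinate change, which
is smooth as a map into operators; off the closed set `C` it is zero. -/
theorem isSmoothForm_dualForm {x₀ : M} {g : M → ℝ} (hg : ContMDiff 𝓘(ℝ, B) 𝓘(ℝ, ℝ) ∞ g)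
    {C : Set M} (hC : IsClosed C) (hCU : C ⊆ (trivializationAt V E x₀).baseSet)
    (hgC : ∀ y ∉ C, g y = 0) (l : V →L[ℝ] ℝ) :
    IsSmoothForm B V (dualForm (V := V) (E := E) x₀ g l) := by
  intro x₁ y hy
  refine ContMDiffAt.contMDiffWithinAt ?_
  let L : (V →L[ℝ] ℝ) →L[ℝ] V [⋀^Fin 1]→L[ℝ] ℝ :=
    ((ContinuousAlternatingMap.ofSubsingletonLIE (0 : Fin 1) :
      (V →L[ℝ] ℝ) ≃ₗᵢ[ℝ] V [⋀^Fin 1]→L[ℝ] ℝ).toContinuousLinearEquiv : _ →L[ℝ] _)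
  by_cases hy0 : y ∈ (trivializationAt V E x₀).baseSet
  · have h1 := contMDiffAt_coordChangeL (n := ∞) (IB := 𝓘(ℝ, B)) (F := V) (E := E)
      (e := trivializationAt V E x₁) (e' := trivializationAt V E x₀) hy hy0
    have h2 : ContMDiffAt 𝓘(ℝ, B) 𝓘(ℝ, V [⋀^Fin 1]→L[ℝ] ℝ) ∞ (fun z => g z • L (l.comp
        (((trivializationAt V E x₁).coordChangeL ℝ (trivializationAt V E x₀) z : V ≃L[ℝ] V) :
          V →L[ℝ] V))) y := by
      refine hg.contMDiffAt.smul ?_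
      have h3 : ContMDiffAt 𝓘(ℝ, B) 𝓘(ℝ, V →L[ℝ] ℝ) ∞ (fun z => l.comp
        (((trivializationAt V E x₁).coordChangeL ℝ (trivializationAt V E x₀) z : V ≃L[ℝ] V) :
          V →L[ℝ] V)) y := contMDiffAt_const.clm_comp h1
      exact L.contDiff.contMDiff.contMDiffAt.comp y h3
    refine h2.congr_of_eventuallyEq ?_
    filter_upwards [(trivializationAt V E x₁).open_baseSet.mem_nhds hy,
      (trivializationAt V E x₀).open_baseSet.mem_nhds hy0] with z hz1 hz0
    ext v
    rw [ContinuousAlternatingMap.compContinuousLinearMap_apply,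
      dualForm_apply l (fun h => absurd hz0 h)]
    simp only [ContinuousAlternatingMap.smul_apply, smul_eq_mul]
    congr 1
    change _ = l (((trivializationAt V E x₁).coordChangeL ℝ (trivializationAt V E x₀) z : V ≃L[ℝ] V)
      (v 0))
    rw [Trivialization.coordChangeL_apply _ _ ⟨hz1, hz0⟩, Function.comp_apply,
      Trivialization.symmL_apply (R := ℝ) _ hz1]
  · refine (contMDiffAt_const (c := (0 : V [⋀^Fin 1]→L[ℝ] ℝ))).congr_of_eventuallyEq ?_
    filter_upwards [hC.isOpen_compl.mem_nhds (fun h => hy0 (hCU h))] with z hz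
    ext v
    rw [ContinuousAlternatingMap.compContinuousLinearMap_apply,
      dualForm_apply l (fun _ => hgC z hz), hgC z hz, zero_mul]
    rfl

end BanachBundle

/-! ### Differential identities on Banach Lie algebroids -/

section DirDeriv

variable {B : Type*} [NormedAddCommGroup B] [NormedSpace ℝ B]
  {M : Type*} [TopologicalSpace M] [ChartedSpace B M]

theorem dirDeriv_zero_left {x : M} (g : M → ℝ) :
    dirDeriv B (0 : TangentSpace 𝓘(ℝ, B) x) g = 0 :=
  map_zero (mfderiv 𝓘(ℝ, B) 𝓘(ℝ, ℝ) g x)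

theorem dirDeriv_sub {x : M} (v : TangentSpace 𝓘(ℝ, B) x) {g h : M → ℝ}
    (hg : ContMDiff 𝓘(ℝ, B) 𝓘(ℝ, ℝ) ∞ g) (hh : ContMDiff 𝓘(ℝ, B) 𝓘(ℝ, ℝ) ∞ h) :
    dirDeriv B v (fun y => g y - h y) = dirDeriv B v g - dirDeriv B v h := by
  have h1 := (hg.mdifferentiable (by simp)) x
  have h2 := (hh.mdifferentiable (by simp)) x
  exact DFunLike.congr_fun (mvfderiv_sub h1 h2) v

end DirDeriv

section Algebroid

variable {B : Type*} [NormedAddCommGroup B] [NormedSpace ℝ B]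
  {M : Type*} [TopologicalSpace M] [ChartedSpace B M]
  {V : Type*} [NormedAddCommGroup V] [NormedSpace ℝ V]
  {E : M → Type*} [∀ x, AddCommGroup (E x)] [∀ x, Module ℝ (E x)]
  [∀ x, TopologicalSpace (E x)] [TopologicalSpace (TotalSpace V E)] [FiberBundle V E]

variable (B V) in
/-- The `1`-form `θ` is smooth as a function on the total space. -/
def IsTotalSmooth (θ : ∀ x, E x [⋀^Fin 1]→L[ℝ] ℝ) : Prop :=
  ContMDiff (𝓘(ℝ, B).prod 𝓘(ℝ, V)) 𝓘(ℝ, ℝ) ∞ (fun p : TotalSpace V E => θ p.1 (fun _ => p.2))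

theorem IsTotalSmooth.contMDiff_section {θ : ∀ x, E x [⋀^Fin 1]→L[ℝ] ℝ}
    (hθ : IsTotalSmooth B V θ) (s : Cₛ^∞⟮𝓘(ℝ, B); V, E⟯) :
    ContMDiff 𝓘(ℝ, B) 𝓘(ℝ, ℝ) ∞ (fun y => θ y (fun _ => s y)) :=
  hθ.comp s.contMDiff

variable [VectorBundle ℝ V E]

theorem IsSmoothForm.isTotalSmooth {θ : ∀ x, E x [⋀^Fin 1]→L[ℝ] ℝ} (hθ : IsSmoothForm B V θ) :
    IsTotalSmooth B V θ := fun p =>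
  hθ.contMDiffAt_apply (m := fun p : TotalSpace V E => p.1) (e := fun _ p => p.2)
    (contMDiff_proj E p) (fun _ => contMDiffAt_id)

/-- The product of a smooth function and a smooth section. -/
def smulSection {g : M → ℝ} (hg : ContMDiff 𝓘(ℝ, B) 𝓘(ℝ, ℝ) ∞ g) (s : Cₛ^∞⟮𝓘(ℝ, B); V, E⟯) :
    Cₛ^∞⟮𝓘(ℝ, B); V, E⟯ :=
  ⟨fun y => g y • s y, hg.smul_section s.contMDiff⟩

/-- A smooth function, as a `0`-form. -/
def functionForm (k : M → ℝ) (x : M) : E x [⋀^Fin 0]→L[ℝ] ℝ :=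
  ContinuousAlternatingMap.constOfIsEmpty ℝ (E x) (Fin 0) (k x)

theorem isSmoothForm_functionForm {k : M → ℝ} (hk : ContMDiff 𝓘(ℝ, B) 𝓘(ℝ, ℝ) ∞ k) :
    IsSmoothForm B V (functionForm (E := E) k) := fun x₀ => by
  have h1 := (ContinuousAlternatingMap.constOfIsEmptyLIE ℝ V ℝ
    (Fin 0)).toContinuousLinearEquiv.contDiff.contMDiff.comp hk
  exact h1.contMDiffOn

theorem alternating_two_swap {W : Type*} [AddCommGroup W] [Module ℝ W] [TopologicalSpace W]
    (η : W [⋀^Fin 2]→L[ℝ] ℝ) (v w : W) : η ![v, w] = -η ![w, v] := by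
  have h := η.toAlternatingMap.map_swap ![v, w] (i := 0) (j := 1) (by simp)
  have e : ![v, w] ∘ (Equiv.swap (0 : Fin 2) 1) = ![w, v] := by
    ext i; fin_cases i <;> simp
  rw [e] at h
  rw [show η ![w, v] = -η ![v, w] from h, neg_neg]

variable [IsManifold 𝓘(ℝ, B) ∞ M]

namespace BanachLieAlgebroid

variable (A : BanachLieAlgebroid B V E)

/-- Every smooth form has an exterior differential. -/
def HasDifferentials : Prop :=
  ∀ (q : ℕ) (α : ∀ x, E x [⋀^Fin q]→L[ℝ] ℝ), IsSmoothForm B V α →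
    ∃ η : ∀ x, E x [⋀^Fin (q + 1)]→L[ℝ] ℝ, IsSmoothForm B V η ∧ A.IsExtDiff α η

/-- The derivative of a function along a section. -/
def act (s : Cₛ^∞⟮𝓘(ℝ, B); V, E⟯) (g : M → ℝ) (x : M) : ℝ := dirDeriv B (A.anchor x (s x)) g

theorem isExtDiff_one_iff {θ : ∀ x, E x [⋀^Fin 1]→L[ℝ] ℝ} {η : ∀ x, E x [⋀^Fin 2]→L[ℝ] ℝ} :
    A.IsExtDiff θ η ↔ ∀ (s t : Cₛ^∞⟮𝓘(ℝ, B); V, E⟯) (x : M), η x ![s x, t x] =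
      A.act s (fun y => θ y (fun _ => t y)) x - A.act t (fun y => θ y (fun _ => s y)) x -
        θ x (fun _ => A.bracket s t x) := by
  have key : ∀ (s : Fin 2 → Cₛ^∞⟮𝓘(ℝ, B); V, E⟯) (x : M),
      (∑ i : Fin 2, (-1 : ℝ) ^ (i : ℕ) *
        dirDeriv B (A.anchor x (s i x)) (fun y => θ y (fun k => s (i.succAbove k) y))) +
      A.bracketSum 1 θ s x = A.act (s 0) (fun y => θ y (fun _ => s 1 y)) x -
        A.act (s 1) (fun y => θ y (fun _ => s 0 y)) x -
        θ x (fun _ => A.bracket (s 0) (s 1) x) := by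
    intro s x
    have e1 : ∀ y, (fun k : Fin 1 => s ((0 : Fin 2).succAbove k) y) = fun _ => s 1 y := fun y => by
      funext k; fin_cases k; rfl
    have e2 : ∀ y, (fun k : Fin 1 => s ((1 : Fin 2).succAbove k) y) = fun _ => s 0 y := fun y => by
      funext k; fin_cases k; rfl
    have e3 : A.bracketSum 1 θ s x = -θ x (fun _ => A.bracket (s 0) (s 1) x) := by
      change (∑ j : Fin 2, ∑ a : Fin 1, if a.castSucc < j then
          (-1 : ℝ) ^ ((a : ℕ) + (j : ℕ)) *
            θ x (Fin.cons (A.bracket (s a.castSucc) (s j) x)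
              (fun k : Fin 0 => s (j.succAbove (a.succAbove k)) x)) else 0) = _
      have e4 : ∀ w : Fin 0 → E x, (Fin.cons (A.bracket (s 0) (s 1) x) w : Fin 1 → E x) =
          fun _ => A.bracket (s 0) (s 1) x := fun w => by funext k; fin_cases k; rfl
      simp [Fin.sum_univ_two, e4]
    rw [e3]
    simp only [Fin.sum_univ_two, e1, e2, act]
    simp
    ring
  constructor
  · intro h s t x
    have h1 := h ![s, t] x
    rw [key] at h1
    have e : (fun k => (![s, t] : Fin 2 → _) k x) = ![s x, t x] := by
      funext k; fin_cases k <;> rfl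
    rw [e] at h1
    exact h1
  · intro h s x
    rw [key, ← h]
    congr 1
    funext k; fin_cases k <;> rfl

variable {A}

theorem bracket_swap (s t : Cₛ^∞⟮𝓘(ℝ, B); V, E⟯) : A.bracket s t = -A.bracket t s := by
  have h := A.bracket_self (s + t)
  simp only [map_add, LinearMap.add_apply, A.bracket_self, zero_add, add_zero] at h
  exact eq_neg_of_add_eq_zero_right h

theorem jacobi_left (s t u : Cₛ^∞⟮𝓘(ℝ, B); V, E⟯) :
    A.bracket (A.bracket s t) u = A.bracket s (A.bracket t u) - A.bracket t (A.bracket s u) := by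
  have h := A.jacobi s t u
  rw [bracket_swap u s, map_neg, bracket_swap u (A.bracket s t)] at h
  rw [eq_comm, ← sub_eq_zero, ← h]
  abel

theorem bracket_smulSection {g : M → ℝ} (hg : ContMDiff 𝓘(ℝ, B) 𝓘(ℝ, ℝ) ∞ g)
    (s t : Cₛ^∞⟮𝓘(ℝ, B); V, E⟯) (x : M) :
    A.bracket s (smulSection hg t) x = g x • A.bracket s t x + A.act s g x • t x :=
  A.leibniz g hg s t (smulSection hg t) (fun _ => rfl) x

variable [ContMDiffVectorBundle ∞ V E 𝓘(ℝ, B)]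

/-- The differential of a function `k`, as a `1`-form `v ↦ ρ(v) k`. -/
theorem HasDifferentials.exists_form (hA : A.HasDifferentials) (hreg : SmoothlyRegular B M)
    {k : M → ℝ} (hk : ContMDiff 𝓘(ℝ, B) 𝓘(ℝ, ℝ) ∞ k) :
    ∃ θ : ∀ x, E x [⋀^Fin 1]→L[ℝ] ℝ, IsSmoothForm B V θ ∧
      ∀ x (v : E x), θ x (fun _ => v) = dirDeriv B (A.anchor x v) k := by
  obtain ⟨η, hη, hd⟩ := hA 0 _ (isSmoothForm_functionForm (E := E) (V := V) hk)
  refine ⟨η, hη, fun x v => ?_⟩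
  obtain ⟨s, rfl⟩ := hreg.exists_section (B := B) (V := V) x v
  have h := hd (fun _ => s) x
  rw [h]
  simp [bracketSum, functionForm]

/-- The function is the smooth 1-form `dk` evaluated on `s`. -/
theorem HasDifferentials.contMDiff_act (hA : A.HasDifferentials) (hreg : SmoothlyRegular B M)
    (s : Cₛ^∞⟮𝓘(ℝ, B); V, E⟯) {k : M → ℝ} (hk : ContMDiff 𝓘(ℝ, B) 𝓘(ℝ, ℝ) ∞ k) :
    ContMDiff 𝓘(ℝ, B) 𝓘(ℝ, ℝ) ∞ (A.act s k) := by
  obtain ⟨θ, hθ, hθk⟩ := hA.exists_form hreg hk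
  have h := hθ.isTotalSmooth.contMDiff_section s
  simp only [hθk] at h
  exact h

/-- The anchor is compatible with the commutator of derivations. -/
theorem HasDifferentials.act_bracket (hA : A.HasDifferentials) (hreg : SmoothlyRegular B M)
    (s t : Cₛ^∞⟮𝓘(ℝ, B); V, E⟯) {k : M → ℝ} (hk : ContMDiff 𝓘(ℝ, B) 𝓘(ℝ, ℝ) ∞ k) (x : M) :
    A.act (A.bracket s t) k x = A.act s (A.act t k) x - A.act t (A.act s k) x := by
  have hs := hA.contMDiff_act hreg s hk
  have ht := hA.contMDiff_act hreg t hk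
  -- Expand `[[s, t], k u]` in two ways, by Leibniz directly and by Jacobi followed by Leibniz.
  -- After cancelling `k` times the Jacobi identity for `u`, the coefficients of `u` are compared.
  -- Only the bracket axioms enter, not the anchor identity.
  have key : ∀ u : Cₛ^∞⟮𝓘(ℝ, B); V, E⟯,
      (A.act (A.bracket s t) k x - (A.act s (A.act t k) x - A.act t (A.act s k) x)) • u x = 0 := by
    intro u
    have e : ∀ (r : Cₛ^∞⟮𝓘(ℝ, B); V, E⟯) (hr : ContMDiff 𝓘(ℝ, B) 𝓘(ℝ, ℝ) ∞ (A.act r k)),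
        A.bracket r (smulSection hk u) = smulSection hk (A.bracket r u) + smulSection hr u := by
      intro r hr
      ext y
      exact bracket_smulSection hk r u y
    have h1 := congrArg (fun r : Cₛ^∞⟮𝓘(ℝ, B); V, E⟯ => r x)
      (jacobi_left (A := A) s t (smulSection hk u))
    have h2 := congrArg (fun r : Cₛ^∞⟮𝓘(ℝ, B); V, E⟯ => r x) (jacobi_left (A := A) s t u)
    simp only [e t ht, e s hs, map_add, ContMDiffSection.coe_sub, ContMDiffSection.coe_add,
      Pi.sub_apply, Pi.add_apply, bracket_smulSection] at h1 h2
    rw [h2, smul_sub] at h1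
    rw [sub_smul, sub_smul, sub_eq_zero]
    have h3 : A.act (A.bracket s t) k x • u x =
        (k x • A.bracket s (A.bracket t u) x - k x • A.bracket t (A.bracket s u) x +
          A.act (A.bracket s t) k x • u x) -
          (k x • A.bracket s (A.bracket t u) x - k x • A.bracket t (A.bracket s u) x) := by abel
    rw [h3, h1]
    abel
  -- If all sections vanish at `x`, so do `s`, `t` and `[s, t]`, and every term is zero.
  by_cases hu : ∃ u : Cₛ^∞⟮𝓘(ℝ, B); V, E⟯, u x ≠ 0
  · obtain ⟨u, hu⟩ := hu
    exact sub_eq_zero.1 ((smul_eq_zero.1 (key u)).resolve_right hu)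
  · push Not at hu
    simp [act, hu, dirDeriv_zero_left]

/-- The exterior differential of an exterior differential vanishes, for `1`-forms. -/
theorem HasDifferentials.cyclic_sum_eq_zero (hA : A.HasDifferentials) (hreg : SmoothlyRegular B M)
    {θ : ∀ x, E x [⋀^Fin 1]→L[ℝ] ℝ} (hθ : IsTotalSmooth B V θ)
    {η : ∀ x, E x [⋀^Fin 2]→L[ℝ] ℝ} (hd : A.IsExtDiff θ η) (s t u : Cₛ^∞⟮𝓘(ℝ, B); V, E⟯) (x : M) :
    (A.act s (fun y => η y ![t y, u y]) x + η x ![s x, A.bracket t u x]) +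
    (A.act t (fun y => η y ![u y, s y]) x + η x ![t x, A.bracket u s x]) +
    (A.act u (fun y => η y ![s y, t y]) x + η x ![u x, A.bracket s t x]) = 0 := by
  rw [isExtDiff_one_iff] at hd
  -- Each `η` is replaced by its expression through `θ`, and the action of `[b, c]` by a commutator.
  -- In the cyclic sum the second-order terms cancel, and `θ` of the Jacobi sum remains.
  have key : ∀ a b c : Cₛ^∞⟮𝓘(ℝ, B); V, E⟯,
      A.act a (fun y => η y ![b y, c y]) x + η x ![a x, A.bracket b c x] =
        A.act a (A.act b (fun y => θ y (fun _ => c y))) x -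
        A.act a (A.act c (fun y => θ y (fun _ => b y))) x -
        (A.act b (A.act c (fun y => θ y (fun _ => a y))) x -
          A.act c (A.act b (fun y => θ y (fun _ => a y))) x) -
        θ x (fun _ => A.bracket a (A.bracket b c) x) := by
    intro a b c
    rw [hd a (A.bracket b c) x, funext fun y => hd b c y,
      hA.act_bracket hreg b c (hθ.contMDiff_section a)]
    have h1 : A.act a (fun y => A.act b (fun y => θ y (fun _ => c y)) y -
        A.act c (fun y => θ y (fun _ => b y)) y - θ y (fun _ => A.bracket b c y)) x =
        A.act a (A.act b (fun y => θ y (fun _ => c y))) x -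
        A.act a (A.act c (fun y => θ y (fun _ => b y))) x -
        A.act a (fun y => θ y (fun _ => A.bracket b c y)) x := by
      have hb := hA.contMDiff_act hreg b (hθ.contMDiff_section c)
      have hc := hA.contMDiff_act hreg c (hθ.contMDiff_section b)
      unfold act at hb hc ⊢
      rw [dirDeriv_sub _ (hb.sub hc) (hθ.contMDiff_section _), dirDeriv_sub _ hb hc]
    rw [h1]
    ring
  have hJ : θ x (fun _ => A.bracket s (A.bracket t u) x) + θ x (fun _ => A.bracket t (A.bracket u s) x)
      + θ x (fun _ => A.bracket u (A.bracket s t) x) = 0 := by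
    let L := (ContinuousAlternatingMap.ofSubsingleton ℝ (E x) ℝ (0 : Fin 1)).symm (θ x)
    have hL : ∀ v, θ x (fun _ => v) = L v := fun v => rfl
    have h := congrArg (fun r : Cₛ^∞⟮𝓘(ℝ, B); V, E⟯ => r x) (A.jacobi s t u)
    simp only [ContMDiffSection.coe_add, Pi.add_apply, ContMDiffSection.coe_zero,
      Pi.zero_apply] at h
    rw [hL, hL, hL, ← map_add, ← map_add, h, map_zero]
  rw [key, key, key]
  linear_combination -hJ

end BanachLieAlgebroid

end Algebroid

/-! ### Tangent vectors in charts of Banach manifolds -/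

section Charts

variable {B : Type*} [NormedAddCommGroup B] [NormedSpace ℝ B]
  {M : Type*} [TopologicalSpace M] [ChartedSpace B M]
  {G : Type*} [NormedAddCommGroup G] [NormedSpace ℝ G]

/-- The coordinate in the chart `φ` of the tangent vector `w`. -/
def chartCoord (φ : OpenPartialHomeomorph M B) (x : M) (w : TangentSpace 𝓘(ℝ, B) x) : B :=
  mfderiv 𝓘(ℝ, B) 𝓘(ℝ, B) φ x w

/-- The derivative of `k` along the coordinate line of the chart `φ` whose direction is the
coordinate of the tangent vector `w`. -/
theorem hasDerivAt_comp_chart_line {φ : OpenPartialHomeomorph M B}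
    (hφ : φ ∈ IsManifold.maximalAtlas 𝓘(ℝ, B) ∞ M) {x : M} (hx : x ∈ φ.source)
    (w : TangentSpace 𝓘(ℝ, B) x) {k : M → G} (hk : MDifferentiableAt 𝓘(ℝ, B) 𝓘(ℝ, G) k x) :
    HasDerivAt (fun t : ℝ => k (φ.symm (φ x + t • chartCoord φ x w)))
      (mfderiv 𝓘(ℝ, B) 𝓘(ℝ, G) k x w : G) 0 := by
  have hφx : MDifferentiableAt 𝓘(ℝ, B) 𝓘(ℝ, B) φ x :=
    (contMDiffAt_of_mem_maximalAtlas hφ hx).mdifferentiableAt (by simp)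
  have hsymm : MDifferentiableAt 𝓘(ℝ, B) 𝓘(ℝ, B) φ.symm (φ x) :=
    (contMDiffAt_symm_of_mem_maximalAtlas hφ (φ.map_source hx)).mdifferentiableAt (by simp)
  have hk' : MDifferentiableAt 𝓘(ℝ, B) 𝓘(ℝ, G) (k ∘ φ.symm) (φ x) :=
    MDifferentiableAt.comp (φ x) (by rwa [φ.left_inv hx]) hsymm
  have heq : (k ∘ φ.symm) ∘ φ =ᶠ[𝓝 x] k := by
    filter_upwards [φ.open_source.mem_nhds hx] with y hy
    simp [φ.left_inv hy]
  have hd : mfderiv 𝓘(ℝ, B) 𝓘(ℝ, G) k x =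
      (mfderiv 𝓘(ℝ, B) 𝓘(ℝ, G) (k ∘ φ.symm) (φ x)).comp (mfderiv 𝓘(ℝ, B) 𝓘(ℝ, B) φ x) := by
    rw [← mfderiv_comp x hk' hφx]
    exact heq.symm.mfderiv_eq
  have hd' : mfderiv 𝓘(ℝ, B) 𝓘(ℝ, G) k x w =
      fderiv ℝ (k ∘ φ.symm) (φ x) (chartCoord φ x w) := by
    rw [hd, mfderiv_eq_fderiv]
    rfl
  rw [hd']
  set a : B := chartCoord φ x w
  have hline : HasDerivAt (fun t : ℝ => φ x + t • a) a 0 := by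
    simpa using ((hasDerivAt_id (0 : ℝ)).smul_const a).const_add (φ x)
  have hF : HasFDerivAt (k ∘ φ.symm) (fderiv ℝ (k ∘ φ.symm) (φ x)) (φ x + (0 : ℝ) • a) := by
    rw [zero_smul, add_zero]
    exact (mdifferentiableAt_iff_differentiableAt.1 hk').hasFDerivAt
  exact hF.comp_hasDerivAt (0 : ℝ) hline

/-- A tangent vector is by convention its own coordinate in the preferred chart. -/
theorem chartCoord_chartAt [IsManifold 𝓘(ℝ, B) ∞ M] (x : M) (w : TangentSpace 𝓘(ℝ, B) x) :
    chartCoord (chartAt B x) x w = w := by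
  have h := mfderiv_extChartAt_self (I := 𝓘(ℝ, B)) (x := x)
  have h2 := congrArg (fun L => L w) h
  simpa [extChartAt, mfld_simps, chartCoord] using! h2

theorem contMDiffOn_chartCoord [IsManifold 𝓘(ℝ, B) ∞ M] {φ : OpenPartialHomeomorph M B}
    (hφ : φ ∈ IsManifold.maximalAtlas 𝓘(ℝ, B) ∞ M) :
    ContMDiffOn (𝓘(ℝ, B).prod 𝓘(ℝ, B)) 𝓘(ℝ, B) ∞
      (fun p : TangentBundle 𝓘(ℝ, B) M => chartCoord φ p.1 p.2)
      {p | p.1 ∈ φ.source} := by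
  have h := (contMDiffOn_of_mem_maximalAtlas hφ).contMDiffOn_tangentMapWithin
    (m := ∞) (by simp) φ.open_source.uniqueMDiffOn
  refine ((contMDiff_snd_tangentBundle_modelSpace B 𝓘(ℝ, B)).comp_contMDiffOn h).congr
    fun p hp => ?_
  have h2 : mfderivWithin 𝓘(ℝ, B) 𝓘(ℝ, B) φ φ.source p.1 = mfderiv 𝓘(ℝ, B) 𝓘(ℝ, B) φ p.1 :=
    mfderivWithin_of_isOpen φ.open_source hp
  exact congrArg (fun L => L p.2) h2.symm

end Charts

/-! ### The limit of a strong projective system of manifolds -/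

section LimManifold

open Convenient

variable {B : ℕ → Type*} [∀ i, NormedAddCommGroup (B i)] [∀ i, NormedSpace ℝ (B i)]
  {M : ℕ → Type*} [∀ i, TopologicalSpace (M i)] [∀ i, ChartedSpace (B i) (M i)]
  {δ : ∀ i j, i ≤ j → M j → M i} {l : ∀ i j, i ≤ j → B j →L[ℝ] B i}
  {φ : ∀ i, OpenPartialHomeomorph (M i) (B i)}

theorem linLim_ext {v w : linLim l} (h : ∀ i, v.1 i = w.1 i) : v = w :=
  Subtype.ext (funext h)

theorem IsProjChart.symm_thread (hφ : IsProjChart δ l φ) {y : linLim l}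
    (hy : ∀ i, y.1 i ∈ (φ i).target) (i j : ℕ) (h : i ≤ j) :
    δ i j h ((φ j).symm (y.1 j)) = (φ i).symm (y.1 i) := by
  have hs := (φ j).map_target (hy j)
  rw [← (φ i).left_inv (hφ.mapsTo i j h hs), hφ.coherent i j h _ hs, (φ j).right_inv (hy j),
    y.2 i j h]

open Classical in
/-- The chart `lim φ_i`; outside its target, the inverse takes the value `x₀`. -/
def IsProjChart.limChart (hφ : IsProjChart δ l φ) (x₀ : ProjLim δ) :
    OpenPartialHomeomorph (ProjLim δ) (linLim l) where
  toFun x := if h : ∀ i, x.1 i ∈ (φ i).source then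
    ⟨fun i => φ i (x.1 i), fun i j hij => by rw [← hφ.coherent i j hij _ (h j), x.2 i j hij]⟩ else 0
  invFun y := if h : ∀ i, y.1 i ∈ (φ i).target then
    ⟨fun i => (φ i).symm (y.1 i), hφ.symm_thread h⟩ else x₀
  source := {x | ∀ i, x.1 i ∈ (φ i).source}
  target := {y | ∀ i, y.1 i ∈ (φ i).target}
  map_source' x hx := by
    rw [mem_ofPred_eq] at hx
    rw [dif_pos hx]
    exact fun i => (φ i).map_source (hx i)
  map_target' y hy := by
    rw [mem_ofPred_eq] at hy
    rw [dif_pos hy]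
    exact fun i => (φ i).map_target (hy i)
  left_inv' x hx := by
    rw [mem_ofPred_eq] at hx
    rw [dif_pos hx, dif_pos (fun i => (φ i).map_source (hx i))]
    exact Subtype.ext (funext fun i => (φ i).left_inv (hx i))
  right_inv' y hy := by
    rw [mem_ofPred_eq] at hy
    rw [dif_pos hy, dif_pos (fun i => (φ i).map_target (hy i))]
    exact linLim_ext fun i => (φ i).right_inv (hy i)
  open_source := hφ.isOpen_source
  open_target := hφ.isOpen_target
  continuousOn_toFun := by
    rw [IsInducing.subtypeVal.continuousOn_iff, continuousOn_pi]
    intro i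
    refine ((φ i).continuousOn.comp
      ((continuous_apply i).comp continuous_subtype_val).continuousOn
      fun x (hx : ∀ i, x.1 i ∈ (φ i).source) => hx i).congr
      fun x (hx : ∀ i, x.1 i ∈ (φ i).source) => ?_
    simp only [Function.comp, dif_pos hx]
  continuousOn_invFun := by
    refine IsInducing.subtypeVal.continuousOn_iff.2 (continuousOn_pi.2 ?_)
    intro i
    refine ((φ i).continuousOn_symm.comp
      ((continuous_apply i).comp continuous_subtype_val).continuousOn
      fun x (hx : ∀ i, x.1 i ∈ (φ i).target) => hx i).congr
      fun x (hx : ∀ i, x.1 i ∈ (φ i).target) => ?_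
    simp only [Function.comp, dif_pos hx]

/-- `e` is the limit of the projective system of charts `φ`. -/
structure IsLimChart (δ : ∀ i j, i ≤ j → M j → M i) (l : ∀ i j, i ≤ j → B j →L[ℝ] B i)
    (φ : ∀ i, OpenPartialHomeomorph (M i) (B i))
    (e : OpenPartialHomeomorph (ProjLim δ) (linLim l)) : Prop where
  proj : IsProjChart δ l φ
  source : e.source = {x | ∀ i, x.1 i ∈ (φ i).source}
  target : e.target = {y | ∀ i, y.1 i ∈ (φ i).target}
  apply : ∀ x ∈ e.source, ∀ i, (e x).1 i = φ i (x.1 i)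

theorem mem_limCharts_iff {e : OpenPartialHomeomorph (ProjLim δ) (linLim l)} :
    e ∈ limCharts δ l ↔ ∃ φ, IsLimChart δ l φ e :=
  ⟨fun ⟨φ, h1, h2, h3, h4⟩ => ⟨φ, h1, h2, h3, h4⟩, fun ⟨φ, h1, h2, h3, h4⟩ => ⟨φ, h1, h2, h3, h4⟩⟩

theorem IsProjChart.isLimChart_limChart (hφ : IsProjChart δ l φ) (x₀ : ProjLim δ) :
    IsLimChart δ l φ (hφ.limChart x₀) where
  proj := hφ
  source := rfl
  target := rfl
  apply x hx i := by
    have hx' : ∀ i, x.1 i ∈ (φ i).source := hx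
    simp only [limChart, OpenPartialHomeomorph.coe_mk, dif_pos hx']

/-- The charted space structure of `lim M_i` whose atlas consists of the charts `lim φ_i`. -/
@[reducible]
def IsStrongProjManifold.chartedSpace [∀ i, IsManifold 𝓘(ℝ, B i) ∞ (M i)]
    (hM : IsStrongProjManifold δ l) :
    ChartedSpace (linLim l) (ProjLim δ) where
  atlas := limCharts δ l
  chartAt x := (hM.exists_chart x).choose_spec.1.limChart x
  mem_chart_source x := (hM.exists_chart x).choose_spec.2
  chart_mem_atlas x :=
    mem_limCharts_iff.2 ⟨_, (hM.exists_chart x).choose_spec.1.isLimChart_limChart x⟩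

/-- A curve in `lim M_i` all of whose components are smooth. -/
def SmoothPath (B : ℕ → Type*) [∀ i, NormedAddCommGroup (B i)] [∀ i, NormedSpace ℝ (B i)]
    [∀ i, ChartedSpace (B i) (M i)] (γ : ℝ → ProjLim δ) : Prop :=
  ∀ i, ContMDiff 𝓘(ℝ, ℝ) 𝓘(ℝ, B i) ∞ (fun t => (γ t).1 i)

theorem SmoothPath.continuous {γ : ℝ → ProjLim δ} (hγ : SmoothPath B γ) : Continuous γ :=
  continuous_induced_rng.2 (continuous_pi fun i => (hγ i).continuous)

theorem SmoothPath.comp {γ : ℝ → ProjLim δ} (hγ : SmoothPath B γ) {s : ℝ → ℝ}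
    (hs : ContDiff ℝ ∞ s) : SmoothPath B (fun t => γ (s t)) :=
  fun i => (hγ i).comp hs.contMDiff

theorem SmoothPath.exists_squash {γ : ℝ → ProjLim δ} (hγ : SmoothPath B γ) (t₀ : ℝ)
    {U : Set (ProjLim δ)} (hU : U ∈ 𝓝 (γ t₀)) :
    ∃ s : ℝ → ℝ, ContDiff ℝ ∞ s ∧ (∀ t, γ (s t) ∈ U) ∧ ∀ᶠ t in 𝓝 t₀, s t = t :=
  _root_.exists_squash t₀ (hγ.continuous.continuousAt hU)

namespace IsLimChart

variable {e : OpenPartialHomeomorph (ProjLim δ) (linLim l)}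

theorem mem_source (h : IsLimChart δ l φ e) {x : ProjLim δ} (hx : x ∈ e.source) (i : ℕ) : x.1 i ∈ (φ i).source := by
  rw [h.source] at hx
  exact hx i

theorem mem_target (h : IsLimChart δ l φ e) {y : linLim l} (hy : y ∈ e.target) (i : ℕ) : y.1 i ∈ (φ i).target := by
  rw [h.target] at hy
  exact hy i

theorem symm_apply (h : IsLimChart δ l φ e) {y : linLim l} (hy : y ∈ e.target) (i : ℕ) :
    (e.symm y).1 i = (φ i).symm (y.1 i) := by
  have hs := e.map_target hy
  rw [← (φ i).left_inv (h.mem_source hs i), ← h.apply _ hs, e.right_inv hy]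

/-- Together with `smoothCurve_comp`, this says that limit charts exchange smooth curves of the
model with threads of smooth curves. Smoothness on the limit can thus be tested on such paths,
without charts. -/
theorem smoothPath_symm [∀ i, CompleteSpace (B i)] (h : IsLimChart δ l φ e)
    {c : ℝ → linLim l} (hc : SmoothCurve c)
    (hct : ∀ t, c t ∈ e.target) : SmoothPath B (fun t => e.symm (c t)) := by
  intro i
  have h1 : (fun t => (e.symm (c t)).1 i) = fun t => (φ i).symm ((c t).1 i) :=
    funext fun t => h.symm_apply (hct t) i
  rw [h1, ← contMDiffOn_univ]
  exact (contMDiffOn_symm_of_mem_maximalAtlas (h.proj.mem i)).comp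
    (smoothCurve_linLim_iff.1 hc i).contMDiff.contMDiffOn fun t _ => h.mem_target (hct t) i

theorem smoothCurve_comp [∀ i, CompleteSpace (B i)] (h : IsLimChart δ l φ e)
    {γ : ℝ → ProjLim δ} (hγ : SmoothPath B γ)
    (hs : ∀ t, γ t ∈ e.source) : SmoothCurve (fun t => e (γ t)) := by
  refine smoothCurve_linLim_iff.2 fun i => ?_
  have h1 : (fun t => (e (γ t)).1 i) = fun t => φ i ((γ t).1 i) :=
    funext fun t => h.apply _ (hs t) i
  rw [h1, ← contMDiff_iff_contDiff, ← contMDiffOn_univ]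
  exact (contMDiffOn_of_mem_maximalAtlas (h.proj.mem i)).comp
    (hγ i).contMDiffOn fun t _ => h.mem_source (hs t) i

end IsLimChart

variable [ChartedSpace (linLim l) (ProjLim δ)]

theorem isLimChart_of_mem (hat : atlas (linLim l) (ProjLim δ) = limCharts δ l)
    {e : OpenPartialHomeomorph (ProjLim δ) (linLim l)} (he : e ∈ atlas (linLim l) (ProjLim δ)) :
    ∃ φ, IsLimChart δ l φ e :=
  mem_limCharts_iff.1 (hat ▸ he)

theorem isSmoothManifold_projLim [∀ i, CompleteSpace (B i)]
    (hat : atlas (linLim l) (ProjLim δ) = limCharts δ l) :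
    IsSmoothManifold (linLim l) (ProjLim δ) where
  smooth_change e he e' he' c hc hcU := by
    obtain ⟨φ, hφ⟩ := isLimChart_of_mem hat he
    obtain ⟨φ', hφ'⟩ := isLimChart_of_mem hat he'
    exact hφ'.smoothCurve_comp (hφ.smoothPath_symm hc fun t => (hcU t).1) fun t => (hcU t).2

/-- A path need not remain in one chart; near each time it is squashed into the preferred chart
there. -/
theorem smoothFun_iff [∀ i, CompleteSpace (B i)]
    (hat : atlas (linLim l) (ProjLim δ) = limCharts δ l) {g : ProjLim δ → ℝ} :
    SmoothFun (linLim l) g ↔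
      ∀ γ : ℝ → ProjLim δ, SmoothPath B γ → ContDiff ℝ ∞ (fun t => g (γ t)) := by
  constructor
  · intro hg γ hγ
    rw [contDiff_iff_contDiffAt]
    intro t₀
    obtain ⟨φ, hφ⟩ := isLimChart_of_mem hat (chart_mem_atlas (linLim l) (γ t₀))
    obtain ⟨s, hs, hsU, hst⟩ := hγ.exists_squash t₀
      ((chartAt (linLim l) (γ t₀)).open_source.mem_nhds (mem_chart_source _ _))
    have h1 := hg _ (chart_mem_atlas (linLim l) (γ t₀)) _ (hφ.smoothCurve_comp (hγ.comp hs) hsU)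
      fun t => (chartAt (linLim l) (γ t₀)).map_source (hsU t)
    refine (smoothCurve_iff_contDiff.1 h1).contDiffAt.congr_of_eventuallyEq ?_
    filter_upwards [hst] with t ht
    rw [(chartAt (linLim l) (γ t₀)).left_inv (hsU t), ht]
  · intro hg e he c hc hcU
    obtain ⟨φ, hφ⟩ := isLimChart_of_mem hat he
    exact smoothCurve_iff_contDiff.2 (hg _ (hφ.smoothPath_symm hc hcU))

end LimManifold

/-! ### The limit of a strong projective system of vector bundles -/

section LimBundle

open Convenient

variable {B : ℕ → Type*} [∀ i, NormedAddCommGroup (B i)] [∀ i, NormedSpace ℝ (B i)]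
  {M : ℕ → Type*} [∀ i, TopologicalSpace (M i)] [∀ i, ChartedSpace (B i) (M i)]
  {V : ℕ → Type*} [∀ i, NormedAddCommGroup (V i)] [∀ i, NormedSpace ℝ (V i)]
  {E : ∀ i, M i → Type*} [∀ i x, AddCommGroup (E i x)] [∀ i x, Module ℝ (E i x)]
  [∀ i x, TopologicalSpace (E i x)] [∀ i, TopologicalSpace (TotalSpace (V i) (E i))]
  {δ : ∀ i j, i ≤ j → M j → M i} {l : ∀ i j, i ≤ j → V j →L[ℝ] V i}
  {f : ∀ i j (h : i ≤ j) (x : M j), E j x →L[ℝ] E i (δ i j h x)}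

variable (V) in
/-- The component in `E_i` of a vector of `lim E_i`. -/
def limComp (i : ℕ) {x : ProjLim δ} (v : LimBundle V δ f x) : TotalSpace (V i) (E i) :=
  ⟨x.1 i, v.1 i⟩

/-- The vector of `lim E_i` with given components. -/
def limBundleMk {x : ProjLim δ} (v : ∀ i, E i (x.1 i))
    (hv : ∀ i j (h : i ≤ j), totalMap V δ f i j h ⟨x.1 j, v j⟩ = ⟨x.1 i, v i⟩) :
    LimBundle V δ f x :=
  (⟨v, hv⟩ : limFibre V δ f x)

theorem limBundleMk_apply {x : ProjLim δ} {v : ∀ i, E i (x.1 i)}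
    (hv : ∀ i j (h : i ≤ j), totalMap V δ f i j h ⟨x.1 j, v j⟩ = ⟨x.1 i, v i⟩) (i : ℕ) :
    (limBundleMk (f := f) v hv).1 i = v i :=
  rfl

theorem limBundle_ext {x : ProjLim δ} {v w : LimBundle V δ f x} (h : ∀ i, v.1 i = w.1 i) : v = w :=
  Subtype.ext (funext h)

theorem totalMap_limComp {i j : ℕ} (h : i ≤ j) {x : ProjLim δ} (v : LimBundle V δ f x) :
    totalMap V δ f i j h (limComp V j v) = limComp V i v :=
  v.2 i j h

theorem continuous_limComp (i : ℕ) :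
    Continuous (fun p : TotalSpace (linLim l) (LimBundle V δ f) => limComp V i p.2) := by
  have h : Continuous (fun (p : TotalSpace (linLim l) (LimBundle V δ f)) i => limComp V i p.2) :=
    continuous_induced_dom
  exact (continuous_apply i).comp h

section Topology

variable [∀ i, FiberBundle (V i) (E i)]

theorem continuous_proj_limBundle : Continuous (π (linLim l) (LimBundle V δ f)) :=
  continuous_induced_rng.2 (continuous_pi fun i =>
    (FiberBundle.continuous_proj (V i) (E i)).comp (continuous_limComp i))

/-- Each inclusion of a fibre of `E_i` in its total space is inducing. Products and subspaces
preserve this, and both topologies on the limit are induced from products. -/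
theorem isInducing_mk_limBundle (x : ProjLim δ) :
    IsInducing (@TotalSpace.mk _ (linLim l) (LimBundle V δ f) x) := by
  have h1 : IsInducing (fun (v : ∀ i, E i (x.1 i)) i => (⟨x.1 i, v i⟩ : TotalSpace (V i) (E i))) :=
    IsInducing.piMap fun i => FiberBundle.totalSpaceMk_isInducing (V i) (E i) (x.1 i)
  have h2 := h1.comp (IsInducing.subtypeVal (t := (limFibre V δ f x : Set (∀ i, E i (x.1 i)))))
  refine ⟨?_⟩
  change _ = TopologicalSpace.induced _ (TopologicalSpace.induced _ _)
  rw [induced_compose]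
  exact h2.eq_induced

end Topology

variable {τ : ∀ i, Trivialization (V i) (π (V i) (E i))}

section Trivialization

variable [∀ i, FiberBundle (V i) (E i)] [∀ i, VectorBundle ℝ (V i) (E i)]
  [∀ i, IsManifold 𝓘(ℝ, B i) ∞ (M i)]

theorem IsProjTriv.symm_thread (hτ : IsProjTriv B δ l f τ) {x : ProjLim δ}
    (hx : ∀ i, x.1 i ∈ (τ i).baseSet) (v : linLim l) (i j : ℕ) (h : i ≤ j) :
    totalMap V δ f i j h ⟨x.1 j, (τ j).symm (x.1 j) (v.1 j)⟩ =
      (⟨x.1 i, (τ i).symm (x.1 i) (v.1 i)⟩ : TotalSpace (V i) (E i)) := by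
  have hj : (⟨x.1 j, (τ j).symm (x.1 j) (v.1 j)⟩ : TotalSpace (V j) (E j)) ∈ (τ j).source :=
    (τ j).mem_source.2 (hx j)
  refine (τ i).injOn ((τ i).mem_source.2 (hτ.mapsTo i j h (hx j))) ((τ i).mem_source.2 (hx i)) ?_
  change τ i _ = τ i _
  rw [hτ.coherent i j h _ hj, (τ j).apply_mk_symm (hx j), (τ i).apply_mk_symm (hx i), x.2 i j h,
    v.2 i j h]

theorem IsProjTriv.snd_thread (hτ : IsProjTriv B δ l f τ) {x : ProjLim δ}
    (hx : ∀ i, x.1 i ∈ (τ i).baseSet) (v : LimBundle V δ f x) (i j : ℕ) (h : i ≤ j) :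
    l i j h (τ j (limComp V j v)).2 = (τ i (limComp V i v)).2 := by
  have hj : limComp V j v ∈ (τ j).source := (τ j).mem_source.2 (hx j)
  have := hτ.coherent i j h _ hj
  rw [totalMap_limComp] at this
  rw [this]

open Classical in
/-- The coordinates of a vector of `lim E_i` in the trivialization `lim τ_i`. -/
def IsProjTriv.coordVec (hτ : IsProjTriv B δ l f τ) {x : ProjLim δ} (v : LimBundle V δ f x) :
    linLim l :=
  if h : ∀ i, x.1 i ∈ (τ i).baseSet then
    ⟨fun i => (τ i (limComp V i v)).2, hτ.snd_thread h v⟩ else 0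

open Classical in
/-- The vector of `lim E_i` with given coordinates in the trivialization `lim τ_i`. -/
def IsProjTriv.symmVec (hτ : IsProjTriv B δ l f τ) (x : ProjLim δ) (v : linLim l) :
    LimBundle V δ f x :=
  if h : ∀ i, x.1 i ∈ (τ i).baseSet then
    limBundleMk (fun i => (τ i).symm (x.1 i) (v.1 i)) (hτ.symm_thread h v) else 0

theorem IsProjTriv.coordVec_apply (hτ : IsProjTriv B δ l f τ) {x : ProjLim δ}
    (hx : ∀ i, x.1 i ∈ (τ i).baseSet) (v : LimBundle V δ f x) (i : ℕ) :
    (hτ.coordVec v).1 i = (τ i (limComp V i v)).2 := by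
  rw [IsProjTriv.coordVec, dif_pos hx]

theorem IsProjTriv.symmVec_apply (hτ : IsProjTriv B δ l f τ) {x : ProjLim δ}
    (hx : ∀ i, x.1 i ∈ (τ i).baseSet) (v : linLim l) (i : ℕ) :
    (hτ.symmVec x v).1 i = (τ i).symm (x.1 i) (v.1 i) := by
  rw [IsProjTriv.symmVec, dif_pos hx, limBundleMk_apply]

/-- The trivialization `lim τ_i`. -/
def IsProjTriv.limTriv (hτ : IsProjTriv B δ l f τ) :
    Trivialization (linLim l) (π (linLim l) (LimBundle V δ f)) where
  toFun p := (p.1, hτ.coordVec p.2)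
  invFun q := ⟨q.1, hτ.symmVec q.1 q.2⟩
  source := π (linLim l) (LimBundle V δ f) ⁻¹' {x : ProjLim δ | ∀ i, x.1 i ∈ (τ i).baseSet}
  target := {x : ProjLim δ | ∀ i, x.1 i ∈ (τ i).baseSet} ×ˢ univ
  baseSet := {x : ProjLim δ | ∀ i, x.1 i ∈ (τ i).baseSet}
  source_eq := rfl
  target_eq := rfl
  open_baseSet := hτ.isOpen_base
  open_source := hτ.isOpen_base.preimage continuous_proj_limBundle
  open_target := hτ.isOpen_base.prod isOpen_univ
  map_source' p hp := ⟨hp, mem_univ _⟩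
  map_target' q hq := hq.1
  left_inv' p (hp : ∀ i, p.1.1 i ∈ (τ i).baseSet) := by
    refine congrArg (TotalSpace.mk p.1) (limBundle_ext fun i => ?_)
    rw [hτ.symmVec_apply hp, hτ.coordVec_apply hp]
    exact (τ i).symm_apply_apply_mk (hp i) (p.2.1 i)
  right_inv' q hq := by
    have hq' : ∀ i, q.1.1 i ∈ (τ i).baseSet := hq.1
    refine Prod.ext rfl (linLim_ext fun i => ?_)
    rw [hτ.coordVec_apply hq', limComp, hτ.symmVec_apply hq']
    exact congrArg Prod.snd ((τ i).apply_mk_symm (hq' i) (q.2.1 i))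
  proj_toFun p hp := rfl
  continuousOn_toFun := by
    refine continuous_proj_limBundle.continuousOn.prodMk
      (IsInducing.subtypeVal.continuousOn_iff.2 (continuousOn_pi.2 fun i => ?_))
    exact (continuous_snd.comp_continuousOn ((τ i).continuousOn.comp
      (continuous_limComp i).continuousOn fun p (hp : ∀ i, p.1.1 i ∈ (τ i).baseSet) =>
        (τ i).mem_source.2 (hp i))).congr fun p (hp : ∀ i, p.1.1 i ∈ (τ i).baseSet) =>
          hτ.coordVec_apply hp p.2 i
  continuousOn_invFun := by
    refine (IsInducing.mk rfl).continuousOn_iff.2 (continuousOn_pi.2 fun i => ?_)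
    have hc : Continuous (fun q : ProjLim δ × linLim l => (q.1.1 i, q.2.1 i)) :=
      (((continuous_apply i).comp continuous_subtype_val).comp continuous_fst).prodMk
        (((continuous_apply i).comp continuous_subtype_val).comp continuous_snd)
    refine ((τ i).toOpenPartialHomeomorph.continuousOn_symm.comp hc.continuousOn
      fun q hq => (τ i).mem_target.2 (hq.1 i)).congr fun q hq => ?_
    simp only [Function.comp, hτ.symmVec_apply hq.1]
    exact (τ i).mk_symm (hq.1 i) _

end Trivialization

/-- `T` is the limit of the projective system of trivializations `τ`. -/
structure IsLimTriv (B : ℕ → Type*) [∀ i, NormedAddCommGroup (B i)] [∀ i, NormedSpace ℝ (B i)]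
    [∀ i, ChartedSpace (B i) (M i)] [∀ i, IsManifold 𝓘(ℝ, B i) ∞ (M i)]
    [∀ i, FiberBundle (V i) (E i)] [∀ i, VectorBundle ℝ (V i) (E i)]
    (δ : ∀ i j, i ≤ j → M j → M i) (l : ∀ i j, i ≤ j → V j →L[ℝ] V i)
    (f : ∀ i j (h : i ≤ j) (x : M j), E j x →L[ℝ] E i (δ i j h x))
    (τ : ∀ i, Trivialization (V i) (π (V i) (E i)))
    (T : Trivialization (linLim l) (π (linLim l) (LimBundle V δ f))) : Prop where
  proj : IsProjTriv B δ l f τ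
  baseSet : T.baseSet = {x | ∀ i, x.1 i ∈ (τ i).baseSet}
  apply : ∀ x ∈ T.baseSet, ∀ (v : LimBundle V δ f x) (i : ℕ),
    (T ⟨x, v⟩).2.1 i = (τ i ⟨x.1 i, v.1 i⟩).2

variable [∀ i, FiberBundle (V i) (E i)] [∀ i, VectorBundle ℝ (V i) (E i)]
  [∀ i, IsManifold 𝓘(ℝ, B i) ∞ (M i)]

theorem mem_limTrivs_iff {T : Trivialization (linLim l) (π (linLim l) (LimBundle V δ f))} :
    T ∈ limTrivs B δ l f ↔ ∃ τ, IsLimTriv B δ l f τ T :=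
  ⟨fun ⟨τ, h1, h2, h3⟩ => ⟨τ, h1, h2, h3⟩, fun ⟨τ, h1, h2, h3⟩ => ⟨τ, h1, h2, h3⟩⟩

theorem IsProjTriv.isLimTriv_limTriv (hτ : IsProjTriv B δ l f τ) :
    IsLimTriv B δ l f τ hτ.limTriv where
  proj := hτ
  baseSet := rfl
  apply x hx v i := by
    have hx' : ∀ i, x.1 i ∈ (τ i).baseSet := hx
    exact hτ.coordVec_apply hx' v i

/-- The fibre bundle structure of `lim E_i` defined by the trivializations `lim τ_i`. -/
@[reducible]
def IsStrongProjBundle.fiberBundle (hE : IsStrongProjBundle B δ l f) :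
    FiberBundle (linLim l) (LimBundle V δ f) where
  totalSpaceMk_isInducing' := isInducing_mk_limBundle
  trivializationAtlas' := limTrivs B δ l f
  trivializationAt' x := (hE.exists_triv x).choose_spec.1.limTriv
  mem_baseSet_trivializationAt' x := (hE.exists_triv x).choose_spec.2
  trivialization_mem_atlas' x :=
    mem_limTrivs_iff.2 ⟨_, (hE.exists_triv x).choose_spec.1.isLimTriv_limTriv⟩

namespace IsLimTriv

variable {T : Trivialization (linLim l) (π (linLim l) (LimBundle V δ f))}

theorem mem_baseSet (h : IsLimTriv B δ l f τ T) {x : ProjLim δ} (hx : x ∈ T.baseSet) (i : ℕ) :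
    x.1 i ∈ (τ i).baseSet := by
  rw [h.baseSet] at hx
  exact hx i

theorem symm_apply (h : IsLimTriv B δ l f τ T) {x : ProjLim δ} (hx : x ∈ T.baseSet) (v : linLim l)
    (i : ℕ) : (T.symm x v).1 i = (τ i).symm (x.1 i) (v.1 i) := by
  have h1 := h.apply x hx (T.symm x v) i
  rw [T.apply_mk_symm hx] at h1
  rw [← (τ i).symm_apply_apply_mk (h.mem_baseSet hx i) ((T.symm x v).1 i), ← h1]

theorem isLinear (h : IsLimTriv B δ l f τ T) : T.IsLinear ℝ where
  linear x hx := by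
    have hl := fun i => (h.proj.linear i).linear _ (h.mem_baseSet hx i)
    exact
    { map_add := fun v w => linLim_ext fun i => by
        rw [h.apply x hx]
        refine ((hl i).map_add (v.1 i) (w.1 i)).trans ?_
        rw [← h.apply x hx, ← h.apply x hx]
        rfl
      map_smul := fun a v => linLim_ext fun i => by
        rw [h.apply x hx]
        refine ((hl i).map_smul a (v.1 i)).trans ?_
        rw [← h.apply x hx]
        rfl }

/-- The vector with coordinates `v t` over the smooth path `γ` depends smoothly on `t`. -/
theorem contMDiff_symm (h : IsLimTriv B δ l f τ T) {γ : ℝ → ProjLim δ}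
    (hγ : SmoothPath B γ) (hγT : ∀ t, γ t ∈ T.baseSet) {v : ℝ → linLim l}
    (hv : ∀ i, ContDiff ℝ ∞ (fun t => (v t).1 i)) (i : ℕ) :
    ContMDiff 𝓘(ℝ, ℝ) (𝓘(ℝ, B i).prod 𝓘(ℝ, V i)) ∞
      (fun t => limComp V i (T.symm (γ t) (v t))) := by
  have h1 : (fun t => limComp V i (T.symm (γ t) (v t))) = fun t =>
      (τ i).toOpenPartialHomeomorph.symm ((γ t).1 i, (v t).1 i) := by
    funext t
    rw [limComp, h.symm_apply (hγT t)]
    exact (τ i).mk_symm (h.mem_baseSet (hγT t) i) _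
  rw [h1, ← contMDiffOn_univ]
  exact (h.proj.smooth_symm i).comp ((hγ i).prodMk (hv i).contMDiff).contMDiffOn
    fun t _ => (τ i).mem_target.2 (h.mem_baseSet (hγT t) i)

/-- The coordinates of a smoothly varying vector are smooth. -/
theorem contDiff_coord (h : IsLimTriv B δ l f τ T) {γ : ℝ → ProjLim δ}
    (hγT : ∀ t, γ t ∈ T.baseSet) {w : ∀ t, LimBundle V δ f (γ t)} {i : ℕ}
    (hw : ContMDiff 𝓘(ℝ, ℝ) (𝓘(ℝ, B i).prod 𝓘(ℝ, V i)) ∞ (fun t => limComp V i (w t))) :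
    ContDiff ℝ ∞ (fun t => (T ⟨γ t, w t⟩).2.1 i) := by
  have h1 : (fun t => (T ⟨γ t, w t⟩).2.1 i) = fun t => (τ i (limComp V i (w t))).2 :=
    funext fun t => h.apply _ (hγT t) _ i
  rw [h1, ← contMDiff_iff_contDiff, ← contMDiffOn_univ]
  exact contMDiff_snd.comp_contMDiffOn ((h.proj.smooth i).comp hw.contMDiffOn
    fun t _ => (τ i).mem_source.2 (h.mem_baseSet (hγT t) i))

end IsLimTriv

variable {lB : ∀ i j, i ≤ j → B j →L[ℝ] B i} [ChartedSpace (linLim lB) (ProjLim δ)]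
  [FiberBundle (linLim l) (LimBundle V δ f)]

theorem isLimTriv_of_mem
    (htr : FiberBundle.trivializationAtlas (linLim l) (LimBundle V δ f) = limTrivs B δ l f)
    {T : Trivialization (linLim l) (π (linLim l) (LimBundle V δ f))}
    (hT : T ∈ FiberBundle.trivializationAtlas (linLim l) (LimBundle V δ f)) :
    ∃ τ, IsLimTriv B δ l f τ T :=
  mem_limTrivs_iff.1 (htr ▸ hT)

variable [∀ i, CompleteSpace (B i)] [∀ i, CompleteSpace (V i)]

theorem isSmoothVectorBundle_limBundle
    (hat : atlas (linLim lB) (ProjLim δ) = limCharts δ lB)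
    (htr : FiberBundle.trivializationAtlas (linLim l) (LimBundle V δ f) = limTrivs B δ l f) :
    IsSmoothVectorBundle (linLim lB) (linLim l) (LimBundle V δ f) where
  linear T hT := by
    obtain ⟨τ, hτ⟩ := isLimTriv_of_mem htr hT
    exact hτ.isLinear
  smooth_change T hT T' hT' e he c hc hcU := by
    obtain ⟨τ, hτ⟩ := isLimTriv_of_mem htr hT
    obtain ⟨τ', hτ'⟩ := isLimTriv_of_mem htr hT'
    obtain ⟨φ, hφ⟩ := isLimChart_of_mem hat he
    obtain ⟨hc1, hc2⟩ := smoothCurve_prod_iff.1 hc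
    refine smoothCurve_linLim_iff.2 fun i => ?_
    exact hτ'.contDiff_coord (fun t => (hcU t).2.2)
      (hτ.contMDiff_symm (hφ.smoothPath_symm hc1 fun t => (hcU t).1) (fun t => (hcU t).2.1)
        (smoothCurve_linLim_iff.1 hc2) i)

/-- A criterion free of charts and trivializations: the limit trivializations and their inverses act
componentwise by diffeomorphisms `τ i`, so only the components along smooth paths matter. -/
theorem isSmoothSection_iff
    (hat : atlas (linLim lB) (ProjLim δ) = limCharts δ lB)
    (htr : FiberBundle.trivializationAtlas (linLim l) (LimBundle V δ f) = limTrivs B δ l f)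
    {σ : ∀ x, LimBundle V δ f x} :
    IsSmoothSection (linLim lB) (linLim l) σ ↔ ∀ γ : ℝ → ProjLim δ, SmoothPath B γ → ∀ i,
      ContMDiff 𝓘(ℝ, ℝ) (𝓘(ℝ, B i).prod 𝓘(ℝ, V i)) ∞ (fun t => limComp V i (σ (γ t))) := by
  constructor
  · intro hσ γ hγ i t₀
    obtain ⟨φ, hφ⟩ := isLimChart_of_mem hat (chart_mem_atlas (linLim lB) (γ t₀))
    have hT := FiberBundle.trivialization_mem_atlas (linLim l) (LimBundle V δ f) (γ t₀)
    obtain ⟨τ, hτ⟩ := isLimTriv_of_mem htr hT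
    set e := chartAt (linLim lB) (γ t₀)
    set T := FiberBundle.trivializationAt (linLim l) (LimBundle V δ f) (γ t₀)
    obtain ⟨s, hs, hsU, hst⟩ := hγ.exists_squash t₀ (inter_mem
      (e.open_source.mem_nhds (mem_chart_source _ _))
      (T.open_baseSet.mem_nhds (FiberBundle.mem_baseSet_trivializationAt _ _ _)))
    have h1 := hσ T hT e (chart_mem_atlas _ _) _
      (hφ.smoothCurve_comp (hγ.comp hs) fun t => (hsU t).1) fun t =>
        ⟨e.map_source (hsU t).1, by rw [e.left_inv (hsU t).1]; exact (hsU t).2⟩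
    have h2 := hτ.contMDiff_symm (hγ.comp hs) (fun t => (hsU t).2) (smoothCurve_linLim_iff.1 h1) i
    refine h2.contMDiffAt.congr_of_eventuallyEq ?_
    filter_upwards [hst] with t ht
    rw [e.left_inv (hsU t).1, T.symm_apply_apply_mk (hsU t).2, ht]
  · intro hσ T hT e he c hc hcU
    obtain ⟨τ, hτ⟩ := isLimTriv_of_mem htr hT
    obtain ⟨φ, hφ⟩ := isLimChart_of_mem hat he
    exact smoothCurve_linLim_iff.2 fun i => hτ.contDiff_coord (fun t => (hcU t).2)
      (hσ _ (hφ.smoothPath_symm hc fun t => (hcU t).1) i)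

end LimBundle

/-! ### Vector fields on manifolds modelled on projective limits of Banach spaces -/

namespace Convenient

section VectorFields

variable {W : ℕ → Type*} [∀ i, NormedAddCommGroup (W i)] [∀ i, NormedSpace ℝ (W i)]
  {l : ∀ i j, i ≤ j → W j →L[ℝ] W i}
  {N : Type*} [TopologicalSpace N] [ChartedSpace (linLim l) N]

theorem diff_congr {F G : Type*} [AddCommGroup F] [Module ℝ F] [AddCommGroup G] [Module ℝ G]
    [TopologicalSpace G] {f g : F → G} {x v : F}
    (h : ∀ᶠ t : ℝ in 𝓝 0, f (x + t • v) = g (x + t • v)) : diff f x v = diff g x v := by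
  have h0 : f x = g x := by simpa using h.self_of_nhds
  unfold diff limUnder
  congr 1
  refine map_congr ?_
  filter_upwards [nhdsWithin_le_nhds h] with t ht
  rw [ht, h0]

theorem eventually_line_mem {U : Set (linLim l)} (hU : IsOpen U) {x : linLim l} (hx : x ∈ U)
    (v : linLim l) : ∀ᶠ t : ℝ in 𝓝 0, x + t • v ∈ U := by
  have hcc : Continuous fun t : ℝ => x + t • v :=
    continuous_linLim fun i => (contDiff_line x v i).continuous
  exact hcc.continuousAt.preimage_mem_nhds (hU.mem_nhds (by simpa using hx))

/-- The coordinate line through `x` in the direction `v`. -/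
def chartLine (x : N) (v : Tangent (linLim l) x) (t : ℝ) : N :=
  -- The abstraction over `u` lets the tangent vector be used as an element of the model space, to
  -- which `Tangent` unfolds.
  (chartAt (linLim l) x).symm ((fun u : linLim l => chartAt (linLim l) x x + t • u) v)

/-- The derivative of a function in the direction of a tangent vector. -/
def tangentAct {x : N} (v : Tangent (linLim l) x) (g : N → ℝ) : ℝ :=
  diff (fun y : linLim l => g ((chartAt (linLim l) x).symm y)) (chartAt (linLim l) x x) v

theorem fieldAct_eq_tangentAct (X : ∀ x : N, Tangent (linLim l) x) (g : N → ℝ) (x : N) :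
    fieldAct X g x = tangentAct (X x) g :=
  rfl

theorem chartLine_zero (x : N) (v : Tangent (linLim l) x) : chartLine x v 0 = x := by
  have h0 : ∀ u : linLim l, chartAt (linLim l) x x + (0 : ℝ) • u = chartAt (linLim l) x x := by
    simp
  exact (congrArg _ (h0 v)).trans ((chartAt (linLim l) x).left_inv (mem_chart_source _ x))

variable {g h : N → ℝ} {x : N}

theorem SmoothFun.hasDerivAt_chartLine (hg : SmoothFun (linLim l) g)
    (v : Tangent (linLim l) x) :
    HasDerivAt (fun t => g (chartLine x v t)) (tangentAct v g) 0 :=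
  (hg _ (chart_mem_atlas _ x)).hasDerivAt_line (chartAt (linLim l) x).open_target
    (mem_chart_target _ x) v

theorem tangentAct_eq_of_hasDerivAt {v : Tangent (linLim l) x} {d : ℝ}
    (hd : HasDerivAt (fun t => g (chartLine x v t)) d 0) : tangentAct v g = d :=
  diff_eq_of_hasDerivAt hd

theorem SmoothFun.tangentAct_add (hg : SmoothFun (linLim l) g) (v w : Tangent (linLim l) x) :
    tangentAct (v + w) g = tangentAct v g + tangentAct w g :=
  diff_add_right (hg _ (chart_mem_atlas _ x)) (chartAt (linLim l) x).open_target
    (mem_chart_target _ x) v w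

theorem SmoothFun.tangentAct_smul (hg : SmoothFun (linLim l) g) (a : ℝ)
    (v : Tangent (linLim l) x) : tangentAct (a • v) g = a * tangentAct v g :=
  diff_smul_right (hg _ (chart_mem_atlas _ x)) (chartAt (linLim l) x).open_target
    (mem_chart_target _ x) a v

theorem SmoothFun.tangentAct_fun_add (hg : SmoothFun (linLim l) g) (hh : SmoothFun (linLim l) h)
    (v : Tangent (linLim l) x) :
    tangentAct v (fun y => g y + h y) = tangentAct v g + tangentAct v h :=
  tangentAct_eq_of_hasDerivAt ((hg.hasDerivAt_chartLine v).add (hh.hasDerivAt_chartLine v))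

theorem SmoothFun.tangentAct_fun_sub (hg : SmoothFun (linLim l) g) (hh : SmoothFun (linLim l) h)
    (v : Tangent (linLim l) x) :
    tangentAct v (fun y => g y - h y) = tangentAct v g - tangentAct v h :=
  tangentAct_eq_of_hasDerivAt ((hg.hasDerivAt_chartLine v).sub (hh.hasDerivAt_chartLine v))

theorem SmoothFun.tangentAct_fun_mul (hg : SmoothFun (linLim l) g) (hh : SmoothFun (linLim l) h)
    (v : Tangent (linLim l) x) :
    tangentAct v (fun y => g y * h y) = tangentAct v g * h x + g x * tangentAct v h := by
  have := (hg.hasDerivAt_chartLine v).mul (hh.hasDerivAt_chartLine v)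
  rw [chartLine_zero] at this
  exact tangentAct_eq_of_hasDerivAt this

theorem SmoothFun.tangentAct_const_mul (a : ℝ) (hg : SmoothFun (linLim l) g)
    (v : Tangent (linLim l) x) :
    tangentAct v (fun y => a * g y) = a * tangentAct v g :=
  tangentAct_eq_of_hasDerivAt ((hg.hasDerivAt_chartLine v).const_mul a)

theorem tangentCoord_chartAt (v : Tangent (linLim l) x) :
    tangentCoord (chartAt (linLim l) x) x v = v := by
  have h1 : tangentCoord (chartAt (linLim l) x) x v =
      diff (fun y : linLim l => y) (chartAt (linLim l) x x) v :=
    diff_congr ((eventually_line_mem (chartAt (linLim l) x).open_target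
      (mem_chart_target _ x) v).mono fun t ht => (chartAt (linLim l) x).right_inv ht)
  rw [h1]
  refine diff_linLim_eq_of_hasDerivAt fun i => ?_
  exact hasDerivAt_line (chartAt (linLim l) x x) v i 0

theorem fieldCoord_chartAt (X : ∀ x : N, Tangent (linLim l) x) (x : N) :
    fieldCoord X (chartAt (linLim l) x) (chartAt (linLim l) x x) = X x := by
  rw [fieldCoord, (chartAt (linLim l) x).left_inv (mem_chart_source _ x), tangentCoord_chartAt]

variable [∀ i, CompleteSpace (W i)] [IsSmoothManifold (linLim l) N]

/-- The derivative in the direction of a tangent vector, read in an arbitrary chart. -/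
theorem SmoothFun.tangentAct_eq (hg : SmoothFun (linLim l) g)
    {e : OpenPartialHomeomorph N (linLim l)} (he : e ∈ atlas (linLim l) N) (hx : x ∈ e.source)
    (v : Tangent (linLim l) x) :
    tangentAct v g = diff (fun y => g (e.symm y)) (e x) (tangentCoord e x v) := by
  set c := chartAt (linLim l) x with hc
  have hxc : x ∈ c.source := mem_chart_source _ x
  have hU : IsOpen (c.target ∩ c.symm ⁻¹' e.source) := c.isOpen_inter_preimage_symm e.open_source
  have hxU : c x ∈ c.target ∩ c.symm ⁻¹' e.source :=
    ⟨c.map_source hxc, by rw [mem_preimage, c.left_inv hxc]; exact hx⟩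
  have hsm := IsSmoothManifold.smooth_change c (chart_mem_atlas (linLim l) x) e he
  obtain ⟨u, hu⟩ : ∃ u : linLim l, u = v := ⟨v, rfl⟩
  obtain ⟨s, hs, hsU, hse⟩ := exists_squash (0 : ℝ) (eventually_line_mem hU hxU u)
  have h1 := smoothCurve_linLim_iff.1 (hsm (fun t => c x + s t • u)
    (smoothCurve_linLim_iff.2 fun i => (contDiff_line (c x) u i).comp hs) hsU)
  have hs0 : s 0 = 0 := hse.self_of_nhds
  have h0 : e (c.symm (c x + s 0 • u)) = e x := by
    rw [hs0, zero_smul, add_zero, c.left_inv hxc]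
  have hd : tangentCoord e x v = diff (fun y => e (c.symm y)) (c x) u := by rw [hu]; rfl
  -- The chain rule for `g ∘ e.symm` along the preferred coordinate line seen in `e`, whose velocity
  -- is `tangentCoord e x v` by definition.
  have h2 := (hg e he).hasDerivAt_comp e.open_target (c := fun t => e (c.symm (c x + s t • u))) h1
    (t₀ := 0) (by rw [h0]; exact e.map_source hx) (v := tangentCoord e x v) fun i => by
      rw [hd]
      exact (hasDerivAt_diff_linLim hsm hU hxU u i).congr_of_eventuallyEq
        (hse.mono fun t ht => by simp only [ht])
  rw [h0] at h2
  refine tangentAct_eq_of_hasDerivAt (h2.congr_of_eventuallyEq ?_)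
  filter_upwards [hse] with t ht
  rw [e.left_inv (hsU t).2, ht, ← hu]
  rfl

theorem SmoothFun.fieldAct_symm (hg : SmoothFun (linLim l) g)
    {e : OpenPartialHomeomorph N (linLim l)} (he : e ∈ atlas (linLim l) N)
    (X : ∀ x : N, Tangent (linLim l) x) {y : linLim l} (hy : y ∈ e.target) :
    fieldAct X g (e.symm y) = diff (fun y => g (e.symm y)) y (fieldCoord X e y) := by
  rw [fieldAct_eq_tangentAct, hg.tangentAct_eq he (e.map_target hy), e.right_inv hy]
  rfl

/-- Smooth vector fields. -/
def SmoothField (X : ∀ x : N, Tangent (linLim l) x) : Prop :=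
  ∀ e ∈ atlas (linLim l) N, SmoothOn (fieldCoord X e) e.target

theorem SmoothFun.fieldAct (hg : SmoothFun (linLim l) g) {X : ∀ x : N, Tangent (linLim l) x}
    (hX : SmoothField X) : SmoothFun (linLim l) (fieldAct X g) := fun e he c hc hcU =>
  ((hg e he).smoothOn_diff e.open_target (hX e he) c hc hcU).congr fun t =>
    hg.fieldAct_symm he X (hcU t)

/-- In the preferred chart at `x` this is the commutator formula `diff_diff_sub`, since a tangent
vector at `x` is its own coordinate there. -/
theorem SmoothFun.tangentAct_fieldBracket (hg : SmoothFun (linLim l) g)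
    {X Y : ∀ x : N, Tangent (linLim l) x} (hX : SmoothField X) (hY : SmoothField Y) (x : N) :
    tangentAct (fieldBracket X Y x) g =
      tangentAct (X x) (Convenient.fieldAct Y g) - tangentAct (Y x) (Convenient.fieldAct X g) := by
  have he := chart_mem_atlas (linLim l) x
  set c := chartAt (linLim l) x with hc
  have hxc : c x ∈ c.target := mem_chart_target _ x
  have key : ∀ X Y : ∀ x : N, Tangent (linLim l) x, tangentAct (X x) (Convenient.fieldAct Y g) =
      diff (fun y => diff (fun y => g (c.symm y)) y (fieldCoord Y c y)) (c x)
        (fieldCoord X c (c x)) := by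
    intro X Y
    rw [hc, fieldCoord_chartAt X x]
    exact diff_congr ((eventually_line_mem c.open_target hxc _).mono fun t ht =>
      hg.fieldAct_symm he Y ht)
  rw [key, key, diff_diff_sub (hg c he) c.open_target (hX c he) (hY c he) hxc, hc,
    fieldCoord_chartAt, fieldCoord_chartAt]
  rfl

end VectorFields

end Convenient

/-! ### The limit anchor -/

section AnchorCoord

variable {B : Type*} [NormedAddCommGroup B] [NormedSpace ℝ B]
  {M : Type*} [TopologicalSpace M] [ChartedSpace B M] [IsManifold 𝓘(ℝ, B) ∞ M]
  {V : Type*} [NormedAddCommGroup V] [NormedSpace ℝ V]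
  {E : M → Type*} [∀ x, AddCommGroup (E x)] [∀ x, Module ℝ (E x)]
  [∀ x, TopologicalSpace (E x)] [TopologicalSpace (TotalSpace V E)] [FiberBundle V E]
  [VectorBundle ℝ V E]

/-- The coordinate of `ρ(p)` in the chart `φ`. -/
def BanachLieAlgebroid.anchorCoord (A : BanachLieAlgebroid B V E) (φ : OpenPartialHomeomorph M B)
    (p : TotalSpace V E) : B :=
  chartCoord φ p.1 (A.anchor p.1 p.2)

theorem BanachLieAlgebroid.contMDiffOn_anchorCoord (A : BanachLieAlgebroid B V E)
    {φ : OpenPartialHomeomorph M B} (hφ : φ ∈ IsManifold.maximalAtlas 𝓘(ℝ, B) ∞ M) :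
    ContMDiffOn (𝓘(ℝ, B).prod 𝓘(ℝ, V)) 𝓘(ℝ, B) ∞ (A.anchorCoord φ) {p | p.1 ∈ φ.source} :=
  (contMDiffOn_chartCoord hφ).comp A.smooth_anchor.contMDiffOn fun _ hp => hp

end AnchorCoord

section LimAnchor

open Convenient

variable {B : ℕ → Type*} [∀ i, NormedAddCommGroup (B i)] [∀ i, NormedSpace ℝ (B i)]
  [∀ i, CompleteSpace (B i)]
  {M : ℕ → Type*} [∀ i, TopologicalSpace (M i)] [∀ i, ChartedSpace (B i) (M i)]
  [∀ i, IsManifold 𝓘(ℝ, B i) ∞ (M i)]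
  {V : ℕ → Type*} [∀ i, NormedAddCommGroup (V i)] [∀ i, NormedSpace ℝ (V i)]
  {E : ∀ i, M i → Type*} [∀ i x, AddCommGroup (E i x)] [∀ i x, Module ℝ (E i x)]
  [∀ i x, TopologicalSpace (E i x)] [∀ i, TopologicalSpace (TotalSpace (V i) (E i))]
  [∀ i, FiberBundle (V i) (E i)] [∀ i, VectorBundle ℝ (V i) (E i)]
  {A : ∀ i, BanachLieAlgebroid (B i) (V i) (E i)}
  {δ : ∀ i j, i ≤ j → M j → M i} {lB : ∀ i j, i ≤ j → B j →L[ℝ] B i}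
  {lV : ∀ i j, i ≤ j → V j →L[ℝ] V i}
  {f : ∀ i j (h : i ≤ j) (x : M j), E j x →L[ℝ] E i (δ i j h x)}

/-- Differentiate `φ i ∘ δ = lB ∘ φ j` and insert the compatibility of the anchors with the tangent
map of `δ`. Hence the coordinates of the `ρ_i (v_i)` form a thread, which makes the limit anchor
possible. -/
theorem IsStrongProjAlgebroid.anchorCoord_totalMap (hsys : IsStrongProjAlgebroid A δ lB lV f)
    {φ : ∀ i, OpenPartialHomeomorph (M i) (B i)} (hφ : IsProjChart δ lB φ) {i j : ℕ} (h : i ≤ j)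
    {p : TotalSpace (V j) (E j)} (hp : p.1 ∈ (φ j).source) :
    (A i).anchorCoord (φ i) (totalMap V δ f i j h p) =
      lB i j h ((A j).anchorCoord (φ j) p) := by
  have hδ : MDifferentiableAt 𝓘(ℝ, B j) 𝓘(ℝ, B i) (δ i j h) p.1 :=
    (hsys.base.smooth i j h).mdifferentiable (by simp) p.1
  have hφi : MDifferentiableAt 𝓘(ℝ, B i) 𝓘(ℝ, B i) (φ i) (δ i j h p.1) :=
    (contMDiffAt_of_mem_maximalAtlas (hφ.mem i) (hφ.mapsTo i j h hp)).mdifferentiableAt (by simp)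
  have hφj : MDifferentiableAt 𝓘(ℝ, B j) 𝓘(ℝ, B j) (φ j) p.1 :=
    (contMDiffAt_of_mem_maximalAtlas (hφ.mem j) hp).mdifferentiableAt (by simp)
  have hl : MDifferentiableAt 𝓘(ℝ, B j) 𝓘(ℝ, B i) (lB i j h) (φ j p.1) :=
    (lB i j h).contMDiff.mdifferentiable (n := 1) one_ne_zero _
  have heq : φ i ∘ δ i j h =ᶠ[𝓝 p.1] lB i j h ∘ φ j := by
    filter_upwards [(φ j).open_source.mem_nhds hp] with y hy using hφ.coherent i j h y hy
  have h1 := heq.mfderiv_eq (I := 𝓘(ℝ, B j)) (I' := 𝓘(ℝ, B i))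
  rw [mfderiv_comp _ hφi hδ, mfderiv_comp _ hl hφj] at h1
  have h2 := congrArg (fun L => (L ((A j).anchor p.1 p.2) : B i)) h1
  have h3 : mfderiv 𝓘(ℝ, B j) 𝓘(ℝ, B i) (lB i j h) (φ j p.1) = lB i j h := by
    rw [mfderiv_eq_fderiv]
    exact (lB i j h).fderiv
  rw [h3] at h2
  refine Eq.trans ?_ h2
  rw [BanachLieAlgebroid.anchorCoord, totalMap, hsys.anchor_comp]
  rfl

/-- The coordinate of `ρ(v)` in the chart `lim φ_i`. -/
def IsStrongProjAlgebroid.limCoord (hsys : IsStrongProjAlgebroid A δ lB lV f)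
    {φ : ∀ i, OpenPartialHomeomorph (M i) (B i)} (hφ : IsProjChart δ lB φ) {x : ProjLim δ}
    (hx : ∀ i, x.1 i ∈ (φ i).source) (v : LimBundle V δ f x) : linLim lB :=
  ⟨fun i => (A i).anchorCoord (φ i) (limComp V i v), fun i j h => by
    rw [← hsys.anchorCoord_totalMap hφ h (hx j), totalMap_limComp]⟩

variable [ChartedSpace (linLim lB) (ProjLim δ)]
  (hsys : IsStrongProjAlgebroid A δ lB lV f)
  (hat : atlas (linLim lB) (ProjLim δ) = limCharts δ lB)

/-- The anchor `lim ρ_i`. -/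
def limAnchor (x : ProjLim δ) : LimBundle V δ f x →ₗ[ℝ] Tangent (linLim lB) x where
  toFun v := hsys.limCoord (isLimChart_of_mem hat (chart_mem_atlas _ x)).choose_spec.proj
    ((isLimChart_of_mem hat (chart_mem_atlas _ x)).choose_spec.mem_source
      (mem_chart_source _ x)) v
  map_add' v w := by
    refine linLim_ext fun i => ?_
    change mfderiv _ _ _ _ ((A i).anchor _ (v.1 i + w.1 i)) = _
    rw [map_add, map_add]
    rfl
  map_smul' a v := by
    refine linLim_ext fun i => ?_
    change mfderiv _ _ _ _ ((A i).anchor _ (a • v.1 i)) = _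
    rw [map_smul, map_smul]
    rfl

/-- The derivative of a function of `x_i` in the direction of `ρ(v)`. -/
theorem hasDerivAt_chartLine_limAnchor {G : Type*} [NormedAddCommGroup G] [NormedSpace ℝ G]
    {x : ProjLim δ} (v : LimBundle V δ f x) (i : ℕ) {k : M i → G}
    (hk : MDifferentiableAt 𝓘(ℝ, B i) 𝓘(ℝ, G) k (x.1 i)) :
    HasDerivAt (fun t => k ((chartLine x (limAnchor hsys hat x v) t).1 i))
      (mfderiv 𝓘(ℝ, B i) 𝓘(ℝ, G) k (x.1 i) ((A i).anchor (x.1 i) (v.1 i)) : G) 0 := by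
  have he := chart_mem_atlas (linLim lB) x
  obtain ⟨φ, hφ, hva⟩ : ∃ φ, ∃ hφ : IsLimChart δ lB φ (chartAt (linLim lB) x),
      limAnchor hsys hat x v =
        hsys.limCoord hφ.proj (hφ.mem_source (mem_chart_source _ x)) v :=
    ⟨_, (isLimChart_of_mem hat he).choose_spec, rfl⟩
  have h1 := hasDerivAt_comp_chart_line (hφ.proj.mem i) (hφ.mem_source (mem_chart_source _ x) i)
    ((A i).anchor (x.1 i) (v.1 i)) hk
  refine h1.congr_of_eventuallyEq ?_
  rw [hva]
  filter_upwards [eventually_line_mem (chartAt (linLim lB) x).open_target (mem_chart_target _ x)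
    (hsys.limCoord hφ.proj (hφ.mem_source (mem_chart_source _ x)) v)] with t ht
  have h2 := hφ.symm_apply ht i
  refine congrArg k (h2.trans ?_)
  refine congrArg (φ i).symm ?_
  exact congrArg (· + t • (A i).anchorCoord (φ i) (limComp V i v))
    (hφ.apply x (mem_chart_source _ x) i)

/-- The anchor is defined through the preferred chart; here its coordinate has the same
componentwise expression in every limit chart, which gives its smoothness. -/
theorem tangentCoord_limAnchor {φ : ∀ i, OpenPartialHomeomorph (M i) (B i)}
    {e : OpenPartialHomeomorph (ProjLim δ) (linLim lB)} (hφ : IsLimChart δ lB φ e)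
    {x : ProjLim δ} (hx : x ∈ e.source) (v : LimBundle V δ f x) :
    tangentCoord e x (limAnchor hsys hat x v) = hsys.limCoord hφ.proj (hφ.mem_source hx) v := by
  refine diff_linLim_eq_of_hasDerivAt fun i => ?_
  have h1 := hasDerivAt_chartLine_limAnchor hsys hat v i
    ((contMDiffAt_of_mem_maximalAtlas (hφ.proj.mem i) (hφ.mem_source hx i)).mdifferentiableAt
      (by simp))
  refine h1.congr_of_eventuallyEq ?_
  have hU : IsOpen ((chartAt (linLim lB) x).target ∩ (chartAt (linLim lB) x).symm ⁻¹' e.source) :=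
    (chartAt (linLim lB) x).isOpen_inter_preimage_symm e.open_source
  have hxU : chartAt (linLim lB) x x ∈
      (chartAt (linLim lB) x).target ∩ (chartAt (linLim lB) x).symm ⁻¹' e.source :=
    ⟨mem_chart_target _ x, by
      rw [mem_preimage, (chartAt (linLim lB) x).left_inv (mem_chart_source _ x)]; exact hx⟩
  filter_upwards [eventually_line_mem hU hxU (limAnchor hsys hat x v)] with t ht
  exact hφ.apply _ ht.2 i

theorem tangentMap_limAnchor {x : ProjLim δ} (v : LimBundle V δ f x) (i : ℕ) :
    Convenient.tangentMap (G := B i) (fun y : ProjLim δ => y.1 i) x (limAnchor hsys hat x v) =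
      (A i).anchor (x.1 i) (v.1 i) := by
  have h1 := hasDerivAt_chartLine_limAnchor hsys hat v i
    ((contMDiffAt_of_mem_maximalAtlas (IsManifold.chart_mem_maximalAtlas (I := 𝓘(ℝ, B i)) (n := ∞)
      (x.1 i)) (mem_chart_source _ (x.1 i))).mdifferentiableAt (by simp))
  have h2 : diff (fun y : linLim lB =>
      chartAt (B i) (x.1 i) (((chartAt (linLim lB) x).symm y).1 i)) (chartAt (linLim lB) x x)
      (limAnchor hsys hat x v) =
        chartCoord (chartAt (B i) (x.1 i)) (x.1 i) ((A i).anchor (x.1 i) (v.1 i)) :=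
    diff_eq_of_hasDerivAt h1
  exact h2.trans (chartCoord_chartAt (x.1 i) _)

theorem tangentAct_limAnchor_comp {x : ProjLim δ} (v : LimBundle V δ f x) {i : ℕ} {k : M i → ℝ}
    (hk : MDifferentiableAt 𝓘(ℝ, B i) 𝓘(ℝ, ℝ) k (x.1 i)) :
    tangentAct (limAnchor hsys hat x v) (fun y => k (y.1 i)) =
      dirDeriv (B i) ((A i).anchor (x.1 i) (v.1 i)) k :=
  tangentAct_eq_of_hasDerivAt (hasDerivAt_chartLine_limAnchor hsys hat v i hk)

theorem smoothCurve_tangentCoord_limAnchor {φ : ∀ i, OpenPartialHomeomorph (M i) (B i)}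
    {e : OpenPartialHomeomorph (ProjLim δ) (linLim lB)} (hφ : IsLimChart δ lB φ e)
    {γ : ℝ → ProjLim δ} (hγ : ∀ t, γ t ∈ e.source) {w : ∀ t, LimBundle V δ f (γ t)}
    (hw : ∀ i, ContMDiff 𝓘(ℝ, ℝ) (𝓘(ℝ, B i).prod 𝓘(ℝ, V i)) ∞ (fun t => limComp V i (w t))) :
    SmoothCurve (fun t => tangentCoord e (γ t) (limAnchor hsys hat (γ t) (w t))) := by
  refine smoothCurve_linLim_iff.2 fun i => ?_
  have h1 : (fun t => (tangentCoord e (γ t) (limAnchor hsys hat (γ t) (w t))).1 i) =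
      fun t => (A i).anchorCoord (φ i) (limComp V i (w t)) := by
    funext t
    rw [tangentCoord_limAnchor hsys hat hφ (hγ t)]
    rfl
  rw [h1, ← contMDiff_iff_contDiff, ← contMDiffOn_univ]
  exact ((A i).contMDiffOn_anchorCoord (hφ.proj.mem i)).comp (hw i).contMDiffOn
    fun t _ => hφ.mem_source (hγ t) i

variable [FiberBundle (linLim lV) (LimBundle V δ f)]
  [∀ i, CompleteSpace (V i)]

theorem smoothOn_limAnchor
    (htr : FiberBundle.trivializationAtlas (linLim lV) (LimBundle V δ f) = limTrivs B δ lV f)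
    {T : Trivialization (linLim lV) (π (linLim lV) (LimBundle V δ f))}
    (hT : T ∈ FiberBundle.trivializationAtlas (linLim lV) (LimBundle V δ f))
    {e : OpenPartialHomeomorph (ProjLim δ) (linLim lB)} (he : e ∈ atlas (linLim lB) (ProjLim δ)) :
    SmoothOn
      (fun p : linLim lB × linLim lV => tangentCoord e (e.symm p.1)
        (limAnchor hsys hat (e.symm p.1) (T.symm (e.symm p.1) p.2)))
      {p | p.1 ∈ e.target ∧ e.symm p.1 ∈ T.baseSet} := by
  intro c hc hcU
  obtain ⟨φ, hφ⟩ := isLimChart_of_mem hat he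
  obtain ⟨τ, hτ⟩ := isLimTriv_of_mem htr hT
  obtain ⟨hc1, hc2⟩ := smoothCurve_prod_iff.1 hc
  exact smoothCurve_tangentCoord_limAnchor hsys hat hφ (fun t => e.map_target (hcU t).1)
    (hτ.contMDiff_symm (hφ.smoothPath_symm hc1 fun t => (hcU t).1) (fun t => (hcU t).2)
      (smoothCurve_linLim_iff.1 hc2))

theorem smoothField_limAnchor
    (htr : FiberBundle.trivializationAtlas (linLim lV) (LimBundle V δ f) = limTrivs B δ lV f)
    {σ : ∀ x, LimBundle V δ f x}
    (hσ : IsSmoothSection (linLim lB) (linLim lV) σ) :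
    SmoothField (fun x => limAnchor hsys hat x (σ x)) := by
  intro e he c hc hcU
  obtain ⟨φ, hφ⟩ := isLimChart_of_mem hat he
  exact smoothCurve_tangentCoord_limAnchor hsys hat hφ (fun t => e.map_target (hcU t))
    ((isSmoothSection_iff hat htr).1 hσ _ (hφ.smoothPath_symm hc hcU))

end LimAnchor

/-! ### Derivatives of forms along curves -/

section FormDerivatives

theorem hasDerivAt_zero_iff {X : Type*} [NormedAddCommGroup X] [NormedSpace ℝ X] {F : ℝ → X}
    {F' : X} (h0 : F 0 = 0) :
    HasDerivAt F F' 0 ↔ Tendsto (fun t : ℝ => t⁻¹ • F t) (𝓝[≠] 0) (𝓝 F') := by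
  rw [hasDerivAt_iff_tendsto_slope_zero]
  simp only [zero_add, h0, sub_zero]

/-- A `1`-form as a linear map. -/
def oneFormLinear {W : Type*} [AddCommGroup W] [Module ℝ W] [TopologicalSpace W]
    (θ : W [⋀^Fin 1]→L[ℝ] ℝ) : W →ₗ[ℝ] ℝ where
  toFun v := θ (fun _ => v)
  map_add' v w := by
    have h := θ.map_update_add (fun _ => 0) 0 v w
    have e : ∀ u : W, Function.update (fun _ : Fin 1 => (0 : W)) 0 u = fun _ => u := fun u =>
      funext fun i => by rw [Subsingleton.elim i 0, Function.update_self]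
    simpa only [e] using h
  map_smul' c v := by
    have h := θ.map_update_smul (fun _ => 0) 0 c v
    have e : ∀ u : W, Function.update (fun _ : Fin 1 => (0 : W)) 0 u = fun _ => u := fun u =>
      funext fun i => by rw [Subsingleton.elim i 0, Function.update_self]
    rw [e, e] at h
    exact h

theorem oneFormLinear_apply {W : Type*} [AddCommGroup W] [Module ℝ W] [TopologicalSpace W]
    (θ : W [⋀^Fin 1]→L[ℝ] ℝ) (v : W) : oneFormLinear θ v = θ (fun _ => v) :=
  rfl

/-- A `2`-form as a linear map of its first argument. -/
def twoFormLinear {W : Type*} [AddCommGroup W] [Module ℝ W] [TopologicalSpace W]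
    (η : W [⋀^Fin 2]→L[ℝ] ℝ) (w : W) : W →ₗ[ℝ] ℝ where
  toFun v := η ![v, w]
  map_add' u v := by
    have h := η.map_update_add ![0, w] 0 u v
    have e : ∀ u : W, Function.update ![0, w] 0 u = ![u, w] := fun u => by
      funext i; fin_cases i <;> rfl
    rw [e, e, e] at h
    exact h
  map_smul' c v := by
    have h := η.map_update_smul ![0, w] 0 c v
    have e : ∀ u : W, Function.update ![0, w] 0 u = ![u, w] := fun u => by
      funext i; fin_cases i <;> rfl
    rw [e, e] at h
    exact h

theorem twoFormLinear_apply {W : Type*} [AddCommGroup W] [Module ℝ W] [TopologicalSpace W]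
    (η : W [⋀^Fin 2]→L[ℝ] ℝ) (v w : W) : twoFormLinear η w v = η ![v, w] :=
  rfl

variable {B : Type*} [NormedAddCommGroup B] [NormedSpace ℝ B]
  {M : Type*} [TopologicalSpace M] [ChartedSpace B M]
  {V : Type*} [NormedAddCommGroup V] [NormedSpace ℝ V]
  {E : M → Type*} [∀ x, AddCommGroup (E x)] [∀ x, Module ℝ (E x)]
  [∀ x, TopologicalSpace (E x)] [TopologicalSpace (TotalSpace V E)] [FiberBundle V E]
  [VectorBundle ℝ V E]

/-- If the vectors `a t` and `b t` over the point `m t` agree at `t = 0`, the derivative of the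
difference of the values of a `1`-form is the value at the derivative of `a - b`. -/
theorem IsTotalSmooth.hasDerivAt_sub {θ : ∀ x, E x [⋀^Fin 1]→L[ℝ] ℝ} (hθ : IsTotalSmooth B V θ)
    {x₀ : M} {m : ℝ → M} (hm : ContinuousAt m 0) (hm0 : m 0 = x₀) {a b : ∀ t, E (m t)} {Z : V}
    (hZ : HasDerivAt (fun t => (trivializationAt V E x₀ ⟨m t, a t⟩).2 -
      (trivializationAt V E x₀ ⟨m t, b t⟩).2) Z 0) (h0 : a 0 = b 0) :
    HasDerivAt (fun t => θ (m t) (fun _ => a t) - θ (m t) (fun _ => b t))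
      (θ x₀ (fun _ => (trivializationAt V E x₀).symmL ℝ x₀ Z)) 0 := by
  set T := trivializationAt V E x₀ with hT
  have hx₀ : x₀ ∈ T.baseSet := mem_baseSet_trivializationAt V E x₀
  set D : ℝ → V := fun t => (T ⟨m t, a t⟩).2 - (T ⟨m t, b t⟩).2 with hD
  have hD0 : D 0 = 0 := by simp only [hD, h0, sub_self]
  have hbase : ∀ᶠ t in 𝓝 (0 : ℝ), m t ∈ T.baseSet :=
    hm.preimage_mem_nhds (T.open_baseSet.mem_nhds (hm0 ▸ hx₀))
  -- By linearity the difference quotient is `θ` evaluated at the vector with coordinate `t⁻¹ • D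
  -- t`. The limit then uses only the continuity of `θ` on the total space, and no derivative of `θ`
  -- appears because `D 0 = 0`.
  have hval : ∀ t, m t ∈ T.baseSet → ∀ c : ℝ,
      c * (θ (m t) (fun _ => a t) - θ (m t) (fun _ => b t)) =
        θ (m t) (fun _ => T.symmL ℝ (m t) (c • D t)) := by
    intro t ht c
    rw [← oneFormLinear_apply, ← oneFormLinear_apply, ← oneFormLinear_apply, ← map_sub,
      ← smul_eq_mul, ← map_smul, map_smul (T.symmL ℝ (m t)), hD, map_sub,
      trivializationAt_symmL_apply ht, trivializationAt_symmL_apply ht]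
  have hF : ∀ y ∈ T.baseSet, ∀ z : V, θ y (fun _ => T.symmL ℝ y z) =
      (fun p : TotalSpace V E => θ p.1 (fun _ => p.2)) (T.toOpenPartialHomeomorph.symm (y, z)) := by
    intro y hy z
    rw [← T.mk_symm hy]
    simp only [Trivialization.symmL_apply (R := ℝ) _ hy]
  rw [hasDerivAt_zero_iff (by rw [h0, sub_self])]
  have hcont : ContinuousAt (fun q : M × V => (fun p : TotalSpace V E => θ p.1 (fun _ => p.2))
      (T.toOpenPartialHomeomorph.symm q)) (x₀, Z) :=
    (ContMDiff.continuous hθ).continuousAt.comp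
      (T.toOpenPartialHomeomorph.continuousAt_symm (T.mem_target.2 hx₀))
  have hlim : Tendsto (fun t : ℝ => (m t, t⁻¹ • D t)) (𝓝[≠] 0) (𝓝 (x₀, Z)) := by
    refine (hm0 ▸ hm.tendsto.mono_left nhdsWithin_le_nhds).prodMk_nhds ?_
    exact (hasDerivAt_zero_iff hD0).1 hZ
  rw [hF x₀ hx₀]
  refine (hcont.tendsto.comp hlim).congr' ?_
  filter_upwards [nhdsWithin_le_nhds hbase] with t ht
  rw [smul_eq_mul, hval t ht, hF _ ht]
  rfl

/-- The derivative of the difference of the values of a `2`-form at pairs of vectors which agree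
at `t = 0`. -/
theorem IsSmoothForm.hasDerivAt_sub {η : ∀ x, E x [⋀^Fin 2]→L[ℝ] ℝ} (hη : IsSmoothForm B V η)
    {x₀ : M} {m : ℝ → M} (hm : ContinuousAt m 0) (hm0 : m 0 = x₀) {a b c d : ∀ t, E (m t)}
    {Z Z' : V}
    (hZ : HasDerivAt (fun t => (trivializationAt V E x₀ ⟨m t, a t⟩).2 -
      (trivializationAt V E x₀ ⟨m t, b t⟩).2) Z 0)
    (hZ' : HasDerivAt (fun t => (trivializationAt V E x₀ ⟨m t, c t⟩).2 -
      (trivializationAt V E x₀ ⟨m t, d t⟩).2) Z' 0)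
    (hb : ContinuousAt (fun t => (trivializationAt V E x₀ ⟨m t, b t⟩).2) 0)
    (hc : ContinuousAt (fun t => (trivializationAt V E x₀ ⟨m t, c t⟩).2) 0)
    (h0 : a 0 = b 0) (h0' : c 0 = d 0) {u w : E x₀}
    (hu : (⟨m 0, a 0⟩ : TotalSpace V E) = ⟨x₀, u⟩) (hw : (⟨m 0, c 0⟩ : TotalSpace V E) = ⟨x₀, w⟩) :
    HasDerivAt (fun t => η (m t) ![a t, c t] - η (m t) ![b t, d t])
      (η x₀ ![(trivializationAt V E x₀).symmL ℝ x₀ Z, w] +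
        η x₀ ![u, (trivializationAt V E x₀).symmL ℝ x₀ Z']) 0 := by
  set T := trivializationAt V E x₀ with hT
  have hx₀ : x₀ ∈ T.baseSet := mem_baseSet_trivializationAt V E x₀
  have hbase : ∀ᶠ t in 𝓝 (0 : ℝ), m t ∈ T.baseSet :=
    hm.preimage_mem_nhds (T.open_baseSet.mem_nhds (hm0 ▸ hx₀))
  set H : M → V [⋀^Fin 2]→L[ℝ] ℝ := fun x => (η x).compContinuousLinearMap (T.symmL ℝ x) with hH
  have hHc : ContinuousAt (fun t => H (m t)) 0 := by
    have h1 : ContinuousAt H (m 0) :=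
      (hη x₀).continuousOn.continuousAt (T.open_baseSet.mem_nhds (hm0 ▸ hx₀))
    exact ContinuousAt.comp h1 hm
  have hHη : ∀ y ∈ T.baseSet, ∀ v w : E y, η y ![v, w] = H y ![(T ⟨y, v⟩).2, (T ⟨y, w⟩).2] := by
    intro y hy v w
    simp only [hH, ContinuousAlternatingMap.compContinuousLinearMap_apply]
    congr 1
    funext k
    fin_cases k
    · exact (trivializationAt_symmL_apply hy v).symm
    · exact (trivializationAt_symmL_apply hy w).symm
  have hHapply : ∀ y v w, H y ![v, w] = η y ![T.symmL ℝ y v, T.symmL ℝ y w] := by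
    intro y v w
    simp only [hH, ContinuousAlternatingMap.compContinuousLinearMap_apply]
    congr 1
    funext k
    fin_cases k <;> rfl
  have hev : ∀ {p q : ℝ → V} {P Q : V}, Tendsto p (𝓝[≠] 0) (𝓝 P) → Tendsto q (𝓝[≠] 0) (𝓝 Q) →
      Tendsto (fun t => H (m t) ![p t, q t]) (𝓝[≠] 0) (𝓝 (H x₀ ![P, Q])) := by
    intro p q P Q hp hq
    have h1 : Tendsto (fun t => ![p t, q t]) (𝓝[≠] 0) (𝓝 ![P, Q]) := by
      refine tendsto_pi_nhds.2 fun k => ?_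
      fin_cases k
      · exact hp
      · exact hq
    have h2 : Tendsto (fun t => H (m t)) (𝓝[≠] 0) (𝓝 (H x₀)) :=
      hm0 ▸ hHc.tendsto.mono_left nhdsWithin_le_nhds
    exact h2.eval h1
  -- The telescoping `φ(p, q) - φ(p', q') = φ(p - p', q) + φ(p', q - q')`, so that the two scaled
  -- differences converge separately.
  have hlin : ∀ (φ : V [⋀^Fin 2]→L[ℝ] ℝ) (r : ℝ) (p q p' q' : V),
      φ ![r • (p - p'), q] + φ ![p', r • (q - q')] = r * (φ ![p, q] - φ ![p', q']) := by
    intro φ r p q p' q'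
    rw [alternating_two_swap φ p' (r • (q - q')), ← twoFormLinear_apply, ← twoFormLinear_apply,
      map_smul, map_smul, map_sub, map_sub, twoFormLinear_apply, twoFormLinear_apply,
      twoFormLinear_apply, twoFormLinear_apply, alternating_two_swap φ q p',
      alternating_two_swap φ q' p']
    simp only [smul_eq_mul]
    ring
  have hslope : ∀ {e e' : ∀ t, E (m t)} {Y : V}, e 0 = e' 0 →
      HasDerivAt (fun t => (T ⟨m t, e t⟩).2 - (T ⟨m t, e' t⟩).2) Y 0 →
      Tendsto (fun t : ℝ => t⁻¹ • ((T ⟨m t, e t⟩).2 - (T ⟨m t, e' t⟩).2)) (𝓝[≠] 0) (𝓝 Y) := by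
    intro e e' Y h hY
    exact (hasDerivAt_zero_iff (by rw [h, sub_self])).1 hY
  have hb0 : (T ⟨m 0, b 0⟩).2 = (T ⟨x₀, u⟩).2 := by rw [← hu, h0]
  have hc0 : (T ⟨m 0, c 0⟩).2 = (T ⟨x₀, w⟩).2 := by rw [← hw]
  have h1 := hev (hslope h0 hZ) (hc0 ▸ hc.tendsto.mono_left nhdsWithin_le_nhds)
  have h2 := hev (hb0 ▸ hb.tendsto.mono_left nhdsWithin_le_nhds) (hslope h0' hZ')
  have h3 := h1.add h2
  rw [hHapply, hHapply, trivializationAt_symmL_apply hx₀, trivializationAt_symmL_apply hx₀] at h3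
  rw [hasDerivAt_zero_iff (by rw [h0, h0', sub_self])]
  refine h3.congr' ?_
  filter_upwards [nhdsWithin_le_nhds hbase] with t ht
  rw [smul_eq_mul, hHη _ ht, hHη _ ht, hlin]

end FormDerivatives

/-! ### Forms evaluated on sections of the limit bundle -/

section LimEvaluation

open Convenient

variable {B : ℕ → Type*} [∀ i, NormedAddCommGroup (B i)] [∀ i, NormedSpace ℝ (B i)]
  [∀ i, CompleteSpace (B i)]
  {M : ℕ → Type*} [∀ i, TopologicalSpace (M i)] [∀ i, ChartedSpace (B i) (M i)]
  [∀ i, IsManifold 𝓘(ℝ, B i) ∞ (M i)]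
  {V : ℕ → Type*} [∀ i, NormedAddCommGroup (V i)] [∀ i, NormedSpace ℝ (V i)]
  [∀ i, CompleteSpace (V i)]
  {E : ∀ i, M i → Type*} [∀ i x, AddCommGroup (E i x)] [∀ i x, Module ℝ (E i x)]
  [∀ i x, TopologicalSpace (E i x)] [∀ i, TopologicalSpace (TotalSpace (V i) (E i))]
  [∀ i, FiberBundle (V i) (E i)] [∀ i, VectorBundle ℝ (V i) (E i)]
  [∀ i, ContMDiffVectorBundle ∞ (V i) (E i) 𝓘(ℝ, B i)]
  {A : ∀ i, BanachLieAlgebroid (B i) (V i) (E i)}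
  {δ : ∀ i j, i ≤ j → M j → M i} {lB : ∀ i j, i ≤ j → B j →L[ℝ] B i}
  {lV : ∀ i j, i ≤ j → V j →L[ℝ] V i}
  {f : ∀ i j (h : i ≤ j) (x : M j), E j x →L[ℝ] E i (δ i j h x)}
  [ChartedSpace (linLim lB) (ProjLim δ)] [FiberBundle (linLim lV) (LimBundle V δ f)]

/-- The coordinate line is meaningful only while it stays in the chart; squashing gives a path
defined for all times with the same germ. -/
theorem exists_smoothPath_chartLine (hat : atlas (linLim lB) (ProjLim δ) = limCharts δ lB)
    (x : ProjLim δ) (a : Tangent (linLim lB) x) :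
    ∃ γ : ℝ → ProjLim δ, SmoothPath B γ ∧ ∀ᶠ t in 𝓝 0, γ t = chartLine x a t := by
  obtain ⟨φ, hφ⟩ := isLimChart_of_mem hat (chart_mem_atlas (linLim lB) x)
  obtain ⟨u, hu⟩ : ∃ u : linLim lB, u = a := ⟨a, rfl⟩
  obtain ⟨s, hs, hsU, hse⟩ := exists_squash (0 : ℝ)
    (eventually_line_mem (chartAt (linLim lB) x).open_target (mem_chart_target _ x) u)
  refine ⟨fun t => (chartAt (linLim lB) x).symm (chartAt (linLim lB) x x + s t • u),
    hφ.smoothPath_symm (smoothCurve_linLim_iff.2 fun i => (contDiff_line _ u i).comp hs) hsU, ?_⟩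
  filter_upwards [hse] with t ht
  rw [ht, hu]
  rfl

/-- The value of a `1`-form on `E_i` on the components of a section of `lim E_i`. -/
def evalOne (i : ℕ) (θ : ∀ x, E i x [⋀^Fin 1]→L[ℝ] ℝ) (σ : ∀ x, LimBundle V δ f x)
    (y : ProjLim δ) : ℝ :=
  θ (y.1 i) (fun _ => (σ y).1 i)

/-- The value of a `2`-form on `E_i` on the components of two sections of `lim E_i`. -/
def evalTwo (i : ℕ) (η : ∀ x, E i x [⋀^Fin 2]→L[ℝ] ℝ) (σ τ : ∀ x, LimBundle V δ f x)
    (y : ProjLim δ) : ℝ :=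
  η (y.1 i) ![(σ y).1 i, (τ y).1 i]

variable {i : ℕ} {θ : ∀ x, E i x [⋀^Fin 1]→L[ℝ] ℝ} {η : ∀ x, E i x [⋀^Fin 2]→L[ℝ] ℝ}
  {σ τ : ∀ x, LimBundle V δ f x}

theorem smoothFun_evalOne (hat : atlas (linLim lB) (ProjLim δ) = limCharts δ lB)
    (htr : FiberBundle.trivializationAtlas (linLim lV) (LimBundle V δ f) = limTrivs B δ lV f)
    (hθ : IsTotalSmooth (B i) (V i) θ) (hσ : IsSmoothSection (linLim lB) (linLim lV) σ) :
    SmoothFun (linLim lB) (evalOne i θ σ) :=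
  (smoothFun_iff hat).2 fun γ hγ => contMDiff_iff_contDiff.1
    (ContMDiff.comp hθ ((isSmoothSection_iff hat htr).1 hσ γ hγ i))

theorem smoothFun_evalTwo (hat : atlas (linLim lB) (ProjLim δ) = limCharts δ lB)
    (htr : FiberBundle.trivializationAtlas (linLim lV) (LimBundle V δ f) = limTrivs B δ lV f)
    (hη : IsSmoothForm (B i) (V i) η) (hσ : IsSmoothSection (linLim lB) (linLim lV) σ)
    (hτ : IsSmoothSection (linLim lB) (linLim lV) τ) :
    SmoothFun (linLim lB) (evalTwo i η σ τ) := by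
  refine (smoothFun_iff hat).2 fun γ hγ => contMDiff_iff_contDiff.1 fun t => ?_
  have h := hη.contMDiffAt_apply (m := fun t => (γ t).1 i)
    (e := ![fun t => (σ (γ t)).1 i, fun t => (τ (γ t)).1 i]) ((hγ i) t) fun k => by
      fin_cases k
      · exact (isSmoothSection_iff hat htr).1 hσ γ hγ i t
      · exact (isSmoothSection_iff hat htr).1 hτ γ hγ i t
  refine h.congr_of_eventuallyEq (Eventually.of_forall fun r => ?_)
  change η _ _ = η _ _
  congr 1
  funext k
  fin_cases k <;> rfl

theorem contMDiffAt_limComp_chartLine (hat : atlas (linLim lB) (ProjLim δ) = limCharts δ lB)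
    (htr : FiberBundle.trivializationAtlas (linLim lV) (LimBundle V δ f) = limTrivs B δ lV f)
    (hσ : IsSmoothSection (linLim lB) (linLim lV) σ) (x : ProjLim δ) (a : Tangent (linLim lB) x)
    (i : ℕ) : ContMDiffAt 𝓘(ℝ, ℝ) (𝓘(ℝ, B i).prod 𝓘(ℝ, V i)) ∞
      (fun t => limComp V i (σ (chartLine x a t))) 0 := by
  obtain ⟨γ, hγ, hγx⟩ := exists_smoothPath_chartLine hat x a
  refine ((isSmoothSection_iff hat htr).1 hσ γ hγ i 0).congr_of_eventuallyEq ?_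
  filter_upwards [hγx] with t ht
  rw [ht]

theorem contMDiffAt_chartLine (hat : atlas (linLim lB) (ProjLim δ) = limCharts δ lB)
    (x : ProjLim δ) (a : Tangent (linLim lB) x) (i : ℕ) :
    ContMDiffAt 𝓘(ℝ, ℝ) 𝓘(ℝ, B i) ∞ (fun t => (chartLine x a t).1 i) 0 := by
  obtain ⟨γ, hγ, hγx⟩ := exists_smoothPath_chartLine hat x a
  refine (hγ i 0).congr_of_eventuallyEq ?_
  filter_upwards [hγx] with t ht
  rw [ht]

/-- The coordinates of the section `σ_i` along a coordinate line. -/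
def lineCoord (i : ℕ) (σ : ∀ x, LimBundle V δ f x) (x : ProjLim δ) (a : Tangent (linLim lB) x)
    (t : ℝ) : V i :=
  (trivializationAt (V i) (E i) (x.1 i) (limComp V i (σ (chartLine x a t)))).2

/-- The coordinates of the section `s` of `E_i` along a coordinate line. -/
def lineCoordBase (s : Cₛ^∞⟮𝓘(ℝ, B i); V i, E i⟯) (x : ProjLim δ) (a : Tangent (linLim lB) x)
    (t : ℝ) : V i :=
  (trivializationAt (V i) (E i) (x.1 i) ⟨(chartLine x a t).1 i, s ((chartLine x a t).1 i)⟩).2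

theorem differentiableAt_lineCoord (hat : atlas (linLim lB) (ProjLim δ) = limCharts δ lB)
    (htr : FiberBundle.trivializationAtlas (linLim lV) (LimBundle V δ f) = limTrivs B δ lV f)
    (hσ : IsSmoothSection (linLim lB) (linLim lV) σ) (x : ProjLim δ) (a : Tangent (linLim lB) x) :
    DifferentiableAt ℝ (lineCoord i σ x a) 0 := by
  have h := contMDiffAt_limComp_chartLine hat htr hσ x a i
  have hx : limComp V i (σ (chartLine x a 0)) ∈ (trivializationAt (V i) (E i) (x.1 i)).source := by
    rw [Trivialization.mem_source, chartLine_zero]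
    exact mem_baseSet_trivializationAt _ _ _
  have h2 := ((trivializationAt (V i) (E i) (x.1 i)).contMDiffAt_iff (f := fun t => limComp V i (σ (chartLine x a t)))
    (x₀ := (0 : ℝ)) hx).1 h
  have h3 : ContDiffAt ℝ ∞ (lineCoord i σ x a) 0 := h2.2.contDiffAt
  exact h3.differentiableAt (by simp)

theorem differentiableAt_lineCoordBase (hat : atlas (linLim lB) (ProjLim δ) = limCharts δ lB)
    (s : Cₛ^∞⟮𝓘(ℝ, B i); V i, E i⟯) (x : ProjLim δ) (a : Tangent (linLim lB) x) :
    DifferentiableAt ℝ (lineCoordBase s x a) 0 := by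
  have h := s.contMDiff.contMDiffAt.comp (0 : ℝ) (contMDiffAt_chartLine hat x a i)
  have hx : TotalSpace.mk' (V i) ((chartLine x a 0).1 i) (s ((chartLine x a 0).1 i)) ∈
      (trivializationAt (V i) (E i) (x.1 i)).source := by
    rw [Trivialization.mem_source, chartLine_zero]
    exact mem_baseSet_trivializationAt _ _ _
  have h2 := ((trivializationAt (V i) (E i) (x.1 i)).contMDiffAt_iff (f := fun t =>
      TotalSpace.mk' (V i) ((chartLine x a t).1 i) (s ((chartLine x a t).1 i)))
    (x₀ := (0 : ℝ)) hx).1 h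
  have h3 : ContDiffAt ℝ ∞ (lineCoordBase s x a) 0 := h2.2.contDiffAt
  exact h3.differentiableAt (by simp)

/-- The derivative at `x` of the difference of the section `σ_i` and the section `s` of `E_i`,
which agree at `x`. -/
def relDeriv (σ : ∀ x, LimBundle V δ f x) (s : Cₛ^∞⟮𝓘(ℝ, B i); V i, E i⟯) (x : ProjLim δ)
    (a : Tangent (linLim lB) x) : E i (x.1 i) :=
  (trivializationAt (V i) (E i) (x.1 i)).symmL ℝ (x.1 i)
    (deriv (fun t => lineCoord i σ x a t - lineCoordBase s x a t) 0)

theorem hasDerivAt_lineCoord_sub (hat : atlas (linLim lB) (ProjLim δ) = limCharts δ lB)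
    (htr : FiberBundle.trivializationAtlas (linLim lV) (LimBundle V δ f) = limTrivs B δ lV f)
    (hσ : IsSmoothSection (linLim lB) (linLim lV) σ) (s : Cₛ^∞⟮𝓘(ℝ, B i); V i, E i⟯)
    (x : ProjLim δ) (a : Tangent (linLim lB) x) :
    HasDerivAt (fun t => lineCoord i σ x a t - lineCoordBase s x a t)
      (deriv (fun t => lineCoord i σ x a t - lineCoordBase s x a t) 0) 0 :=
  ((differentiableAt_lineCoord hat htr hσ x a).sub
    (differentiableAt_lineCoordBase hat s x a)).hasDerivAt

theorem apply_chartLine_zero {x : ProjLim δ} (a : Tangent (linLim lB) x)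
    {s : Cₛ^∞⟮𝓘(ℝ, B i); V i, E i⟯} (hs : s (x.1 i) = (σ x).1 i) :
    (σ (chartLine x a 0)).1 i = s ((chartLine x a 0).1 i) := by
  have : ∀ y, y = x → (σ y).1 i = s (y.1 i) := by
    rintro _ rfl
    exact hs.symm
  exact this _ (chartLine_zero x a)

theorem limComp_chartLine_zero (σ : ∀ x, LimBundle V δ f x) (x : ProjLim δ)
    (a : Tangent (linLim lB) x) :
    limComp V i (σ (chartLine x a 0)) = ⟨x.1 i, (σ x).1 i⟩ := by
  rw [chartLine_zero]
  rfl

/-- Comparison of the derivatives of `θ(σ_i)` and of `θ(s)`. -/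
theorem tangentAct_evalOne (hsys : IsStrongProjAlgebroid A δ lB lV f)
    (hat : atlas (linLim lB) (ProjLim δ) = limCharts δ lB)
    (htr : FiberBundle.trivializationAtlas (linLim lV) (LimBundle V δ f) = limTrivs B δ lV f)
    (hθ : IsTotalSmooth (B i) (V i) θ) (hσ : IsSmoothSection (linLim lB) (linLim lV) σ)
    {x : ProjLim δ} {s : Cₛ^∞⟮𝓘(ℝ, B i); V i, E i⟯} (hs : s (x.1 i) = (σ x).1 i)
    (w : LimBundle V δ f x) :
    tangentAct (limAnchor hsys hat x w) (evalOne i θ σ) =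
      dirDeriv (B i) ((A i).anchor (x.1 i) (w.1 i)) (fun y => θ y (fun _ => s y)) +
        θ (x.1 i) (fun _ => relDeriv σ s x (limAnchor hsys hat x w)) := by
  set a := limAnchor hsys hat x w with ha
  have h1 := (smoothFun_evalOne hat htr hθ hσ).hasDerivAt_chartLine a
  have h2 := hasDerivAt_chartLine_limAnchor hsys hat w i
    (((hθ.contMDiff_section s).mdifferentiable (by simp)) (x.1 i))
  have h3 := hθ.hasDerivAt_sub (contMDiffAt_chartLine hat x a i).continuousAt
    (congrArg (fun y : ProjLim δ => y.1 i) (chartLine_zero x a))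
    (a := fun t => (σ (chartLine x a t)).1 i) (b := fun t => s ((chartLine x a t).1 i))
    (hasDerivAt_lineCoord_sub hat htr hσ s x a) (apply_chartLine_zero a hs)
  have h4 := h3.unique (h1.sub h2)
  rw [relDeriv, h4]
  exact (add_sub_cancel _ _).symm

/-- Comparison of the derivatives of `η(σ_i, τ_i)` and of `η(s, t)`. -/
theorem tangentAct_evalTwo (hsys : IsStrongProjAlgebroid A δ lB lV f)
    (hat : atlas (linLim lB) (ProjLim δ) = limCharts δ lB)
    (htr : FiberBundle.trivializationAtlas (linLim lV) (LimBundle V δ f) = limTrivs B δ lV f)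
    (hη : IsSmoothForm (B i) (V i) η) (hσ : IsSmoothSection (linLim lB) (linLim lV) σ)
    (hτ : IsSmoothSection (linLim lB) (linLim lV) τ)
    {x : ProjLim δ} {s t : Cₛ^∞⟮𝓘(ℝ, B i); V i, E i⟯} (hs : s (x.1 i) = (σ x).1 i)
    (ht : t (x.1 i) = (τ x).1 i) (w : LimBundle V δ f x) :
    tangentAct (limAnchor hsys hat x w) (evalTwo i η σ τ) =
      dirDeriv (B i) ((A i).anchor (x.1 i) (w.1 i)) (fun y => η y ![s y, t y]) +
        (η (x.1 i) ![relDeriv σ s x (limAnchor hsys hat x w), (τ x).1 i] +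
          η (x.1 i) ![(σ x).1 i, relDeriv τ t x (limAnchor hsys hat x w)]) := by
  set a := limAnchor hsys hat x w with ha
  have hst : ContMDiff 𝓘(ℝ, B i) 𝓘(ℝ, ℝ) ∞ (fun y => η y ![s y, t y]) := fun y => by
    have h := hη.contMDiffAt_apply (m := fun y => y)
      (e := ![fun y => s y, fun y => t y]) contMDiffAt_id fun k => by
        fin_cases k
        · exact s.contMDiff y
        · exact t.contMDiff y
    refine h.congr_of_eventuallyEq (Eventually.of_forall fun r => ?_)
    change η _ _ = η _ _
    congr 1
    funext k
    fin_cases k <;> rfl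
  have h1 := (smoothFun_evalTwo hat htr hη hσ hτ).hasDerivAt_chartLine a
  have h2 := hasDerivAt_chartLine_limAnchor hsys hat w i ((hst.mdifferentiable (by simp)) (x.1 i))
  have h3 := hη.hasDerivAt_sub (contMDiffAt_chartLine hat x a i).continuousAt
    (congrArg (fun y : ProjLim δ => y.1 i) (chartLine_zero x a))
    (a := fun r => (σ (chartLine x a r)).1 i) (b := fun r => s ((chartLine x a r).1 i))
    (c := fun r => (τ (chartLine x a r)).1 i) (d := fun r => t ((chartLine x a r).1 i))
    (hasDerivAt_lineCoord_sub hat htr hσ s x a) (hasDerivAt_lineCoord_sub hat htr hτ t x a)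
    (differentiableAt_lineCoordBase hat s x a).continuousAt
    (differentiableAt_lineCoord hat htr hτ x a).continuousAt
    (apply_chartLine_zero a hs) (apply_chartLine_zero a ht)
    (limComp_chartLine_zero σ x a) (limComp_chartLine_zero τ x a)
  have h4 := h3.unique (h1.sub h2)
  rw [relDeriv, relDeriv, h4]
  exact (add_sub_cancel _ _).symm

end LimEvaluation

/-! ### The bracket of sections of the limit bundle -/

section Separation

variable {B : Type*} [NormedAddCommGroup B] [NormedSpace ℝ B]
  {M : Type*} [TopologicalSpace M] [ChartedSpace B M] [IsManifold 𝓘(ℝ, B) ∞ M]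
  {V : Type*} [NormedAddCommGroup V] [NormedSpace ℝ V]
  {E : M → Type*} [∀ x, AddCommGroup (E x)] [∀ x, Module ℝ (E x)]
  [∀ x, TopologicalSpace (E x)] [TopologicalSpace (TotalSpace V E)] [FiberBundle V E]
  [VectorBundle ℝ V E] [ContMDiffVectorBundle ∞ V E 𝓘(ℝ, B)]

/-- Smooth `1`-forms separate the vectors of a fibre. -/
theorem SmoothlyRegular.eq_of_forall_form (hreg : SmoothlyRegular B M) {x : M} {v w : E x}
    (h : ∀ θ : ∀ x, E x [⋀^Fin 1]→L[ℝ] ℝ, IsSmoothForm B V θ →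
      θ x (fun _ => v) = θ x (fun _ => w)) : v = w := by
  have hx : x ∈ (trivializationAt V E x).baseSet := mem_baseSet_trivializationAt V E x
  obtain ⟨g, hg, hgx, C, hCU, hC, hgC⟩ :=
    hreg.exists_bump ((trivializationAt V E x).open_baseSet.mem_nhds hx)
  have hT : (trivializationAt V E x ⟨x, v⟩).2 = (trivializationAt V E x ⟨x, w⟩).2 := by
    refine (SeparatingDual.eq_iff_forall_dual_eq (R := ℝ)).2 fun l => ?_
    have h1 := h _ (isSmoothForm_dualForm (E := E) hg hC hCU hgC l)
    rw [dualForm_apply l (fun hn => absurd hx hn), dualForm_apply l (fun hn => absurd hx hn),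
      hgx.self_of_nhds, one_mul, one_mul] at h1
    exact h1
  rw [← trivializationAt_symmL_apply hx v, hT, trivializationAt_symmL_apply hx w]

end Separation

/-! ### Construction of the bracket by duality with 1-forms -/

section LimBracket

open Convenient

variable {B : ℕ → Type*} [∀ i, NormedAddCommGroup (B i)] [∀ i, NormedSpace ℝ (B i)]
  [∀ i, CompleteSpace (B i)]
  {M : ℕ → Type*} [∀ i, TopologicalSpace (M i)] [∀ i, ChartedSpace (B i) (M i)]
  [∀ i, IsManifold 𝓘(ℝ, B i) ∞ (M i)]
  {V : ℕ → Type*} [∀ i, NormedAddCommGroup (V i)] [∀ i, NormedSpace ℝ (V i)]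
  [∀ i, CompleteSpace (V i)]
  {E : ∀ i, M i → Type*} [∀ i x, AddCommGroup (E i x)] [∀ i x, Module ℝ (E i x)]
  [∀ i x, TopologicalSpace (E i x)] [∀ i, TopologicalSpace (TotalSpace (V i) (E i))]
  [∀ i, FiberBundle (V i) (E i)] [∀ i, VectorBundle ℝ (V i) (E i)]
  [∀ i, ContMDiffVectorBundle ∞ (V i) (E i) 𝓘(ℝ, B i)]
  {A : ∀ i, BanachLieAlgebroid (B i) (V i) (E i)}
  {δ : ∀ i j, i ≤ j → M j → M i} {lB : ∀ i j, i ≤ j → B j →L[ℝ] B i}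
  {lV : ∀ i j, i ≤ j → V j →L[ℝ] V i}
  {f : ∀ i j (h : i ≤ j) (x : M j), E j x →L[ℝ] E i (δ i j h x)}
  [ChartedSpace (linLim lB) (ProjLim δ)] [FiberBundle (linLim lV) (LimBundle V δ f)]

/-- Being a morphism includes the existence of differentials on the target, so the bonding map from
`E_i` to itself suffices. -/
theorem IsStrongProjAlgebroid.hasDifferentials (hsys : IsStrongProjAlgebroid A δ lB lV f) (i : ℕ) :
    (A i).HasDifferentials := fun q α hα => by
  obtain ⟨η, h1, h2, -⟩ := hsys.morphism i i le_rfl q α hα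
  exact ⟨η, h1, h2⟩

/-- The value at `x` of `ρ(σ) θ(τ_i) - ρ(τ) θ(σ_i) - η(σ_i, τ_i)`. -/
def bracketForm (hsys : IsStrongProjAlgebroid A δ lB lV f)
    (hat : atlas (linLim lB) (ProjLim δ) = limCharts δ lB) (i : ℕ)
    (θ : ∀ x, E i x [⋀^Fin 1]→L[ℝ] ℝ) (η : ∀ x, E i x [⋀^Fin 2]→L[ℝ] ℝ)
    (σ τ : ∀ x, LimBundle V δ f x) (x : ProjLim δ) : ℝ :=
  fieldAct (fun y => limAnchor hsys hat y (σ y)) (evalOne i θ τ) x -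
    fieldAct (fun y => limAnchor hsys hat y (τ y)) (evalOne i θ σ) x - evalTwo i η σ τ x

/-- The vector `w` of `E_i` is the component of the bracket `[σ, τ]` at `x`. -/
def IsBracketAt (hsys : IsStrongProjAlgebroid A δ lB lV f)
    (hat : atlas (linLim lB) (ProjLim δ) = limCharts δ lB) (i : ℕ)
    (σ τ : ∀ x, LimBundle V δ f x) (x : ProjLim δ) (w : E i (x.1 i)) : Prop :=
  ∀ (θ : ∀ x, E i x [⋀^Fin 1]→L[ℝ] ℝ) (η : ∀ x, E i x [⋀^Fin 2]→L[ℝ] ℝ),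
    IsTotalSmooth (B i) (V i) θ → (A i).IsExtDiff θ η →
      θ (x.1 i) (fun _ => w) = bracketForm hsys hat i θ η σ τ x

variable (hsys : IsStrongProjAlgebroid A δ lB lV f)
  (hat : atlas (linLim lB) (ProjLim δ) = limCharts δ lB)

section Pointwise

variable {i : ℕ} {σ τ : ∀ x, LimBundle V δ f x}

/-- The component of the bracket, in terms of sections of `E_i` with the same values at `x`. -/
theorem isBracketAt_formula
    (htr : FiberBundle.trivializationAtlas (linLim lV) (LimBundle V δ f) = limTrivs B δ lV f)
    (hσ : IsSmoothSection (linLim lB) (linLim lV) σ)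
    (hτ : IsSmoothSection (linLim lB) (linLim lV) τ) {x : ProjLim δ}
    {s t : Cₛ^∞⟮𝓘(ℝ, B i); V i, E i⟯} (hs : s (x.1 i) = (σ x).1 i) (ht : t (x.1 i) = (τ x).1 i) :
    IsBracketAt hsys hat i σ τ x ((A i).bracket s t (x.1 i) +
      relDeriv τ t x (limAnchor hsys hat x (σ x)) -
        relDeriv σ s x (limAnchor hsys hat x (τ x))) := by
  intro θ η hθ hd
  have h1 := (A i).isExtDiff_one_iff.1 hd s t (x.1 i)
  -- Replacing `σ_i`, `τ_i` by `s`, `t` in the two derivatives produces the `relDeriv` terms. The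
  -- rest is the formula for `dθ` on `s` and `t`, which yields `θ([s, t])`.
  rw [bracketForm, fieldAct_eq_tangentAct, fieldAct_eq_tangentAct,
    tangentAct_evalOne hsys hat htr hθ hτ ht, tangentAct_evalOne hsys hat htr hθ hσ hs, evalTwo,
    ← hs, ← ht, h1, BanachLieAlgebroid.act, BanachLieAlgebroid.act, ← oneFormLinear_apply,
    map_sub, map_add]
  simp only [oneFormLinear_apply]
  ring

theorem exists_isBracketAt (hreg : SmoothlyRegular (B i) (M i))
    (htr : FiberBundle.trivializationAtlas (linLim lV) (LimBundle V δ f) = limTrivs B δ lV f)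
    (hσ : IsSmoothSection (linLim lB) (linLim lV) σ)
    (hτ : IsSmoothSection (linLim lB) (linLim lV) τ) (x : ProjLim δ) :
    ∃ w, IsBracketAt hsys hat i σ τ x w := by
  obtain ⟨s, hs⟩ := hreg.exists_section (V := V i) (x.1 i) ((σ x).1 i)
  obtain ⟨t, ht⟩ := hreg.exists_section (V := V i) (x.1 i) ((τ x).1 i)
  exact ⟨_, isBracketAt_formula hsys hat htr hσ hτ hs ht⟩

variable {hsys hat} in
-- Uniqueness is phrased for points of the total space because the vectors to be compared lie over
-- `δ i j h (x.1 j)` and `x.1 i`, which are equal but not by definition.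
theorem IsBracketAt.eq_mk (hreg : SmoothlyRegular (B i) (M i)) {x : ProjLim δ}
    {w : E i (x.1 i)} (hw : IsBracketAt hsys hat i σ τ x w) {p : TotalSpace (V i) (E i)}
    (hp : p.1 = x.1 i)
    (h : ∀ θ : ∀ x, E i x [⋀^Fin 1]→L[ℝ] ℝ, IsSmoothForm (B i) (V i) θ →
      ∃ η, (A i).IsExtDiff θ η ∧
        θ p.1 (fun _ => p.2) = bracketForm hsys hat i θ η σ τ x) :
    p = ⟨x.1 i, w⟩ := by
  obtain ⟨y, v⟩ := p
  obtain rfl : y = x.1 i := hp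
  refine congrArg (TotalSpace.mk _) (hreg.eq_of_forall_form (V := V i) fun θ hθ => ?_)
  obtain ⟨η, h1, h2⟩ := h θ hθ
  rw [hw θ η hθ.isTotalSmooth h1]
  exact h2

theorem twoForm_totalMap {j : ℕ} (h : i ≤ j) (η : ∀ x, E i x [⋀^Fin 2]→L[ℝ] ℝ) {x : M j} {y : M i}
    {a b : E j x} {u w : E i y} (ha : totalMap V δ f i j h ⟨x, a⟩ = ⟨y, u⟩)
    (hb : totalMap V δ f i j h ⟨x, b⟩ = ⟨y, w⟩) :
    (η (δ i j h x)).compContinuousLinearMap (f i j h x) ![a, b] = η y ![u, w] := by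
  obtain rfl : δ i j h x = y := congrArg TotalSpace.proj ha
  have ha' : f i j h x a = u := (TotalSpace.mk_inj (F := V i)).1 ha
  have hb' : f i j h x b = w := (TotalSpace.mk_inj (F := V i)).1 hb
  rw [ContinuousAlternatingMap.compContinuousLinearMap_apply, ← ha', ← hb']
  congr 1
  funext k
  fin_cases k <;> rfl

theorem evalOne_pullback {j : ℕ} (h : i ≤ j) (θ : ∀ x, E i x [⋀^Fin 1]→L[ℝ] ℝ)
    (σ : ∀ x, LimBundle V δ f x) :
    evalOne j (fun x => (θ (δ i j h x)).compContinuousLinearMap (f i j h x)) σ =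
      evalOne i θ σ := by
  funext y
  exact congrArg (fun p : TotalSpace (V i) (E i) => θ p.1 (fun _ => p.2))
    (totalMap_limComp h (σ y))

theorem evalTwo_pullback {j : ℕ} (h : i ≤ j) (η : ∀ x, E i x [⋀^Fin 2]→L[ℝ] ℝ)
    (σ τ : ∀ x, LimBundle V δ f x) :
    evalTwo j (fun x => (η (δ i j h x)).compContinuousLinearMap (f i j h x)) σ τ =
      evalTwo i η σ τ :=
  funext fun y => twoForm_totalMap (V := V) h η (totalMap_limComp h (σ y))
    (totalMap_limComp h (τ y))

/-- The pull-back is a composition with a smooth map of total spaces. For this reason `IsBracketAt`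
tests on forms smooth on the total space: no operator-norm smoothness of the fibre maps is involved.
-/
theorem isTotalSmooth_pullback {j : ℕ} (h : i ≤ j) {θ : ∀ x, E i x [⋀^Fin 1]→L[ℝ] ℝ}
    (hE : IsStrongProjBundle B δ lV f) (hθ : IsTotalSmooth (B i) (V i) θ) :
    IsTotalSmooth (B j) (V j)
      (fun x => (θ (δ i j h x)).compContinuousLinearMap (f i j h x)) :=
  ContMDiff.comp hθ (hE.smooth i j h)

variable {hsys hat} in
/-- The components of the bracket are compatible with the bonding maps. -/
theorem IsBracketAt.totalMap_eq (hreg : SmoothlyRegular (B i) (M i)) {j : ℕ} (h : i ≤ j)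
    {x : ProjLim δ} {w : E i (x.1 i)} {w' : E j (x.1 j)} (hw : IsBracketAt hsys hat i σ τ x w)
    (hw' : IsBracketAt hsys hat j σ τ x w') :
    totalMap V δ f i j h ⟨x.1 j, w'⟩ = ⟨x.1 i, w⟩ := by
  refine hw.eq_mk hreg (x.2 i j h) fun θ hθ => ?_
  -- The morphism property gives an `η` which differentiates `θ` and whose pull-back differentiates
  -- the pull-back of `θ`. On sections of the limit the pulled-back forms have the same values as
  -- `θ` and `η`, so both levels have the same `bracketForm`.
  obtain ⟨η, -, h1, h2⟩ := hsys.morphism i j h 1 θ hθ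
  refine ⟨η, h1, ?_⟩
  have h3 := hw' _ _ (isTotalSmooth_pullback h hsys.bundle hθ.isTotalSmooth) h2
  rw [bracketForm, evalOne_pullback, evalOne_pullback, evalTwo_pullback] at h3
  exact h3

end Pointwise

theorem smoothFun_sub (hat : atlas (linLim lB) (ProjLim δ) = limCharts δ lB)
    {g h : ProjLim δ → ℝ} (hg : SmoothFun (linLim lB) g)
    (hh : SmoothFun (linLim lB) h) : SmoothFun (linLim lB) (fun x => g x - h x) :=
  (smoothFun_iff hat).2 fun γ hγ =>
    ((smoothFun_iff hat).1 hg γ hγ).sub ((smoothFun_iff hat).1 hh γ hγ)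

variable {hsys hat} in
/-- A section whose components are the components of the bracket is smooth. -/
theorem isSmoothSection_of_isBracketAt (hreg : ∀ i, SmoothlyRegular (B i) (M i))
    (htr : FiberBundle.trivializationAtlas (linLim lV) (LimBundle V δ f) = limTrivs B δ lV f)
    {σ τ υ : ∀ x, LimBundle V δ f x} (hσ : IsSmoothSection (linLim lB) (linLim lV) σ)
    (hτ : IsSmoothSection (linLim lB) (linLim lV) τ)
    (h : ∀ x i, IsBracketAt hsys hat i σ τ x ((υ x).1 i)) :
    IsSmoothSection (linLim lB) (linLim lV) υ := by
  have := isSmoothManifold_projLim hat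
  refine (isSmoothSection_iff hat htr).2 fun γ hγ i t₀ => ?_
  set x₀ := (γ t₀).1 i with hx₀
  have hxT : x₀ ∈ (trivializationAt (V i) (E i) x₀).baseSet := mem_baseSet_trivializationAt _ _ _
  refine ((trivializationAt (V i) (E i) x₀).contMDiffAt_iff (f := fun t => limComp V i (υ (γ t)))
    (x₀ := t₀) ((Trivialization.mem_source _).2 hxT)).2 ⟨hγ i t₀, ?_⟩
  obtain ⟨g, hg, hgx, C, hCU, hC, hgC⟩ := (hreg i).exists_bump
    ((trivializationAt (V i) (E i) x₀).open_baseSet.mem_nhds hxT)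
  -- The cut-off makes the coordinate meaningful along the whole path. A functional `l` of it is the
  -- pairing of `υ` with `dualForm x₀ g l`, that is, a `bracketForm`, which is a smooth function.
  -- Scalarwise smoothness then suffices.
  have h1 : ContDiff ℝ ∞ (fun t => g ((γ t).1 i) •
      (trivializationAt (V i) (E i) x₀ (limComp V i (υ (γ t)))).2) := by
    refine contDiff_of_forall_dual fun l => ?_
    have hθ := isSmoothForm_dualForm (E := E i) hg hC hCU hgC l
    obtain ⟨η, hη, hd⟩ := hsys.hasDifferentials i 1 _ hθ
    have hsm : SmoothFun (linLim lB) (bracketForm hsys hat i (dualForm x₀ g l) η σ τ) :=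
      smoothFun_sub hat (smoothFun_sub hat
        ((smoothFun_evalOne hat htr hθ.isTotalSmooth hτ).fieldAct
          (smoothField_limAnchor hsys hat htr hσ))
        ((smoothFun_evalOne hat htr hθ.isTotalSmooth hσ).fieldAct
          (smoothField_limAnchor hsys hat htr hτ)))
        (smoothFun_evalTwo hat htr hη hσ hτ)
    convert (smoothFun_iff hat).1 hsm γ hγ using 2 with t
    rw [← h (γ t) i _ η hθ.isTotalSmooth hd,
      dualForm_apply l (fun hn => hgC _ fun hc => hn (hCU hc)), map_smul, smul_eq_mul]
    rfl
  refine h1.contMDiff.contMDiffAt.congr_of_eventuallyEq ?_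
  filter_upwards [(hγ i).continuous.continuousAt.eventually hgx] with t ht
  rw [ht, one_smul]

end LimBracket

/-! ### Bilinearity, antisymmetry and the Leibniz rule -/

section BracketLaws

open Convenient

variable {B : ℕ → Type*} [∀ i, NormedAddCommGroup (B i)] [∀ i, NormedSpace ℝ (B i)]
  [∀ i, CompleteSpace (B i)]
  {M : ℕ → Type*} [∀ i, TopologicalSpace (M i)] [∀ i, ChartedSpace (B i) (M i)]
  [∀ i, IsManifold 𝓘(ℝ, B i) ∞ (M i)]
  {V : ℕ → Type*} [∀ i, NormedAddCommGroup (V i)] [∀ i, NormedSpace ℝ (V i)]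
  [∀ i, CompleteSpace (V i)]
  {E : ∀ i, M i → Type*} [∀ i x, AddCommGroup (E i x)] [∀ i x, Module ℝ (E i x)]
  [∀ i x, TopologicalSpace (E i x)] [∀ i, TopologicalSpace (TotalSpace (V i) (E i))]
  [∀ i, FiberBundle (V i) (E i)] [∀ i, VectorBundle ℝ (V i) (E i)]
  [∀ i, ContMDiffVectorBundle ∞ (V i) (E i) 𝓘(ℝ, B i)]
  {A : ∀ i, BanachLieAlgebroid (B i) (V i) (E i)}
  {δ : ∀ i j, i ≤ j → M j → M i} {lB : ∀ i j, i ≤ j → B j →L[ℝ] B i}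
  {lV : ∀ i j, i ≤ j → V j →L[ℝ] V i}
  {f : ∀ i j (h : i ≤ j) (x : M j), E j x →L[ℝ] E i (δ i j h x)}
  [ChartedSpace (linLim lB) (ProjLim δ)] [FiberBundle (linLim lV) (LimBundle V δ f)]
  [IsSmoothVectorBundle (linLim lB) (linLim lV) (LimBundle V δ f)]

section Evaluation

variable {i : ℕ} (θ : ∀ x, E i x [⋀^Fin 1]→L[ℝ] ℝ) (η : ∀ x, E i x [⋀^Fin 2]→L[ℝ] ℝ)

theorem evalOne_add (σ τ : ∀ x, LimBundle V δ f x) :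
    evalOne i θ (σ + τ) = fun y => evalOne i θ σ y + evalOne i θ τ y :=
  funext fun y => map_add (oneFormLinear (θ (y.1 i))) ((σ y).1 i) ((τ y).1 i)

theorem evalOne_smul (g : ProjLim δ → ℝ) (σ : ∀ x, LimBundle V δ f x) :
    evalOne i θ (fun y => g y • σ y) = fun y => g y * evalOne i θ σ y :=
  funext fun y => map_smul (oneFormLinear (θ (y.1 i))) (g y) ((σ y).1 i)

theorem evalTwo_swap (σ τ : ∀ x, LimBundle V δ f x) (y : ProjLim δ) :
    evalTwo i η σ τ y = -evalTwo i η τ σ y :=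
  alternating_two_swap _ _ _

theorem evalTwo_add_left (σ σ' τ : ∀ x, LimBundle V δ f x) (y : ProjLim δ) :
    evalTwo i η (σ + σ') τ y = evalTwo i η σ τ y + evalTwo i η σ' τ y :=
  map_add (twoFormLinear (η (y.1 i)) ((τ y).1 i)) ((σ y).1 i) ((σ' y).1 i)

theorem evalTwo_smul_left (g : ProjLim δ → ℝ) (σ τ : ∀ x, LimBundle V δ f x) (y : ProjLim δ) :
    evalTwo i η (fun y => g y • σ y) τ y = g y * evalTwo i η σ τ y :=
  map_smul (twoFormLinear (η (y.1 i)) ((τ y).1 i)) (g y) ((σ y).1 i)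

end Evaluation

variable (hreg : ∀ i, SmoothlyRegular (B i) (M i)) (hsys : IsStrongProjAlgebroid A δ lB lV f)
  (hat : atlas (linLim lB) (ProjLim δ) = limCharts δ lB)
  (htr : FiberBundle.trivializationAtlas (linLim lV) (LimBundle V δ f) = limTrivs B δ lV f)

/-- The bracket of two sections of `lim E_i`, at a point. -/
def limBracketVec (σ τ : smoothSections (linLim lB) (linLim lV) (LimBundle V δ f))
    (x : ProjLim δ) : LimBundle V δ f x :=
  limBundleMk (fun i => (exists_isBracketAt hsys hat (hreg i) htr σ.2 τ.2 x).choose)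
    fun i j h => IsBracketAt.totalMap_eq (hreg i) h
      (exists_isBracketAt hsys hat (hreg i) htr σ.2 τ.2 x).choose_spec
      (exists_isBracketAt hsys hat (hreg j) htr σ.2 τ.2 x).choose_spec

theorem isBracketAt_limBracketVec
    (σ τ : smoothSections (linLim lB) (linLim lV) (LimBundle V δ f)) (x : ProjLim δ) (i : ℕ) :
    IsBracketAt hsys hat i σ.1 τ.1 x ((limBracketVec hreg hsys hat htr σ τ x).1 i) :=
  (exists_isBracketAt hsys hat (hreg i) htr σ.2 τ.2 x).choose_spec

/-- The bracket of two sections of `lim E_i`. -/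
def limBracket (σ τ : smoothSections (linLim lB) (linLim lV) (LimBundle V δ f)) :
    smoothSections (linLim lB) (linLim lV) (LimBundle V δ f) :=
  ⟨limBracketVec hreg hsys hat htr σ τ, isSmoothSection_of_isBracketAt hreg htr σ.2 τ.2
    (isBracketAt_limBracketVec hreg hsys hat htr σ τ)⟩

variable {σ σ' τ υ : smoothSections (linLim lB) (linLim lV) (LimBundle V δ f)} {x : ProjLim δ}
  {i : ℕ} {θ : ∀ x, E i x [⋀^Fin 1]→L[ℝ] ℝ} {η : ∀ x, E i x [⋀^Fin 2]→L[ℝ] ℝ}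

theorem evalOne_limBracket (hθ : IsTotalSmooth (B i) (V i) θ) (hd : (A i).IsExtDiff θ η)
    (σ τ : smoothSections (linLim lB) (linLim lV) (LimBundle V δ f)) :
    evalOne i θ (limBracket hreg hsys hat htr σ τ).1 = bracketForm hsys hat i θ η σ.1 τ.1 :=
  funext fun x => isBracketAt_limBracketVec hreg hsys hat htr σ τ x i θ η hθ hd

/-- Smooth `1`-forms on the `E_i` separate the vectors of `lim E_i`. -/
theorem limBundle_eq_of_forall_form (hreg : ∀ i, SmoothlyRegular (B i) (M i))
    {v w : LimBundle V δ f x}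
    (h : ∀ (i : ℕ) (θ : ∀ x, E i x [⋀^Fin 1]→L[ℝ] ℝ), IsSmoothForm (B i) (V i) θ →
      θ (x.1 i) (fun _ => v.1 i) = θ (x.1 i) (fun _ => w.1 i)) : v = w :=
  limBundle_ext fun i => (hreg i).eq_of_forall_form (V := V i) (h i)

/-- The bracket is determined by its pairing with `1`-forms. -/
theorem limBracket_apply_eq {v : LimBundle V δ f x}
    (h : ∀ (i : ℕ) (θ : ∀ x, E i x [⋀^Fin 1]→L[ℝ] ℝ) (η : ∀ x, E i x [⋀^Fin 2]→L[ℝ] ℝ),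
      IsSmoothForm (B i) (V i) θ → (A i).IsExtDiff θ η →
        θ (x.1 i) (fun _ => v.1 i) = bracketForm hsys hat i θ η σ.1 τ.1 x) :
    (limBracket hreg hsys hat htr σ τ).1 x = v := by
  refine limBundle_eq_of_forall_form hreg fun i θ hθ => ?_
  obtain ⟨η, -, hd⟩ := hsys.hasDifferentials i 1 θ hθ
  rw [h i θ η hθ hd, ← evalOne_limBracket hreg hsys hat htr hθ.isTotalSmooth hd]
  rfl

theorem bracketForm_swap (σ τ : ∀ x, LimBundle V δ f x) :
    bracketForm hsys hat i θ η σ τ x = -bracketForm hsys hat i θ η τ σ x := by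
  rw [bracketForm, bracketForm, evalTwo_swap]
  ring

theorem limBracket_swap (σ τ : smoothSections (linLim lB) (linLim lV) (LimBundle V δ f)) :
    limBracket hreg hsys hat htr σ τ = -limBracket hreg hsys hat htr τ σ := by
  refine Subtype.ext (funext fun x => ?_)
  refine limBracket_apply_eq hreg hsys hat htr fun i θ η hθ hd => ?_
  rw [bracketForm_swap, ← evalOne_limBracket hreg hsys hat htr hθ.isTotalSmooth hd]
  exact map_neg (oneFormLinear (θ (x.1 i))) _

theorem limBracket_self (σ : smoothSections (linLim lB) (linLim lV) (LimBundle V δ f)) :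
    limBracket hreg hsys hat htr σ σ = 0 := by
  have h := eq_neg_iff_add_eq_zero.1 (limBracket_swap hreg hsys hat htr σ σ)
  rw [← two_smul ℝ] at h
  rw [← inv_smul_smul₀ (two_ne_zero (α := ℝ)) (limBracket hreg hsys hat htr σ σ), h, smul_zero]

/-- Against a 1-form all three terms of `bracketForm` are additive in the first section, the first
by linearity of the derivative in the direction. -/
theorem limBracket_add_left (σ σ' τ : smoothSections (linLim lB) (linLim lV) (LimBundle V δ f)) :
    limBracket hreg hsys hat htr (σ + σ') τ =
      limBracket hreg hsys hat htr σ τ + limBracket hreg hsys hat htr σ' τ := by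
  refine Subtype.ext (funext fun x => ?_)
  refine limBracket_apply_eq hreg hsys hat htr fun i θ η hθ hd => ?_
  refine (map_add (oneFormLinear (θ (x.1 i))) _ _).trans ?_
  have h1 := congrFun (evalOne_limBracket hreg hsys hat htr hθ.isTotalSmooth hd σ τ) x
  have h2 := congrFun (evalOne_limBracket hreg hsys hat htr hθ.isTotalSmooth hd σ' τ) x
  have hs := fun σ : smoothSections (linLim lB) (linLim lV) (LimBundle V δ f) =>
    smoothFun_evalOne hat htr hθ.isTotalSmooth σ.2
  refine (congrArg₂ (· + ·) h1 h2).trans ?_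
  change _ = bracketForm hsys hat i θ η (σ.1 + σ'.1) τ.1 x
  have h3 : tangentAct (limAnchor hsys hat x ((σ.1 + σ'.1) x)) (evalOne i θ τ.1) =
      tangentAct (limAnchor hsys hat x (σ.1 x)) (evalOne i θ τ.1) +
        tangentAct (limAnchor hsys hat x (σ'.1 x)) (evalOne i θ τ.1) := by
    rw [Pi.add_apply, map_add, (hs τ).tangentAct_add]
  simp only [bracketForm, fieldAct_eq_tangentAct]
  rw [h3, evalOne_add, (hs σ).tangentAct_fun_add (hs σ'), evalTwo_add_left]
  ring

theorem limBracket_smul_left (a : ℝ)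
    (σ τ : smoothSections (linLim lB) (linLim lV) (LimBundle V δ f)) :
    limBracket hreg hsys hat htr (a • σ) τ = a • limBracket hreg hsys hat htr σ τ := by
  refine Subtype.ext (funext fun x => ?_)
  refine limBracket_apply_eq hreg hsys hat htr fun i θ η hθ hd => ?_
  refine (map_smul (oneFormLinear (θ (x.1 i))) _ _).trans ?_
  have h1 := congrFun (evalOne_limBracket hreg hsys hat htr hθ.isTotalSmooth hd σ τ) x
  have hs := fun σ : smoothSections (linLim lB) (linLim lV) (LimBundle V δ f) =>
    smoothFun_evalOne hat htr hθ.isTotalSmooth σ.2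
  refine (congrArg (a • ·) h1).trans ?_
  change _ = bracketForm hsys hat i θ η (fun y => (fun _ => a) y • σ.1 y) τ.1 x
  simp only [bracketForm, fieldAct_eq_tangentAct]
  rw [evalOne_smul, evalTwo_smul_left, map_smul, (hs τ).tangentAct_smul,
    (hs σ).tangentAct_const_mul, smul_eq_mul]
  ring

/-- In `ρ(σ)(g θ(τ_i))` the product rule gives the extra term `(ρ(σ)g) θ(τ_i)`; the other two terms
of `bracketForm` are linear over functions in the second section. -/
theorem limBracket_leibniz {g : ProjLim δ → ℝ} (hg : SmoothFun (linLim lB) g)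
    (hu : ∀ x, υ.1 x = g x • τ.1 x) (x : ProjLim δ) :
    (limBracket hreg hsys hat htr σ υ).1 x = g x • (limBracket hreg hsys hat htr σ τ).1 x +
      fieldAct (fun y => limAnchor hsys hat y (σ.1 y)) g x • τ.1 x := by
  refine limBracket_apply_eq hreg hsys hat htr fun i θ η hθ hd => ?_
  refine (map_add (oneFormLinear (θ (x.1 i))) _ _).trans ?_
  refine (congrArg₂ (· + ·) (map_smul (oneFormLinear (θ (x.1 i))) _ _)
    (map_smul (oneFormLinear (θ (x.1 i))) _ _)).trans ?_
  have h1 := congrFun (evalOne_limBracket hreg hsys hat htr hθ.isTotalSmooth hd σ τ) x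
  have hs := fun σ : smoothSections (linLim lB) (linLim lV) (LimBundle V δ f) =>
    smoothFun_evalOne hat htr hθ.isTotalSmooth σ.2
  have hυ : υ.1 = fun y => g y • τ.1 y := funext hu
  rw [hυ, bracketForm, evalTwo_swap, evalTwo_smul_left, evalOne_smul]
  simp only [fieldAct_eq_tangentAct]
  rw [hg.tangentAct_fun_mul (hs τ), map_smul, (hs σ).tangentAct_smul]
  have h2 : oneFormLinear (θ (x.1 i)) (((limBracket hreg hsys hat htr σ τ).1 x).1 i) =
      bracketForm hsys hat i θ η σ.1 τ.1 x := h1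
  rw [bracketForm, evalTwo_swap] at h2
  simp only [fieldAct_eq_tangentAct] at h2
  refine (congrArg (fun r => g x • r + _) h2).trans ?_
  simp only [smul_eq_mul]
  change _ + _ * evalOne i θ τ.1 x = _
  ring

end BracketLaws

/-! ### The anchor as a Lie morphism, and the Jacobi identity -/

section AnchorBracket

open Convenient

variable {B : ℕ → Type*} [∀ i, NormedAddCommGroup (B i)] [∀ i, NormedSpace ℝ (B i)]
  [∀ i, CompleteSpace (B i)]
  {M : ℕ → Type*} [∀ i, TopologicalSpace (M i)] [∀ i, ChartedSpace (B i) (M i)]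
  [∀ i, IsManifold 𝓘(ℝ, B i) ∞ (M i)]
  {V : ℕ → Type*} [∀ i, NormedAddCommGroup (V i)] [∀ i, NormedSpace ℝ (V i)]
  [∀ i, CompleteSpace (V i)]
  {E : ∀ i, M i → Type*} [∀ i x, AddCommGroup (E i x)] [∀ i x, Module ℝ (E i x)]
  [∀ i x, TopologicalSpace (E i x)] [∀ i, TopologicalSpace (TotalSpace (V i) (E i))]
  [∀ i, FiberBundle (V i) (E i)] [∀ i, VectorBundle ℝ (V i) (E i)]
  [∀ i, ContMDiffVectorBundle ∞ (V i) (E i) 𝓘(ℝ, B i)]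
  {A : ∀ i, BanachLieAlgebroid (B i) (V i) (E i)}
  {δ : ∀ i j, i ≤ j → M j → M i} {lB : ∀ i j, i ≤ j → B j →L[ℝ] B i}
  {lV : ∀ i j, i ≤ j → V j →L[ℝ] V i}
  {f : ∀ i j (h : i ≤ j) (x : M j), E j x →L[ℝ] E i (δ i j h x)}
  [ChartedSpace (linLim lB) (ProjLim δ)] [FiberBundle (linLim lV) (LimBundle V δ f)]

theorem smoothFun_comp (hat : atlas (linLim lB) (ProjLim δ) = limCharts δ lB) {i : ℕ}
    {k : M i → ℝ} (hk : ContMDiff 𝓘(ℝ, B i) 𝓘(ℝ, ℝ) ∞ k) :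
    SmoothFun (linLim lB) (fun y : ProjLim δ => k (y.1 i)) :=
  (smoothFun_iff hat).2 fun _ hγ => contMDiff_iff_contDiff.1 (hk.comp (hγ i))

/-- Smooth functions of the components separate tangent vectors. -/
theorem tangent_eq_of_forall_fun (hreg : ∀ i, SmoothlyRegular (B i) (M i))
    (hat : atlas (linLim lB) (ProjLim δ) = limCharts δ lB) {x : ProjLim δ}
    {v w : Tangent (linLim lB) x}
    (h : ∀ (i : ℕ) (k : M i → ℝ), ContMDiff 𝓘(ℝ, B i) 𝓘(ℝ, ℝ) ∞ k →
      tangentAct v (fun y => k (y.1 i)) = tangentAct w (fun y => k (y.1 i))) : v = w := by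
  obtain ⟨φ, hφ⟩ := isLimChart_of_mem hat (chart_mem_atlas (linLim lB) x)
  have hx := hφ.mem_source (mem_chart_source _ x)
  refine linLim_ext fun i => (SeparatingDual.eq_iff_forall_dual_eq (R := ℝ)).2 fun l => ?_
  obtain ⟨g, hg, hgx, C, hCU, hC, hgC⟩ :=
    (hreg i).exists_bump ((φ i).open_source.mem_nhds (hx i))
  have hk : ContMDiff 𝓘(ℝ, B i) 𝓘(ℝ, ℝ) ∞ (fun y => g y • l (φ i y)) :=
    contMDiff_smul_of_bump hg (φ i).open_source hC hCU hgC
      (l.contMDiff.comp_contMDiffOn (contMDiffOn_of_mem_maximalAtlas (hφ.proj.mem i)))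
  -- The test function is `l ∘ φ i` cut off near `x_i`. Along the coordinate line, `φ i` of the
  -- `i`-th component is affine with slope `u.1 i`.
  have key : ∀ u : linLim lB,
      tangentAct (x := x) u (fun y => g (y.1 i) • l (φ i (y.1 i))) = l (u.1 i) := by
    intro u
    have h1 : HasDerivAt (fun t : ℝ => l ((chartAt (linLim lB) x x + t • u).1 i)) (l (u.1 i)) 0 :=
      l.hasFDerivAt.comp_hasDerivAt 0 (hasDerivAt_line (chartAt (linLim lB) x x) u i 0)
    refine tangentAct_eq_of_hasDerivAt (h1.congr_of_eventuallyEq ?_)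
    have hg1 : ∀ u' : Tangent (linLim lB) x,
        ∀ᶠ t in 𝓝 (0 : ℝ), g ((chartLine x u' t).1 i) = 1 := by
      intro u'
      have hc : ContinuousAt (fun t => (chartLine x u' t).1 i) 0 :=
        (contMDiffAt_chartLine hat x u' i).continuousAt
      refine hc.eventually (p := fun y => g y = 1) ?_
      simp only [chartLine_zero]
      exact hgx
    filter_upwards [hg1 u, eventually_line_mem (chartAt (linLim lB) x).open_target
      (mem_chart_target _ x) u] with t ht1 ht2
    rw [ht1, one_smul]
    refine congrArg l ?_
    have h2 := hφ.symm_apply ht2 i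
    refine (congrArg (φ i) h2).trans ?_
    exact (φ i).right_inv (hφ.mem_target ht2 i)
  have h1 := h i _ hk
  exact (key v).symm.trans (h1.trans (key w))

variable [IsSmoothVectorBundle (linLim lB) (linLim lV) (LimBundle V δ f)]
  (hreg : ∀ i, SmoothlyRegular (B i) (M i)) (hsys : IsStrongProjAlgebroid A δ lB lV f)
  (hat : atlas (linLim lB) (ProjLim δ) = limCharts δ lB)
  (htr : FiberBundle.trivializationAtlas (linLim lV) (LimBundle V δ f) = limTrivs B δ lV f)

/-- For `θ = dk` the function `θ(σ_i)` is `ρ(σ)` applied to `k(x_i)`, and `dθ = 0`. The defining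
formula of the bracket thus becomes the commutator of `ρ(σ)` and `ρ(τ)` on such functions, which
separate tangent vectors. -/
theorem limAnchor_limBracket
    (σ τ : smoothSections (linLim lB) (linLim lV) (LimBundle V δ f)) (x : ProjLim δ) :
    limAnchor hsys hat x ((limBracket hreg hsys hat htr σ τ).1 x) =
      fieldBracket (fun y => limAnchor hsys hat y (σ.1 y))
        (fun y => limAnchor hsys hat y (τ.1 y)) x := by
  have := isSmoothManifold_projLim hat
  refine tangent_eq_of_forall_fun hreg hat fun i k hk => ?_
  obtain ⟨θ, hθ, hθk⟩ := (hsys.hasDifferentials i).exists_form (hreg i) hk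
  have hd : (A i).IsExtDiff θ (fun _ => 0) := by
    refine (A i).isExtDiff_one_iff.2 fun s t y => ?_
    simp only [hθk]
    have := (hsys.hasDifferentials i).act_bracket (hreg i) s t hk y
    change 0 = (A i).act s ((A i).act t k) y - (A i).act t ((A i).act s k) y -
      (A i).act ((A i).bracket s t) k y
    rw [this, sub_self]
  have hev : ∀ υ : smoothSections (linLim lB) (linLim lV) (LimBundle V δ f),
      evalOne i θ υ.1 =
        fieldAct (fun y => limAnchor hsys hat y (υ.1 y)) (fun y => k (y.1 i)) := by
    intro υ
    funext y
    rw [evalOne, hθk, fieldAct_eq_tangentAct,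
      tangentAct_limAnchor_comp hsys hat _ (hk.mdifferentiable (by simp) _)]
  rw [(smoothFun_comp hat hk).tangentAct_fieldBracket (smoothField_limAnchor hsys hat htr σ.2)
    (smoothField_limAnchor hsys hat htr τ.2)]
  have h1 := congrFun (evalOne_limBracket hreg hsys hat htr hθ.isTotalSmooth hd σ τ) x
  rw [hev, bracketForm, hev, hev, evalTwo] at h1
  refine h1.trans ?_
  exact sub_zero _

variable {i : ℕ} {θ : ∀ x, E i x [⋀^Fin 1]→L[ℝ] ℝ} {η : ∀ x, E i x [⋀^Fin 2]→L[ℝ] ℝ}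

theorem twoForm_add_sub_right {W : Type*} [AddCommGroup W] [Module ℝ W] [TopologicalSpace W]
    (η : W [⋀^Fin 2]→L[ℝ] ℝ) (a b c d : W) :
    η ![a, b + c - d] = η ![a, b] + η ![a, c] - η ![a, d] := by
  rw [alternating_two_swap η a (b + c - d), alternating_two_swap η a b, alternating_two_swap η a c,
    alternating_two_swap η a d, ← twoFormLinear_apply, map_sub, map_add]
  simp only [twoFormLinear_apply]
  ring

/-- By uniqueness, the explicit solution holds for every choice of sections of `E_i` with the right
values at `x`; this reduces computations to `E_i`. -/
theorem limBracket_apply_formula (σ τ : smoothSections (linLim lB) (linLim lV) (LimBundle V δ f))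
    {x : ProjLim δ} {s t : Cₛ^∞⟮𝓘(ℝ, B i); V i, E i⟯} (hs : s (x.1 i) = (σ.1 x).1 i)
    (ht : t (x.1 i) = (τ.1 x).1 i) :
    ((limBracket hreg hsys hat htr σ τ).1 x).1 i = (A i).bracket s t (x.1 i) +
      relDeriv τ.1 t x (limAnchor hsys hat x (σ.1 x)) -
        relDeriv σ.1 s x (limAnchor hsys hat x (τ.1 x)) := by
  refine (hreg i).eq_of_forall_form (V := V i) fun θ hθ => ?_
  obtain ⟨η, -, hd⟩ := hsys.hasDifferentials i 1 θ hθ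
  rw [isBracketAt_formula hsys hat htr σ.2 τ.2 hs ht θ η hθ.isTotalSmooth hd]
  exact isBracketAt_limBracketVec hreg hsys hat htr σ τ x i θ η hθ.isTotalSmooth hd

/-- The exterior differential of an exact `2`-form, evaluated on sections of `lim E_i`. -/
theorem cyclic_sum_evalTwo_eq_zero (hθ : IsTotalSmooth (B i) (V i) θ)
    (hη : IsSmoothForm (B i) (V i) η) (hd : (A i).IsExtDiff θ η)
    (σ τ υ : smoothSections (linLim lB) (linLim lV) (LimBundle V δ f)) (x : ProjLim δ) :
    (tangentAct (limAnchor hsys hat x (σ.1 x)) (evalTwo i η τ.1 υ.1) +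
      evalTwo i η σ.1 (limBracket hreg hsys hat htr τ υ).1 x) +
    (tangentAct (limAnchor hsys hat x (τ.1 x)) (evalTwo i η υ.1 σ.1) +
      evalTwo i η τ.1 (limBracket hreg hsys hat htr υ σ).1 x) +
    (tangentAct (limAnchor hsys hat x (υ.1 x)) (evalTwo i η σ.1 τ.1) +
      evalTwo i η υ.1 (limBracket hreg hsys hat htr σ τ).1 x) = 0 := by
  obtain ⟨s, hs⟩ := (hreg i).exists_section (V := V i) (x.1 i) ((σ.1 x).1 i)
  obtain ⟨t, ht⟩ := (hreg i).exists_section (V := V i) (x.1 i) ((τ.1 x).1 i)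
  obtain ⟨u, hu⟩ := (hreg i).exists_section (V := V i) (x.1 i) ((υ.1 x).1 i)
  have h0 := (hsys.hasDifferentials i).cyclic_sum_eq_zero (hreg i) hθ hd s t u (x.1 i)
  rw [tangentAct_evalTwo hsys hat htr hη τ.2 υ.2 ht hu,
    tangentAct_evalTwo hsys hat htr hη υ.2 σ.2 hu hs,
    tangentAct_evalTwo hsys hat htr hη σ.2 τ.2 hs ht, evalTwo, evalTwo, evalTwo,
    limBracket_apply_formula hreg hsys hat htr τ υ ht hu,
    limBracket_apply_formula hreg hsys hat htr υ σ hu hs,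
    limBracket_apply_formula hreg hsys hat htr σ τ hs ht,
    twoForm_add_sub_right, twoForm_add_sub_right, twoForm_add_sub_right, ← hs, ← ht, ← hu]
  simp only [BanachLieAlgebroid.act] at h0
  set a := limAnchor hsys hat x (σ.1 x)
  set b := limAnchor hsys hat x (τ.1 x)
  set c := limAnchor hsys hat x (υ.1 x)
  -- The `relDeriv` terms from differentiating `η` and those from the brackets now cancel in pairs,
  -- by alternation; the identity for `s`, `t`, `u` on `E_i` remains.
  rw [alternating_two_swap (η (x.1 i)) (relDeriv τ.1 t x a) (u (x.1 i)),
    alternating_two_swap (η (x.1 i)) (relDeriv υ.1 u x b) (s (x.1 i)),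
    alternating_two_swap (η (x.1 i)) (relDeriv σ.1 s x c) (t (x.1 i))]
  linear_combination h0

/-- A double bracket paired with `θ` splits into second derivatives of `θ` on the sections and a
term of `d(dθ)`. In the cyclic sum of the Jacobi identity the former cancel identically, and the
latter add up to zero by `cyclic_sum_evalTwo_eq_zero`. -/
theorem evalOne_limBracket_limBracket (hθ : IsTotalSmooth (B i) (V i) θ)
    (hη : IsSmoothForm (B i) (V i) η) (hd : (A i).IsExtDiff θ η)
    (σ τ υ : smoothSections (linLim lB) (linLim lV) (LimBundle V δ f)) (x : ProjLim δ) :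
    evalOne i θ (limBracket hreg hsys hat htr σ (limBracket hreg hsys hat htr τ υ)).1 x =
      tangentAct (limAnchor hsys hat x (σ.1 x))
        (fieldAct (fun y => limAnchor hsys hat y (τ.1 y)) (evalOne i θ υ.1)) -
      tangentAct (limAnchor hsys hat x (σ.1 x))
        (fieldAct (fun y => limAnchor hsys hat y (υ.1 y)) (evalOne i θ τ.1)) -
      (tangentAct (limAnchor hsys hat x (τ.1 x))
        (fieldAct (fun y => limAnchor hsys hat y (υ.1 y)) (evalOne i θ σ.1)) -
      tangentAct (limAnchor hsys hat x (υ.1 x))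
        (fieldAct (fun y => limAnchor hsys hat y (τ.1 y)) (evalOne i θ σ.1))) -
      (tangentAct (limAnchor hsys hat x (σ.1 x)) (evalTwo i η τ.1 υ.1) +
        evalTwo i η σ.1 (limBracket hreg hsys hat htr τ υ).1 x) := by
  have := isSmoothManifold_projLim hat
  have hs := fun σ : smoothSections (linLim lB) (linLim lV) (LimBundle V δ f) =>
    smoothFun_evalOne hat htr hθ σ.2
  have hX := fun σ : smoothSections (linLim lB) (linLim lV) (LimBundle V δ f) =>
    smoothField_limAnchor hsys hat htr σ.2
  rw [evalOne_limBracket hreg hsys hat htr hθ hd, bracketForm,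
    evalOne_limBracket hreg hsys hat htr hθ hd τ υ, fieldAct_eq_tangentAct,
    fieldAct_eq_tangentAct, limAnchor_limBracket,
    (hs σ).tangentAct_fieldBracket (hX τ) (hX υ)]
  have h1 : tangentAct (limAnchor hsys hat x (σ.1 x)) (bracketForm hsys hat i θ η τ.1 υ.1) =
      tangentAct (limAnchor hsys hat x (σ.1 x))
        (fieldAct (fun y => limAnchor hsys hat y (τ.1 y)) (evalOne i θ υ.1)) -
      tangentAct (limAnchor hsys hat x (σ.1 x))
        (fieldAct (fun y => limAnchor hsys hat y (υ.1 y)) (evalOne i θ τ.1)) -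
      tangentAct (limAnchor hsys hat x (σ.1 x)) (evalTwo i η τ.1 υ.1) := by
    rw [← ((hs υ).fieldAct (hX τ)).tangentAct_fun_sub ((hs τ).fieldAct (hX υ)),
      ← (smoothFun_sub hat ((hs υ).fieldAct (hX τ)) ((hs τ).fieldAct (hX υ))).tangentAct_fun_sub
        (smoothFun_evalTwo hat htr hη τ.2 υ.2)]
    rfl
  rw [h1]
  ring

theorem limBracket_jacobi (σ τ υ : smoothSections (linLim lB) (linLim lV) (LimBundle V δ f)) :
    limBracket hreg hsys hat htr σ (limBracket hreg hsys hat htr τ υ) +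
      limBracket hreg hsys hat htr τ (limBracket hreg hsys hat htr υ σ) +
      limBracket hreg hsys hat htr υ (limBracket hreg hsys hat htr σ τ) = 0 := by
  refine Subtype.ext (funext fun x => limBundle_eq_of_forall_form hreg fun i θ hθ => ?_)
  obtain ⟨η, hη, hd⟩ := hsys.hasDifferentials i 1 θ hθ
  refine Eq.trans ?_ (map_zero (oneFormLinear (θ (x.1 i)))).symm
  refine (map_add (oneFormLinear (θ (x.1 i))) _ _).trans ?_
  refine (congrArg (· + _) (map_add (oneFormLinear (θ (x.1 i))) _ _)).trans ?_
  change evalOne i θ (limBracket hreg hsys hat htr σ (limBracket hreg hsys hat htr τ υ)).1 x +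
    evalOne i θ (limBracket hreg hsys hat htr τ (limBracket hreg hsys hat htr υ σ)).1 x +
    evalOne i θ (limBracket hreg hsys hat htr υ (limBracket hreg hsys hat htr σ τ)).1 x = 0
  rw [evalOne_limBracket_limBracket hreg hsys hat htr hθ.isTotalSmooth hη hd,
    evalOne_limBracket_limBracket hreg hsys hat htr hθ.isTotalSmooth hη hd,
    evalOne_limBracket_limBracket hreg hsys hat htr hθ.isTotalSmooth hη hd]
  linear_combination -cyclic_sum_evalTwo_eq_zero hreg hsys hat htr hθ.isTotalSmooth hη hd σ τ υ x

end AnchorBracket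

/-! ### The limit Lie algebroid -/

section LimAlgebroid

open Convenient

variable {B : ℕ → Type*} [∀ i, NormedAddCommGroup (B i)] [∀ i, NormedSpace ℝ (B i)]
  [∀ i, CompleteSpace (B i)]
  {M : ℕ → Type*} [∀ i, TopologicalSpace (M i)] [∀ i, ChartedSpace (B i) (M i)]
  [∀ i, IsManifold 𝓘(ℝ, B i) ∞ (M i)]
  {V : ℕ → Type*} [∀ i, NormedAddCommGroup (V i)] [∀ i, NormedSpace ℝ (V i)]
  [∀ i, CompleteSpace (V i)]
  {E : ∀ i, M i → Type*} [∀ i x, AddCommGroup (E i x)] [∀ i x, Module ℝ (E i x)]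
  [∀ i x, TopologicalSpace (E i x)] [∀ i, TopologicalSpace (TotalSpace (V i) (E i))]
  [∀ i, FiberBundle (V i) (E i)] [∀ i, VectorBundle ℝ (V i) (E i)]
  [∀ i, ContMDiffVectorBundle ∞ (V i) (E i) 𝓘(ℝ, B i)]
  {A : ∀ i, BanachLieAlgebroid (B i) (V i) (E i)}
  {δ : ∀ i j, i ≤ j → M j → M i} {lB : ∀ i j, i ≤ j → B j →L[ℝ] B i}
  {lV : ∀ i j, i ≤ j → V j →L[ℝ] V i}
  {f : ∀ i j (h : i ≤ j) (x : M j), E j x →L[ℝ] E i (δ i j h x)}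
  [ChartedSpace (linLim lB) (ProjLim δ)] [FiberBundle (linLim lV) (LimBundle V δ f)]

section ProjSections

variable {s t : ∀ i, Cₛ^∞⟮𝓘(ℝ, B i); V i, E i⟯}

/-- The limit of a projective sequence of sections. -/
def IsProjSection.lim {s : ∀ i (x : M i), E i x} (hs : IsProjSection δ f s) (x : ProjLim δ) :
    LimBundle V δ f x :=
  limBundleMk (fun i => s i (x.1 i)) fun i j h => by
    have key : ∀ y, δ i j h (x.1 j) = y →
        totalMap V δ f i j h ⟨x.1 j, s j (x.1 j)⟩ = ⟨y, s i y⟩ := by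
      rintro _ rfl
      rw [totalMap, hs i j h]
    exact key _ (x.2 i j h)

theorem IsProjSection.isSmoothSection_lim (hs : IsProjSection δ f (fun i x => s i x))
    (hat : atlas (linLim lB) (ProjLim δ) = limCharts δ lB)
    (htr : FiberBundle.trivializationAtlas (linLim lV) (LimBundle V δ f) = limTrivs B δ lV f) :
    IsSmoothSection (linLim lB) (linLim lV) (hs.lim (V := V)) :=
  (isSmoothSection_iff hat htr).2 fun _ hγ i => (s i).contMDiff.comp (hγ i)

/-- The chain rule: the anchors of projective sections are related by the tangent maps of the `δ`.
-/
theorem IsStrongProjAlgebroid.act_comp (hsys : IsStrongProjAlgebroid A δ lB lV f)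
    (hs : IsProjSection δ f (fun i x => s i x)) {i j : ℕ} (h : i ≤ j) {k : M i → ℝ}
    (hk : ContMDiff 𝓘(ℝ, B i) 𝓘(ℝ, ℝ) ∞ k) (x : M j) :
    (A j).act (s j) (fun y => k (δ i j h y)) x = (A i).act (s i) k (δ i j h x) := by
  have h1 := mfderiv_comp x (hk.mdifferentiable (by simp) (δ i j h x))
    ((hsys.base.smooth i j h).mdifferentiable (by simp) x)
  have h2 := congrArg (fun L => L ((A j).anchor x (s j x))) h1
  refine h2.trans ?_
  have h3 : (A i).anchor (δ i j h x) (s i (δ i j h x)) =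
      mfderiv 𝓘(ℝ, B j) 𝓘(ℝ, B i) (δ i j h) x ((A j).anchor x (s j x)) := by
    rw [← hsys.anchor_comp]
    exact congrArg _ (hs i j h x).symm
  exact congrArg (mfderiv 𝓘(ℝ, B i) 𝓘(ℝ, ℝ) k (δ i j h x)) h3.symm

/-- Compare `dθ` on `s i`, `t i` with the differential of the pull-back of `θ` on `s j`, `t j`. All
terms except those with the brackets agree, so the brackets pair equally with every `θ`. This works
at each point of `M j`, on a thread or not. -/
theorem IsStrongProjAlgebroid.isProjSection_bracket (hsys : IsStrongProjAlgebroid A δ lB lV f)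
    (hreg : ∀ i, SmoothlyRegular (B i) (M i)) (hs : IsProjSection δ f (fun i x => s i x))
    (ht : IsProjSection δ f (fun i x => t i x)) :
    IsProjSection δ f (fun i x => (A i).bracket (s i) (t i) x) := by
  intro i j h x
  refine (hreg i).eq_of_forall_form (V := V i) fun θ hθ => ?_
  obtain ⟨η, hη, h1, h2⟩ := hsys.morphism i j h 1 θ hθ
  have h3 := (A i).isExtDiff_one_iff.1 h1 (s i) (t i) (δ i j h x)
  have h4 := (A j).isExtDiff_one_iff.1 h2 (s j) (t j) x
  have key : ∀ r : ∀ i, Cₛ^∞⟮𝓘(ℝ, B i); V i, E i⟯, IsProjSection δ f (fun i x => r i x) →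
      (fun y => (θ (δ i j h y)).compContinuousLinearMap (f i j h y) (fun _ => r j y)) =
        fun y => (fun z => θ z (fun _ => r i z)) (δ i j h y) := by
    intro r hr
    funext y
    have : f i j h y (r j y) = r i (δ i j h y) := hr i j h y
    exact congrArg (fun e => θ (δ i j h y) (fun _ => e)) this
  have hη2 := twoForm_totalMap (V := V) h η (x := x) (a := s j x) (b := t j x)
    (congrArg (TotalSpace.mk _) (hs i j h x)) (congrArg (TotalSpace.mk _) (ht i j h x))
  rw [hη2, key t ht, key s hs, hsys.act_comp hs h (hθ.isTotalSmooth.contMDiff_section (t i)),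
    hsys.act_comp ht h (hθ.isTotalSmooth.contMDiff_section (s i)), h3] at h4
  exact (sub_right_inj.1 h4).symm

/-- For a limit section, the `i`-th section itself serves as comparison along all of the limit, so
the correction terms of the bracket vanish. -/
theorem relDeriv_eq_zero {i : ℕ} {σ : ∀ x, LimBundle V δ f x} {s : Cₛ^∞⟮𝓘(ℝ, B i); V i, E i⟯}
    (h : ∀ x, (σ x).1 i = s (x.1 i)) (x : ProjLim δ) (a : Tangent (linLim lB) x) :
    relDeriv σ s x a = 0 := by
  have h1 : (fun t => lineCoord i σ x a t - lineCoordBase s x a t) = fun _ => 0 := by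
    funext t
    rw [lineCoord, lineCoordBase, limComp, h, sub_self]
  rw [relDeriv, h1, deriv_const, map_zero]

end ProjSections

variable [IsSmoothVectorBundle (linLim lB) (linLim lV) (LimBundle V δ f)]
  (hreg : ∀ i, SmoothlyRegular (B i) (M i)) (hsys : IsStrongProjAlgebroid A δ lB lV f)
  (hat : atlas (linLim lB) (ProjLim δ) = limCharts δ lB)
  (htr : FiberBundle.trivializationAtlas (linLim lV) (LimBundle V δ f) = limTrivs B δ lV f)

/-- The bracket of sections of `lim E_i` as a bilinear map. -/
def limBracketLinear : smoothSections (linLim lB) (linLim lV) (LimBundle V δ f) →ₗ[ℝ]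
    smoothSections (linLim lB) (linLim lV) (LimBundle V δ f) →ₗ[ℝ]
      smoothSections (linLim lB) (linLim lV) (LimBundle V δ f) :=
  LinearMap.mk₂ ℝ (limBracket hreg hsys hat htr) (limBracket_add_left hreg hsys hat htr)
    (limBracket_smul_left hreg hsys hat htr)
    (fun σ τ τ' => by
      rw [limBracket_swap, limBracket_add_left, limBracket_swap _ _ _ _ σ τ,
        limBracket_swap _ _ _ _ σ τ', neg_add])
    (fun a σ τ => by
      rw [limBracket_swap, limBracket_smul_left, limBracket_swap _ _ _ _ σ τ, smul_neg])

/-- The limit of a strong projective system of Banach Lie algebroids. -/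
def limLieAlgebroid : LieAlgebroid (linLim lB) (linLim lV) (LimBundle V δ f) where
  anchor := limAnchor hsys hat
  smooth_anchor _ hT _ he := smoothOn_limAnchor hsys hat htr hT he
  bracket := limBracketLinear hreg hsys hat htr
  bracket_self := limBracket_self hreg hsys hat htr
  jacobi := limBracket_jacobi hreg hsys hat htr
  anchor_bracket := limAnchor_limBracket hreg hsys hat htr
  leibniz _ hg _ _ _ hu x := limBracket_leibniz hreg hsys hat htr hg hu x

theorem isLimSection_limBracket {s t : ∀ i, Cₛ^∞⟮𝓘(ℝ, B i); V i, E i⟯}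
    {σ τ : smoothSections (linLim lB) (linLim lV) (LimBundle V δ f)}
    (hσ : IsLimSection δ f σ.1 (fun i x => s i x)) (hτ : IsLimSection δ f τ.1 (fun i x => t i x)) :
    IsLimSection δ f (limBracket hreg hsys hat htr σ τ).1
      (fun i x => (A i).bracket (s i) (t i) x) := by
  intro x i
  rw [limBracket_apply_formula hreg hsys hat htr σ τ (hσ x i).symm (hτ x i).symm,
    relDeriv_eq_zero fun y => hσ y i, relDeriv_eq_zero fun y => hτ y i, add_zero, sub_zero]

end LimAlgebroid

end

theorem mainTheorem1
    {B : ℕ → Type*} [∀ i, NormedAddCommGroup (B i)] [∀ i, NormedSpace ℝ (B i)]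
    [∀ i, CompleteSpace (B i)]
    {M : ℕ → Type*} [∀ i, TopologicalSpace (M i)] [∀ i, ChartedSpace (B i) (M i)]
    [∀ i, IsManifold 𝓘(ℝ, B i) ∞ (M i)]
    {V : ℕ → Type*} [∀ i, NormedAddCommGroup (V i)] [∀ i, NormedSpace ℝ (V i)]
    [∀ i, CompleteSpace (V i)]
    {E : ∀ i, M i → Type*} [∀ i x, AddCommGroup (E i x)] [∀ i x, Module ℝ (E i x)]
    [∀ i x, TopologicalSpace (E i x)] [∀ i, TopologicalSpace (TotalSpace (V i) (E i))]
    [∀ i, FiberBundle (V i) (E i)] [∀ i, VectorBundle ℝ (V i) (E i)]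
    [∀ i, ContMDiffVectorBundle ∞ (V i) (E i) 𝓘(ℝ, B i)]
    (hreg : ∀ i, SmoothlyRegular (B i) (M i))
    (A : ∀ i, BanachLieAlgebroid (B i) (V i) (E i))
    (δ : ∀ i j, i ≤ j → M j → M i) (lB : ∀ i j, i ≤ j → B j →L[ℝ] B i)
    (lV : ∀ i j, i ≤ j → V j →L[ℝ] V i)
    (f : ∀ i j (h : i ≤ j) (x : M j), E j x →L[ℝ] E i (δ i j h x))
    (hsys : IsStrongProjAlgebroid A δ lB lV f) :
    Convenient.IsFrechetSpace (linLim lB) ∧ Convenient.IsFrechetSpace (linLim lV) ∧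
    -- `lim M_i` is a Fréchet manifold for the charts `lim φ_i`
    ∃ (_ : ChartedSpace (linLim lB) (ProjLim δ)),
      atlas (linLim lB) (ProjLim δ) = limCharts δ lB ∧
      Convenient.IsSmoothManifold (linLim lB) (ProjLim δ) ∧
    -- `lim E_i` is a Fréchet vector bundle for the trivializations `lim τ_i`
    ∃ (_ : FiberBundle (linLim lV) (LimBundle V δ f)),
      FiberBundle.trivializationAtlas (linLim lV) (LimBundle V δ f) = limTrivs B δ lV f ∧
    ∃ (_ : Convenient.IsSmoothVectorBundle (linLim lB) (linLim lV) (LimBundle V δ f))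
      (L : Convenient.LieAlgebroid (linLim lB) (linLim lV) (LimBundle V δ f)),
      -- the anchor is the projective limit of the anchors
      (∀ (x : ProjLim δ) (v : LimBundle V δ f x) (i : ℕ),
        Convenient.tangentMap (G := B i) (fun y : ProjLim δ => y.1 i) x (L.anchor x v) =
          (A i).anchor (x.1 i) (v.1 i)) ∧
      -- projective sequences of smooth sections have smooth limits
      (∀ s : ∀ i, Cₛ^∞⟮𝓘(ℝ, B i); V i, E i⟯, IsProjSection δ f (fun i x => s i x) →
        ∃ σ : Convenient.smoothSections (linLim lB) (linLim lV) (LimBundle V δ f),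
          IsLimSection δ f σ.1 (fun i x => s i x)) ∧
      -- on limit sections the bracket is the projective limit of the brackets
      (∀ s t : ∀ i, Cₛ^∞⟮𝓘(ℝ, B i); V i, E i⟯,
        IsProjSection δ f (fun i x => s i x) → IsProjSection δ f (fun i x => t i x) →
        IsProjSection δ f (fun i x => (A i).bracket (s i) (t i) x) ∧
        ∀ σ τ : Convenient.smoothSections (linLim lB) (linLim lV) (LimBundle V δ f),
          IsLimSection δ f σ.1 (fun i x => s i x) → IsLimSection δ f τ.1 (fun i x => t i x) →
          IsLimSection δ f (L.bracket σ τ).1 (fun i x => (A i).bracket (s i) (t i) x)) := by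
  -- The atlas consists of all limit charts, and likewise for the trivializations below. Choice
  -- enters only in the preferred ones, and the constructions use them only through `hat` and `htr`.
  let _ : ChartedSpace (linLim lB) (ProjLim δ) := hsys.base.chartedSpace
  have hat : atlas (linLim lB) (ProjLim δ) = limCharts δ lB := rfl
  let _ : FiberBundle (linLim lV) (LimBundle V δ f) := hsys.bundle.fiberBundle
  have htr : FiberBundle.trivializationAtlas (linLim lV) (LimBundle V δ f) =
      limTrivs B δ lV f := rfl
  have hvb : Convenient.IsSmoothVectorBundle (linLim lB) (linLim lV) (LimBundle V δ f) :=
    isSmoothVectorBundle_limBundle hat htr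
  refine ⟨Convenient.isFrechetSpace_linLim, Convenient.isFrechetSpace_linLim,
    inferInstance, hat, isSmoothManifold_projLim hat, inferInstance, htr, hvb,
    limLieAlgebroid hreg hsys hat htr, fun x v i => tangentMap_limAnchor hsys hat v i,
    fun s hs => ⟨⟨hs.lim, hs.isSmoothSection_lim hat htr⟩, fun x i => rfl⟩,
    fun s t hs ht => ⟨hsys.isProjSection_bracket hreg hs ht, fun σ τ hσ hτ =>
      isLimSection_limBracket hreg hsys hat htr hσ hτ⟩⟩
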